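/- Let $n\ge 2$, $m\ge 2$ and let $\mathbf d=(d_1,\dots,d_m)$ be positive integers with $d=\sum_i d_i$. If $m=2$, assume moreover that $d_1\nmid d_2$ and $d_2\nmid d_1$. Let $S_n(k)$ be the space of homogeneous polynomials of degree $k$ in $\mathbb C[x_0,\dots,x_n]$, let $$H=H^0(\mathbb P^n,\Omega^1_{\mathbb P^n}(d))=\Big\{\sum_{j=0}^n a_j\,dx_j : a_j\in S_n(d-1),\ \sum_j x_ja_j=0\Big\},$$ $$\Lambda(\mathbf d)=\Big\{\lambda\in\mathbb C^m:\sum_i d_i\lambda_i=0\Big\},\qquad X=\mathbb P\Lambda(\mathbf d)\times\prod_{i=1}^m\mathbb P S_n(d_i).$$ For $\lambda\in\mathbb C^m$ and $F_i\in S_n(d_i)$ put $\mu(\lambda,F)=\sum_{i=1}^m\lambda_i\big(\prod_{k\ne i}F_k\big)\,dF_i$; it lies in $H$ when $\lambda\in\Lambda(\mathbf d)$. Let $\mathbf L_n(\mathbf d)\subset\mathbb P H$ be the Zariski closure of the set of points $[\omega]$ with $0\ne\omega\in H$ of the form $\omega=\mu(\lambda,F)$, where $\lambda\in\mathbb C^m$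 and $F_i\in S_n(d_i)\setminus\{0\}$. Let $\rho: X\dashrightarrow \mathbf L_n(\mathbf d)$ be the rational map $\rho([\lambda],[F_1],\dots,[F_m])=[\mu(\lambda,F)]$, defined on the set $\operatorname{dom}\rho$ of points where $\mu(\lambda,F)\ne0$. Let $\mathbb S(\mathbf d)$ be the group of permutations $\sigma$ of $\{1,\dots,m\}$ with $d_{\sigma(i)}=d_i$ for all $i$; it acts on $X$ by permuting the $\lambda_i$ and the $F_i$ simultaneously. Then: 1. (Generic injectivity up to order) There is a dense Zariski open subset $V\subset\mathbf L_n(\mathbf d)$, contained in the image of $\rho$, such that for all $x,x'\in\operatorname{dom}\rho$ with $\rho(x)\in V$ one has $\rho(x)=\rho(x')$ if and only if $x'=\sigma x$ for some $\sigma\in\mathbb S(\mathbf d)$. 2. (Birationality modulo $\mathbb S(\mathbf d)$) $\rho$ induces a birational map $X/\mathbb S(\mathbf d)\dashrightarrow\mathbf L_n(\mathbf d)$: there are dense Zariski open subsets $A\subset X/\mathbb S(\mathbf d)$ and $B\subset\mathbf L_n(\mathbf d)$, with the preimage of $A$ in $X$ contained in $\operatorname{dom}\rho$, and an isomorphism of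 varieties $A\to B$ that sends the class of $x$ to $\rho(x)$. 3. $\dim\mathbf L_n(\mathbf d)=\dim X$. -/

import Mathlib

open scoped LinearAlgebra.Projectivization

noncomputable section

namespace LogForms

/-! ### Spaces with functions

Complex algebraic varieties are treated classically: a variety is the set of its closed points, with
the Zariski topology and, for each open set, the complex-valued functions that are regular on it. -/

/-- A topological space with a notion of regular complex function: `RegularOn U f` says that the
restriction of `f` to the open set `U` is regular (the values of `f` off `U` play no role). -/
class SpaceWithFunctions (X : Type*) extends TopologicalSpace X where
  RegularOn : Set X → (X → ℂ) → Prop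

/-- The structure induced on a subset `Y`: the subspace topology, and the functions that are locally
restrictions of regular functions of the ambient space. -/
instance instSubtype {X : Type*} [SpaceWithFunctions X] (Y : Set X) : SpaceWithFunctions Y where
  toTopologicalSpace := instTopologicalSpaceSubtype
  RegularOn U f := ∀ y ∈ U, ∃ (O : Set X) (g : X → ℂ), IsOpen O ∧ (y : X) ∈ O ∧
    SpaceWithFunctions.RegularOn O g ∧ ∀ z ∈ U, (z : X) ∈ O → f z = g z

/-- The structure on the quotient by an equivalence relation (for the orbits of a finite group, the
quotient variety): the quotient topology, and the functions whose pull-back is regular. -/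
instance instQuotient {X : Type*} [SpaceWithFunctions X] (s : Setoid X) :
    SpaceWithFunctions (Quotient s) where
  toTopologicalSpace := instTopologicalSpaceQuotient
  RegularOn U f := SpaceWithFunctions.RegularOn ((Quotient.mk s) ⁻¹' U) (f ∘ Quotient.mk s)

/-- An isomorphism of spaces with functions: a homeomorphism that identifies the regular functions
on corresponding open sets. -/
structure Iso (X Y : Type*) [SpaceWithFunctions X] [SpaceWithFunctions Y] extends X ≃ₜ Y where
  regularOn_iff : ∀ (U : Set Y) (f : Y → ℂ), IsOpen U →
    (SpaceWithFunctions.RegularOn U f ↔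
      SpaceWithFunctions.RegularOn (toHomeomorph ⁻¹' U) (f ∘ toHomeomorph))

/-! ### Zariski topology and regular functions through cones -/

/-- The algebra of polynomial functions on a complex vector space: it is generated by the linear
functionals. -/
def polyFun (W : Type*) [AddCommGroup W] [Module ℂ W] : Subalgebra ℂ (W → ℂ) :=
  Algebra.adjoin ℂ (Set.range fun φ : Module.Dual ℂ W => (φ : W → ℂ))

/-- The Zariski topology on a complex vector space, generated by the sets `p ≠ 0` with `p` a
polynomial function. -/
abbrev zariski (W : Type*) [AddCommGroup W] [Module ℂ W] : TopologicalSpace W :=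
  TopologicalSpace.generateFrom {U | ∃ p ∈ polyFun W, U = {w | p w ≠ 0}}

/-- The structure that a set `X` receives from a surjection `π : C → X`, where `C` is a subset of a
vector space `W` and `π` forgets scalar factors (such as `W ∖ {0} → ℙ W`). A subset of `X` is open
if its cone is Zariski open in `C`. A function is regular on `U` if on the cone over `U` it is
locally a quotient of polynomial functions; as `f ∘ π` is invariant under scaling, numerator and
denominator can then be taken homogeneous of the same degree. -/
@[reducible]
def coneStructure {W X : Type*} [AddCommGroup W] [Module ℂ W] {C : Set W} (π : C → X) :
    SpaceWithFunctions X where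
  toTopologicalSpace :=
    TopologicalSpace.coinduced π (TopologicalSpace.induced Subtype.val (zariski W))
  RegularOn U f := ∀ v : C, π v ∈ U → ∃ p ∈ polyFun W, ∃ q ∈ polyFun W, q (v : W) ≠ 0 ∧
    ∀ w : C, π w ∈ U → q (w : W) ≠ 0 → f (π w) = p (w : W) / q (w : W)

/-- The projective space of a complex vector space `V`, as an algebraic variety. -/
def ProjSpace (V : Type*) [AddCommGroup V] [Module ℂ V] : Type _ := ℙ ℂ V

/-- The projection `V ∖ {0} → ℙ V`. -/
def ProjSpace.proj (V : Type*) [AddCommGroup V] [Module ℂ V] (v : {v : V | v ≠ 0}) :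
    ProjSpace V :=
  Projectivization.mk ℂ v.1 v.2

instance (V : Type*) [AddCommGroup V] [Module ℂ V] : SpaceWithFunctions (ProjSpace V) :=
  coneStructure (ProjSpace.proj V)

/-! ### Logarithmic forms -/

/-- The ring `ℂ[x₀, …, xₙ]`. -/
abbrev Poly (n : ℕ) : Type := MvPolynomial (Fin (n + 1)) ℂ

/-- The homogeneous polynomials of degree `k` in `x₀, …, xₙ`. -/
abbrev HomPoly (n k : ℕ) : Submodule ℂ (Poly n) :=
  MvPolynomial.homogeneousSubmodule (Fin (n + 1)) ℂ k

/-- The projective one-forms of degree `e`, that is, `H⁰(ℙⁿ, Ω¹(e))`, for `e ≥ 1`: the forms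
`∑ aⱼ dxⱼ` with `aⱼ` homogeneous of degree `e - 1` and `∑ xⱼ aⱼ = 0`. The form `∑ aⱼ dxⱼ` is given
by its coefficient vector `a`. -/
def ProjForm (n e : ℕ) : Submodule ℂ (Fin (n + 1) → Poly n) where
  carrier := {a | (∀ j, a j ∈ HomPoly n (e - 1)) ∧ ∑ j, MvPolynomial.X j * a j = 0}
  zero_mem' := ⟨fun _ => Submodule.zero_mem _, by simp⟩
  add_mem' := fun {a b} ha hb => ⟨fun j => Submodule.add_mem _ (ha.1 j) (hb.1 j), by
    simp only [Pi.add_apply, mul_add, Finset.sum_add_distrib, ha.2, hb.2, add_zero]⟩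
  smul_mem' := fun c a ha => ⟨fun j => Submodule.smul_mem _ c (ha.1 j), by
    simp only [Pi.smul_apply, mul_smul_comm, ← Finset.smul_sum, ha.2, smul_zero]⟩

variable {m : ℕ}

/-- The one-form `∑ᵢ λᵢ (∏_{k ≠ i} F_k) dFᵢ`, by its coefficient vector. -/
def logForm {n : ℕ} (l : Fin m → ℂ) (F : Fin m → Poly n) : Fin (n + 1) → Poly n :=
  fun j => ∑ i, l i • ((∏ k ∈ Finset.univ.erase i, F k) * MvPolynomial.pderiv j (F i))

/-- The set of projective logarithmic one-forms of type `d`. -/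
def logForms (n : ℕ) (d : Fin m → ℕ) : Set (ProjForm n (∑ i, d i)) :=
  {ω | ∃ (l : Fin m → ℂ) (F : Fin m → Poly n), (∀ i, F i ∈ HomPoly n (d i)) ∧ (∀ i, F i ≠ 0) ∧
    (ω : Fin (n + 1) → Poly n) = logForm l F}

/-- The logarithmic component: the Zariski closure, in the projective space of projective one-forms
of degree `∑ dᵢ`, of the set of points given by non-zero logarithmic forms of type `d`. -/
def LogComponent (n : ℕ) (d : Fin m → ℕ) : Set (ProjSpace (ProjForm n (∑ i, d i))) :=
  closure {y | ∃ ω, ∃ h : ω ≠ 0, ω ∈ logForms n d ∧ y = ProjSpace.proj _ ⟨ω, h⟩}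

/-- The hyperplane `∑ dᵢ λᵢ = 0` in `ℂᵐ`. -/
def Residues (d : Fin m → ℕ) : Submodule ℂ (Fin m → ℂ) where
  carrier := {l | ∑ i, (d i : ℂ) * l i = 0}
  zero_mem' := by simp
  add_mem' := fun {a b} ha hb => by
    simp only [Set.mem_ofPred_eq] at ha hb ⊢
    simp only [Pi.add_apply, mul_add, Finset.sum_add_distrib, ha, hb, add_zero]
  smul_mem' := fun c a ha => by
    simp only [Set.mem_ofPred_eq] at ha ⊢
    simp only [Pi.smul_apply, smul_eq_mul, mul_left_comm _ c, ← Finset.mul_sum, ha, mul_zero]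

theorem logForm_mem {n : ℕ} (d : Fin m → ℕ) (l : Residues d) (F : ∀ i, HomPoly n (d i)) :
    logForm l.1 (fun i => (F i : Poly n)) ∈ ProjForm n (∑ i, d i) := by
  have hF : ∀ i, (F i : Poly n).IsHomogeneous (d i) := fun i =>
    (MvPolynomial.mem_homogeneousSubmodule _ _).1 (F i).2
  refine ⟨fun j => Submodule.sum_mem _ fun i _ => Submodule.smul_mem _ _ ?_, ?_⟩
  · change MvPolynomial.IsHomogeneous ((∏ k ∈ Finset.univ.erase i, (F k : Poly n)) *
      MvPolynomial.pderiv j (F i : Poly n)) (∑ i, d i - 1)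
    by_cases hi : d i = 0
    · have h0 : (F i : Poly n).totalDegree = 0 := Nat.le_zero.1 (hi ▸ (hF i).totalDegree_le)
      rw [MvPolynomial.totalDegree_eq_zero_iff_eq_C.1 h0, MvPolynomial.pderiv_C, mul_zero]
      exact MvPolynomial.isHomogeneous_zero _ _ _
    · have h := (MvPolynomial.IsHomogeneous.prod (Finset.univ.erase i) (fun k => (F k : Poly n)) d
        fun k _ => hF k).mul ((hF i).pderiv (i := j))
      have hs := Finset.add_sum_erase Finset.univ d (Finset.mem_univ i)
      convert h using 1
      omega
  · have hE : ∀ i, ∑ j, MvPolynomial.X j * MvPolynomial.pderiv j (F i : Poly n)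
        = d i • (F i : Poly n) := fun i => (hF i).sum_X_mul_pderiv
    have key : ∀ i, ∑ j, MvPolynomial.X j * (l.1 i •
        ((∏ k ∈ Finset.univ.erase i, (F k : Poly n)) * MvPolynomial.pderiv j (F i : Poly n)))
        = ((d i : ℂ) * l.1 i) • ∏ k, (F k : Poly n) := by
      intro i
      have : ∀ j, MvPolynomial.X j * (l.1 i •
          ((∏ k ∈ Finset.univ.erase i, (F k : Poly n)) * MvPolynomial.pderiv j (F i : Poly n)))
          = l.1 i • ((∏ k ∈ Finset.univ.erase i, (F k : Poly n)) *
            (MvPolynomial.X j * MvPolynomial.pderiv j (F i : Poly n))) := by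
        intro j
        rw [mul_smul_comm, mul_left_comm]
      simp only [this]
      rw [← Finset.smul_sum, ← Finset.mul_sum, hE, mul_smul_comm, mul_comm,
        Finset.mul_prod_erase Finset.univ (fun k => (F k : Poly n)) (Finset.mem_univ i),
        ← Nat.cast_smul_eq_nsmul ℂ, smul_smul, mul_comm]
    simp only [logForm, Finset.mul_sum]
    rw [Finset.sum_comm]
    simp only [key]
    rw [← Finset.sum_smul, show ∑ i, (d i : ℂ) * l.1 i = 0 from l.2, zero_smul]

/-- The multilinear map `μ(λ, F) = ∑ᵢ λᵢ (∏_{k ≠ i} F_k) dFᵢ`. -/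
def mu (n : ℕ) (d : Fin m → ℕ) (v : Residues d × (∀ i, HomPoly n (d i))) :
    ProjForm n (∑ i, d i) :=
  ⟨logForm v.1.1 (fun i => (v.2 i : Poly n)), logForm_mem d v.1 v.2⟩

/-! ### The parameter space and the rational parametrization -/

/-- The product of the projective space of `Residues d` with the projective spaces of the
`HomPoly n (d i)`, as an algebraic variety. -/
def ParamSpace (n : ℕ) (d : Fin m → ℕ) : Type :=
  ℙ ℂ (Residues d) × (∀ i, ℙ ℂ (HomPoly n (d i)))

/-- The cone over the parameter space: `(λ, F)` with `λ` and all `Fᵢ` non-zero. -/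
def ParamCone (n : ℕ) (d : Fin m → ℕ) : Set (Residues d × (∀ i, HomPoly n (d i))) :=
  {v | v.1 ≠ 0 ∧ ∀ i, v.2 i ≠ 0}

/-- The projection of the cone onto the parameter space. -/
def ParamSpace.proj (n : ℕ) (d : Fin m → ℕ) (v : ParamCone n d) : ParamSpace n d :=
  (Projectivization.mk ℂ v.1.1 v.2.1, fun i => Projectivization.mk ℂ (v.1.2 i) (v.2.2 i))

instance (n : ℕ) (d : Fin m → ℕ) : SpaceWithFunctions (ParamSpace n d) :=
  coneStructure (ParamSpace.proj n d)

/-- A choice of homogeneous coordinates of a point of the parameter space. -/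
def ParamSpace.rep {n : ℕ} {d : Fin m → ℕ} (x : ParamSpace n d) :
    Residues d × (∀ i, HomPoly n (d i)) :=
  (x.1.rep, fun i => (x.2 i).rep)

theorem mu_smul (n : ℕ) (d : Fin m → ℕ) (v : Residues d × (∀ i, HomPoly n (d i))) (c : ℂ)
    (a : Fin m → ℂ) :
    mu n d (c • v.1, fun i => a i • v.2 i) = (c * ∏ i, a i) • mu n d v := by
  apply Subtype.ext
  funext j
  simp only [mu, logForm, Submodule.coe_smul, Pi.smul_apply, Derivation.map_smul, Finset.smul_sum,
    smul_eq_mul]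
  refine Finset.sum_congr rfl fun i _ => ?_
  rw [show ∏ k ∈ Finset.univ.erase i, a k • (v.2 k : Poly n)
      = (∏ k ∈ Finset.univ.erase i, a k) • ∏ k ∈ Finset.univ.erase i, (v.2 k : Poly n) from
      Finset.prod_smul _ _ _, ← Finset.mul_prod_erase Finset.univ a (Finset.mem_univ i)]
  simp only [smul_mul_assoc, mul_smul_comm, smul_smul]
  congr 1
  ring

/-- The complement of the base locus: the points at which `μ` does not vanish. -/
def rhoDomain (n : ℕ) (d : Fin m → ℕ) : Set (ParamSpace n d) :=
  {x | mu n d x.rep ≠ 0}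

theorem proj_mem_logComponent (n : ℕ) (d : Fin m → ℕ) (x : rhoDomain n d) :
    ProjSpace.proj _ ⟨mu n d x.1.rep, x.2⟩ ∈ LogComponent n d :=
  subset_closure ⟨_, x.2, ⟨_, _, fun i => (x.1.rep.2 i).2,
    fun i h => (x.1.2 i).rep_nonzero (Subtype.ext h), rfl⟩, rfl⟩

/-- The rational parametrization `ρ`, from the complement of its base locus to the logarithmic
component. -/
def rho (n : ℕ) (d : Fin m → ℕ) (x : rhoDomain n d) : LogComponent n d :=
  ⟨ProjSpace.proj _ ⟨mu n d x.1.rep, x.2⟩, proj_mem_logComponent n d x⟩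

theorem exists_rep_proj (n : ℕ) (d : Fin m → ℕ) (v : ParamCone n d) :
    ∃ c : ℂ, c ≠ 0 ∧ mu n d (ParamSpace.proj n d v).rep = c • mu n d v.1 := by
  obtain ⟨c, hc⟩ := Projectivization.exists_smul_eq_mk_rep ℂ v.1.1 v.2.1
  choose a ha using fun i => Projectivization.exists_smul_eq_mk_rep ℂ (v.1.2 i) (v.2.2 i)
  refine ⟨(c : ℂ) * ∏ i, (a i : ℂ), mul_ne_zero c.ne_zero
    (Finset.prod_ne_zero_iff.2 fun i _ => (a i).ne_zero), ?_⟩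
  rw [← mu_smul]
  congr 1
  exact Prod.ext hc.symm (funext fun i => (ha i).symm)

theorem proj_mem_rhoDomain (n : ℕ) (d : Fin m → ℕ) (v : ParamCone n d) :
    ParamSpace.proj n d v ∈ rhoDomain n d ↔ mu n d v.1 ≠ 0 := by
  obtain ⟨c, hc, h⟩ := exists_rep_proj n d v
  simp only [rhoDomain, Set.mem_ofPred_eq, h, ne_eq, smul_eq_zero, hc, false_or]

/-- The formula `ρ(π(λ), π(F)) = π(μ(λ, F))`. -/
theorem rho_proj (n : ℕ) (d : Fin m → ℕ) (v : ParamCone n d) (hv : mu n d v.1 ≠ 0) :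
    (rho n d ⟨ParamSpace.proj n d v, (proj_mem_rhoDomain n d v).2 hv⟩ :
      ProjSpace (ProjForm n (∑ i, d i))) = ProjSpace.proj _ ⟨mu n d v.1, hv⟩ := by
  obtain ⟨c, _, h⟩ := exists_rep_proj n d v
  exact (Projectivization.mk_eq_mk_iff' ℂ _ _ _ _).2 ⟨c, h.symm⟩

/-! ### Permutations of the entries of equal degree -/

/-- The group of permutations of the indices that only permute indices with equal `dᵢ`. -/
def degreePerm (d : Fin m → ℕ) : Subgroup (Equiv.Perm (Fin m)) where
  carrier := {s | ∀ i, d (s i) = d i}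
  one_mem' := fun _ => rfl
  mul_mem' := fun {a b} ha hb i => (ha (b i)).trans (hb i)
  inv_mem' := fun {a} ha i => by simpa using (ha (a⁻¹ i)).symm

theorem degreePerm_inv {d : Fin m → ℕ} (s : degreePerm d) (i : Fin m) :
    d (s.1⁻¹ i) = d i := s⁻¹.2 i

/-- The action on residues, `(s λ)ᵢ = λ_{s⁻¹ i}`. -/
def permResidues {d : Fin m → ℕ} (s : degreePerm d) : Residues d →ₗ[ℂ] Residues d where
  toFun l := ⟨fun i => l.1 (s.1⁻¹ i), by
    change ∑ i, (d i : ℂ) * l.1 (s.1⁻¹ i) = 0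
    rw [← show ∑ i, (d i : ℂ) * l.1 i = 0 from l.2, 
      ← Equiv.sum_comp s.1⁻¹ (fun i => (d i : ℂ) * l.1 i)]
    simp only [degreePerm_inv]⟩
  map_add' _ _ := rfl
  map_smul' _ _ := rfl

theorem permResidues_injective {d : Fin m → ℕ} (s : degreePerm d) :
    Function.Injective (permResidues s) := by
  intro l l' h
  apply Subtype.ext
  funext i
  have := congrFun (congrArg Subtype.val h) (s.1 i)
  simpa [permResidues] using this

/-- The identification of `HomPoly n k` with `HomPoly n k'` when `k = k'`. -/
def castHom (n : ℕ) {k k' : ℕ} (h : k = k') : HomPoly n k →ₗ[ℂ] HomPoly n k' :=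
  Submodule.inclusion (le_of_eq (congrArg _ h))

theorem castHom_injective (n : ℕ) {k k' : ℕ} (h : k = k') : Function.Injective (castHom n h) :=
  Submodule.inclusion_injective _

/-- The action `s (π(λ), π(F)) = (π(s λ), π(s F))`, where `(s λ)ᵢ = λ_{s⁻¹ i}` and
`(s F)ᵢ = F_{s⁻¹ i}`. -/
instance (n : ℕ) (d : Fin m → ℕ) : MulAction (degreePerm d) (ParamSpace n d) where
  smul s x := (Projectivization.map (permResidues s) (permResidues_injective s) x.1,
    fun i => Projectivization.map (castHom n (degreePerm_inv s i)) (castHom_injective n _)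
      (x.2 (s.1⁻¹ i)))
  one_smul x := by
    refine Prod.ext ?_ (funext fun i => ?_)
    · change Projectivization.map _ (permResidues_injective (1 : degreePerm d)) x.1 = x.1
      induction x.1 with | h v hv => rfl
    · change Projectivization.map _ (castHom_injective n (degreePerm_inv (1 : degreePerm d) i))
        (x.2 i) = x.2 i
      induction x.2 i with | h v hv => rfl
  mul_smul s t x := by
    refine Prod.ext ?_ (funext fun i => ?_)
    · change Projectivization.map _ (permResidues_injective (s * t)) x.1 =
        Projectivization.map _ (permResidues_injective s)
          (Projectivization.map _ (permResidues_injective t) x.1)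
      induction x.1 with | h v hv => rfl
    · change Projectivization.map _ (castHom_injective n (degreePerm_inv (s * t) i))
          (x.2 (t.1⁻¹ (s.1⁻¹ i))) =
        Projectivization.map _ (castHom_injective n (degreePerm_inv s i))
          (Projectivization.map _ (castHom_injective n (degreePerm_inv t (s.1⁻¹ i)))
            (x.2 (t.1⁻¹ (s.1⁻¹ i))))
      induction x.2 (t.1⁻¹ (s.1⁻¹ i)) with | h v hv => rfl

/-- The equivalence relation on the parameter space whose classes are the orbits of permutations of
the entries of equal degree. -/
abbrev permRel (n : ℕ) (d : Fin m → ℕ) : Setoid (ParamSpace n d) :=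
  MulAction.orbitRel (degreePerm d) (ParamSpace n d)

/-! ### Birationality modulo permutations -/

/-- The map `ρ` induces a birational map from the quotient of the parameter space by the permutation
group to the logarithmic component: there are dense open sets `A` in the quotient and `B` in the
component, with the preimage of `A` contained in the domain of `ρ`, and an isomorphism `A ≅ B` that
sends the class of `x` to `ρ(x)`. -/
def BirationalModPerm (n : ℕ) (d : Fin m → ℕ) : Prop :=
  ∃ (A : Set (Quotient (permRel n d))) (B : Set (LogComponent n d)),
    IsOpen A ∧ Dense A ∧ IsOpen B ∧ Dense B ∧
    ∃ e : Iso A B, ∀ (x : ParamSpace n d) (hA : Quotient.mk (permRel n d) x ∈ A),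
      ∃ hx : x ∈ rhoDomain n d,
        ((e.toHomeomorph ⟨Quotient.mk (permRel n d) x, hA⟩ : B) : LogComponent n d) =
          rho n d ⟨x, hx⟩

end LogForms

end

/-!
Everything is read off from the polynomial map `μ` between vector spaces, and the three assertions
come from one polynomial function `Δ` on the space of projective forms
(`LogForms.IsGenericDenominator`).

*Generic injectivity.* An integrating factor of a form `ω` is a polynomial `G` with
`G dω = dG ∧ ω`. The product `∏ Fᵢ` is an integrating factor of `ω = μ(λ, F)`. That it is the only
one of its degree, up to scalars, is an open condition on `(λ, F)`
(`exists_forall_integrating_factor`), since it says that a linear map depending polynomially on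
`(λ, F)` has the least possible kernel. So it suffices to find one example. For monomials `Fᵢ` the
equation `G dω = dG ∧ ω` decouples into conditions on the exponents of `G`, and `exists_example`
chooses exponents and residues that only `∏ Fᵢ` fulfils; for two factors this needs that no degree
divides the other. Hence `ω` generically determines `∏ Fᵢ` up to a scalar. If moreover `∏ Fᵢ` is
squarefree and the `λᵢ` are distinct, the residue of `ω / ∏ Fᵢ` along a prime factor of `∏ Fᵢ` tells
to which `Fᵢ` this factor belongs, and `(λ, F)` is recovered up to order and scalars
(`exists_perm_of_logForm_eq`, `exists_generic`).

*Birationality.* In characteristic zero, a function on an affine variety that is constant on the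
generic fibres of a dominant map is a rational function of the image
(`exists_mul_eq_of_constant_on_fibres`): otherwise it would take different values under two
embeddings of the function field over the function field of the image, and specialising these to
points would give two points of one fibre. This applies to the permutation invariants in the algebra
generated by the functions that are linear in `λ` and in each `Fᵢ`, the coordinate ring of a Segre
cone. They form a finitely generated algebra, so one denominator is enough (`exists_denominator`).
Together with Chevalley's theorem for the image of `μ` (`exists_forall_mem_image_mu`) this gives
`Δ`. An invariant regular function on the parameter space is locally a quotient of two such invariants
(`exists_invariant_fraction`), so over `Δ ≠ 0` the bijection induced by `ρ` is open and identifies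
the regular functions (`IsGenericDenominator.iso`).

*Dimensions.* Let `N` be the dimension of an affine chart of the parameter space. Chains of
irreducible closed subsets of the parameter space, or of the logarithmic component, are turned into
chains of prime ideals in a ring of functions on the cone. These functions are determined by their
restriction to a slice of dimension `N + 1`, and the chain can be prolonged by the ideal of the
vertex, so both dimensions are at most `N` (`topologicalKrullDim_le_of_cone`). Conversely, the flags
of linear subspaces of a chart give chains of length `N` in the parameter space. They stay strict in
the quotient by the finite group (`strictMono_map_quotient`), and the isomorphism carries them over
to the logarithmic component (`IsGenericDenominator.topologicalKrullDim_eq`).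
-/

noncomputable section

namespace LogForms

/-! ### Polynomial functions on a vector space -/

section PolyFun

variable {W : Type*} [AddCommGroup W] [Module ℂ W]

theorem dual_mem_polyFun (φ : W →ₗ[ℂ] ℂ) : (fun w => φ w) ∈ polyFun W :=
  Algebra.subset_adjoin ⟨φ, rfl⟩

theorem const_mem_polyFun (c : ℂ) : (fun _ : W => c) ∈ polyFun W :=
  (polyFun W).algebraMap_mem c

/-- Evaluation of polynomial functions at a point. -/
def evalAt (w : W) : polyFun W →ₐ[ℂ] ℂ where
  toFun p := p.1 w
  map_one' := rfl
  map_mul' _ _ := rfl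
  map_zero' := rfl
  map_add' _ _ := rfl
  commutes' _ := rfl

@[simp]
theorem evalAt_apply (w : W) (p : polyFun W) : evalAt w p = p.1 w := rfl

/-- Any spanning family of linear functionals generates the algebra of polynomial functions. -/
theorem polyFun_eq_adjoin_of_span {ι : Type*} (c : ι → Module.Dual ℂ W)
    (hc : ∀ φ : Module.Dual ℂ W, φ ∈ Submodule.span ℂ (Set.range c)) :
    polyFun W = Algebra.adjoin ℂ (Set.range fun i => (c i : W → ℂ)) := by
  apply le_antisymm
  · refine Algebra.adjoin_le ?_
    rintro _ ⟨φ, rfl⟩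
    change (φ : W → ℂ) ∈ _
    induction hc φ using Submodule.span_induction with
    | mem x h =>
      obtain ⟨i, rfl⟩ := h
      exact Algebra.subset_adjoin ⟨i, rfl⟩
    | zero => exact Subalgebra.zero_mem _
    | add x y _ _ hx hy => exact Subalgebra.add_mem _ hx hy
    | smul a x _ hx => exact Subalgebra.smul_mem _ hx a
  · refine Algebra.adjoin_mono ?_
    rintro _ ⟨i, rfl⟩
    exact ⟨c i, rfl⟩

/-- The polynomial function with given expression in the coordinates of a basis. -/
def ofMvPoly {ι : Type*} (e : Module.Basis ι ℂ W) : MvPolynomial ι ℂ →ₐ[ℂ] polyFun W :=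
  MvPolynomial.aeval fun i => ⟨fun w => e.coord i w, dual_mem_polyFun _⟩

theorem ofMvPoly_apply {ι : Type*} (e : Module.Basis ι ℂ W) (p : MvPolynomial ι ℂ) (w : W) :
    (ofMvPoly e p).1 w = MvPolynomial.eval (fun i => e.repr w i) p := by
  have : (evalAt w).comp (ofMvPoly e) = MvPolynomial.aeval (fun i => e.repr w i) := by
    ext i
    simp [ofMvPoly]
  have h := congrArg (fun f => f p) this
  simpa [MvPolynomial.aeval_eq_eval] using h

theorem ofMvPoly_bijective {ι : Type*} [Finite ι] (e : Module.Basis ι ℂ W) :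
    Function.Bijective (ofMvPoly e) := by
  have := Fintype.ofFinite ι
  constructor
  · intro p q h
    refine MvPolynomial.funext fun x => ?_
    have h' := congrArg (fun f : polyFun W => f.1 (e.equivFun.symm x)) h
    simp only [ofMvPoly_apply] at h'
    have hx : (fun i => e.repr (e.equivFun.symm x) i) = x := by
      funext i
      exact congrFun (e.equivFun.apply_symm_apply x) i
    rwa [hx] at h'
  · rintro ⟨p, hp⟩
    have hp' := hp
    rw [polyFun_eq_adjoin_of_span (fun i => e.coord i) (fun φ => by
      have : φ = ∑ i, φ (e i) • e.coord i := by
        refine e.ext fun j => ?_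
        classical
        simp
      rw [this]
      exact Submodule.sum_mem _ fun i _ => Submodule.smul_mem _ _
        (Submodule.subset_span ⟨i, rfl⟩))] at hp'
    have : p ∈ ((polyFun W).val.comp (ofMvPoly e)).range := by
      refine Algebra.adjoin_le ?_ hp'
      rintro _ ⟨i, rfl⟩
      exact ⟨MvPolynomial.X i, by simp [ofMvPoly]; rfl⟩
    obtain ⟨q, hq⟩ := this
    exact ⟨q, Subtype.ext hq⟩

variable [FiniteDimensional ℂ W]

variable (W) in
/-- The algebra of polynomial functions is a polynomial ring. -/
def polyFunEquiv : MvPolynomial (Fin (Module.finrank ℂ W)) ℂ ≃ₐ[ℂ] polyFun W :=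
  AlgEquiv.ofBijective _ (ofMvPoly_bijective (Module.finBasis ℂ W))

instance instIsDomainPolyFun : IsDomain (polyFun W) :=
  (polyFunEquiv W).symm.toMulEquiv.isDomain _

instance instFiniteTypePolyFun : Algebra.FiniteType ℂ (polyFun W) :=
  Algebra.FiniteType.equiv inferInstance (polyFunEquiv W)

/-- The algebra homomorphisms `polyFun W → ℂ` are the evaluations at points. -/
theorem exists_eq_evalAt (φ : polyFun W →ₐ[ℂ] ℂ) : ∃ w : W, φ = evalAt w := by
  let e := Module.finBasis ℂ W
  let x := fun i => φ ⟨fun w => e.coord i w, dual_mem_polyFun _⟩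
  refine ⟨e.equivFun.symm x, ?_⟩
  have h : φ.comp (ofMvPoly e) = (evalAt (e.equivFun.symm x)).comp (ofMvPoly e) := by
    refine MvPolynomial.algHom_ext fun i => ?_
    have hx : e.repr (e.equivFun.symm x) i = x i := congrFun (e.equivFun.apply_symm_apply x) i
    simp only [AlgHom.comp_apply, ofMvPoly, MvPolynomial.aeval_X, evalAt_apply]
    exact hx.symm
  ext p
  obtain ⟨q, rfl⟩ := (ofMvPoly_bijective e).2 p
  exact congrArg (fun f => f q) h

theorem polyFun_mul_ne_zero {p q : W → ℂ} (hp : p ∈ polyFun W) (hq : q ∈ polyFun W)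
    (h1 : ∃ w, p w ≠ 0) (h2 : ∃ w, q w ≠ 0) : ∃ w, p w ≠ 0 ∧ q w ≠ 0 := by
  by_contra! H
  have h : (⟨p, hp⟩ : polyFun W) * ⟨q, hq⟩ = 0 := by
    refine Subtype.ext (funext fun w => ?_)
    change p w * q w = 0
    by_cases hw : p w = 0
    · simp [hw]
    · simp [H w hw]
  rcases mul_eq_zero.1 h with h | h
  · obtain ⟨w, hw⟩ := h1
    exact hw (congrFun (congrArg Subtype.val h) w)
  · obtain ⟨w, hw⟩ := h2
    exact hw (congrFun (congrArg Subtype.val h) w)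

end PolyFun

/-! ### Polynomial maps -/

section PolyMap

variable {W : Type*} [AddCommGroup W] [Module ℂ W]
variable {U : Type*} [AddCommGroup U] [Module ℂ U]
variable {U' : Type*} [AddCommGroup U'] [Module ℂ U']

variable (W U) in
/-- The polynomial maps from `W` to a vector space `U`: the finite sums of maps `w ↦ p(w) u` with
`p` a polynomial function. The space `U` may have infinite dimension. -/
def polyMap : Submodule ℂ (W → U) :=
  Submodule.span ℂ {f | ∃ p ∈ polyFun W, ∃ u : U, f = fun w => p w • u}

theorem smul_mem_polyMap {p : W → ℂ} (hp : p ∈ polyFun W) (u : U) :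
    (fun w => p w • u) ∈ polyMap W U :=
  Submodule.subset_span ⟨p, hp, u, rfl⟩

theorem const_mem_polyMap (u : U) : (fun _ : W => u) ∈ polyMap W U := by
  simpa using smul_mem_polyMap (const_mem_polyFun (W := W) 1) u

theorem comp_mem_polyMap (L : U →ₗ[ℂ] U') {f : W → U} (hf : f ∈ polyMap W U) :
    (fun w => L (f w)) ∈ polyMap W U' := by
  induction hf using Submodule.span_induction with
  | mem x h =>
    obtain ⟨p, hp, u, rfl⟩ := h
    simpa using smul_mem_polyMap hp (L u)
  | zero => simpa only [Pi.zero_apply, map_zero] using const_mem_polyMap 0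
  | add x y _ _ hx hy =>
    simp only [Pi.add_apply, map_add]
    exact Submodule.add_mem _ hx hy
  | smul a x _ hx =>
    simp only [Pi.smul_apply, map_smul]
    exact Submodule.smul_mem _ a hx

theorem mem_polyMap_complex {f : W → ℂ} : f ∈ polyMap W ℂ ↔ f ∈ polyFun W := by
  refine ⟨fun hf => ?_, fun hf => by simpa using smul_mem_polyMap hf (1 : ℂ)⟩
  induction hf using Submodule.span_induction with
  | mem x h =>
    obtain ⟨p, hp, u, rfl⟩ := h
    exact Subalgebra.mul_mem _ hp (const_mem_polyFun u)
  | zero => exact Subalgebra.zero_mem _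
  | add x y _ _ hx hy => exact Subalgebra.add_mem _ hx hy
  | smul a x _ hx => exact Subalgebra.smul_mem _ hx a

theorem comp_mem_polyFun (L : U →ₗ[ℂ] ℂ) {f : W → U} (hf : f ∈ polyMap W U) :
    (fun w => L (f w)) ∈ polyFun W :=
  mem_polyMap_complex.1 (comp_mem_polyMap L hf)

/-- Polynomial functions pull back to polynomial functions along polynomial maps. -/
theorem polyFun_comp_mem {f : W → U} (hf : ∀ φ : U →ₗ[ℂ] ℂ, (fun w => φ (f w)) ∈ polyFun W)
    {p : U → ℂ} (hp : p ∈ polyFun U) : (fun w => p (f w)) ∈ polyFun W := by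
  induction hp using Algebra.adjoin_induction with
  | mem x h =>
    obtain ⟨φ, rfl⟩ := h
    exact hf φ
  | algebraMap r => exact const_mem_polyFun r
  | add x y _ _ hx hy => exact Subalgebra.add_mem _ hx hy
  | mul x y _ _ hx hy => exact Subalgebra.mul_mem _ hx hy

theorem bilin_mem_polyMap {U'' : Type*} [AddCommGroup U''] [Module ℂ U'']
    (B : U →ₗ[ℂ] U' →ₗ[ℂ] U'') {f : W → U} {g : W → U'}
    (hf : f ∈ polyMap W U) (hg : g ∈ polyMap W U') :
    (fun w => B (f w) (g w)) ∈ polyMap W U'' := by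
  induction hf using Submodule.span_induction with
  | mem x h =>
    obtain ⟨p, hp, u, rfl⟩ := h
    induction hg using Submodule.span_induction with
    | mem y h' =>
      obtain ⟨q, hq, u', rfl⟩ := h'
      convert smul_mem_polyMap (Subalgebra.mul_mem _ hp hq) (B u u') using 2
      simp [smul_smul, mul_comm]
    | zero => simpa only [Pi.zero_apply, map_zero] using const_mem_polyMap 0
    | add x y _ _ hx hy =>
      simp only [Pi.add_apply, map_add]
      exact Submodule.add_mem _ hx hy
    | smul a x _ hx =>
      simp only [Pi.smul_apply, map_smul] at hx ⊢
      exact Submodule.smul_mem _ a hx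
  | zero =>
    simpa only [Pi.zero_apply, map_zero, LinearMap.zero_apply] using const_mem_polyMap 0
  | add x y _ _ hx hy =>
    simp only [Pi.add_apply, map_add, LinearMap.add_apply]
    exact Submodule.add_mem _ hx hy
  | smul a x _ hx =>
    simp only [Pi.smul_apply, map_smul, LinearMap.smul_apply]
    exact Submodule.smul_mem _ a hx

theorem mul_mem_polyMap {A : Type*} [CommRing A] [Algebra ℂ A] {f g : W → A}
    (hf : f ∈ polyMap W A) (hg : g ∈ polyMap W A) : (fun w => f w * g w) ∈ polyMap W A :=
  bilin_mem_polyMap (LinearMap.mul ℂ A) hf hg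

theorem prod_mem_polyMap {A ι : Type*} [CommRing A] [Algebra ℂ A] (s : Finset ι) {f : ι → W → A}
    (hf : ∀ i ∈ s, f i ∈ polyMap W A) : (fun w => ∏ i ∈ s, f i w) ∈ polyMap W A := by
  classical
  induction s using Finset.induction_on with
  | empty => simpa using const_mem_polyMap (1 : A)
  | insert a s ha ih =>
    simp only [Finset.prod_insert ha]
    exact mul_mem_polyMap (hf a (Finset.mem_insert_self a s))
      (ih fun i hi => hf i (Finset.mem_insert_of_mem hi))

theorem sum_mem_polyMap {ι : Type*} (s : Finset ι) {f : ι → W → U}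
    (hf : ∀ i ∈ s, f i ∈ polyMap W U) : (fun w => ∑ i ∈ s, f i w) ∈ polyMap W U := by
  have := Submodule.sum_mem (polyMap W U) hf
  convert this using 1
  funext w
  simp

theorem pi_mem_polyMap {ι : Type*} [Finite ι] {f : W → ι → U}
    (hf : ∀ i, (fun w => f w i) ∈ polyMap W U) : f ∈ polyMap W (ι → U) := by
  classical
  have := Fintype.ofFinite ι
  have h := sum_mem_polyMap Finset.univ fun i _ =>
    comp_mem_polyMap (LinearMap.single ℂ (fun _ : ι => U) i) (hf i)
  convert h using 1
  funext w
  exact (LinearMap.sum_single_apply (fun _ : ι => U) (f w)).symm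

theorem prodMk_mem_polyMap {f : W → U} {g : W → U'} (hf : f ∈ polyMap W U)
    (hg : g ∈ polyMap W U') : (fun w => (f w, g w)) ∈ polyMap W (U × U') := by
  have := Submodule.add_mem _ (comp_mem_polyMap (LinearMap.inl ℂ U U') hf)
    (comp_mem_polyMap (LinearMap.inr ℂ U U') hg)
  convert this using 1
  funext w
  simp

theorem linear_mem_polyMap [FiniteDimensional ℂ W] (L : W →ₗ[ℂ] U) :
    (fun w => L w) ∈ polyMap W U := by
  let e := Module.finBasis ℂ W
  have := sum_mem_polyMap Finset.univ fun i _ =>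
    smul_mem_polyMap (dual_mem_polyFun (e.coord i)) (L (e i))
  convert this using 1
  funext w
  conv_lhs => rw [← e.sum_repr w]
  simp only [map_sum, map_smul, Module.Basis.coord_apply]

/-- Injectivity is an open condition on the members of a family of linear maps with source of finite
dimension that depends polynomially on a parameter. -/
theorem exists_injective_of_ne_zero [FiniteDimensional ℂ U] (T : W → U →ₗ[ℂ] U')
    (hT : ∀ u, (fun w => T w u) ∈ polyMap W U') (w₀ : W) (h₀ : Function.Injective (T w₀)) :
    ∃ b ∈ polyFun W, b w₀ ≠ 0 ∧ ∀ w, b w ≠ 0 → Function.Injective (T w) := by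
  obtain ⟨L, hL⟩ := (T w₀).exists_leftInverse_of_injective (LinearMap.ker_eq_bot.2 h₀)
  let e := Module.finBasis ℂ U
  refine ⟨fun w => LinearMap.det (L ∘ₗ T w), ?_, by simp [hL], fun w hw => ?_⟩
  · have : ∀ w, LinearMap.det (L ∘ₗ T w) = (LinearMap.toMatrix e e (L ∘ₗ T w)).det :=
      fun w => (LinearMap.det_toMatrix e _).symm
    simp only [this, Matrix.det_apply']
    rw [← mem_polyMap_complex]
    refine sum_mem_polyMap _ fun σ _ => mul_mem_polyMap (const_mem_polyMap _)
      (prod_mem_polyMap _ fun i _ => ?_)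
    simp only [LinearMap.toMatrix_apply, LinearMap.comp_apply]
    exact comp_mem_polyMap (e.coord (σ i) ∘ₗ L) (hT (e i))
  · have h1 : Function.Injective (L ∘ₗ T w) := by
      rw [← LinearMap.ker_eq_bot]
      by_contra h
      exact hw (LinearMap.det_eq_zero_iff_ker_ne_bot.2 h)
    exact Function.Injective.of_comp h1

end PolyMap

/-! ### Generic fibres of dominant maps -/

section Algebra

universe v

/-- A form of the Nullstellensatz: on a finitely generated complex algebra, an element that is not
nilpotent is non-zero at some complex point. -/
theorem exists_algHom_ne_zero {T : Type*} [CommRing T] [Algebra ℂ T] [Algebra.FiniteType ℂ T]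
    {t : T} (ht : ¬ IsNilpotent t) : ∃ x : T →ₐ[ℂ] ℂ, x t ≠ 0 := by
  let S := Localization.Away t
  have hS : Nontrivial S := by
    by_contra h
    rw [not_nontrivial_iff_subsingleton] at h
    exact ht ((IsLocalization.subsingleton_iff (M := Submonoid.powers t) (S := S)).1 h)
  have : Algebra.FiniteType T S := IsLocalization.finiteType_of_monoid_fg (Submonoid.powers t) S
  have : Algebra.FiniteType ℂ S := Algebra.FiniteType.trans (S := T) inferInstance inferInstance
  obtain ⟨M, hM⟩ := Ideal.exists_maximal S
  let K := S ⧸ M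
  let _ : Field K := Ideal.Quotient.field M
  have : Algebra.FiniteType ℂ K := Algebra.FiniteType.of_surjective
    (Ideal.Quotient.mkₐ ℂ M) (Ideal.Quotient.mkₐ_surjective ℂ M)
  have : Module.Finite ℂ K := finite_of_finite_type_of_isJacobsonRing ℂ K
  let e : K →ₐ[ℂ] ℂ := IsAlgClosed.lift
  refine ⟨(e.comp (Ideal.Quotient.mkₐ ℂ M)).comp (IsScalarTower.toAlgHom ℂ T S), ?_⟩
  have hu : IsUnit (IsScalarTower.toAlgHom ℂ T S t) :=
    IsLocalization.map_units S (⟨t, Submonoid.mem_powers t⟩ : Submonoid.powers t)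
  exact ((hu.map (Ideal.Quotient.mkₐ ℂ M)).map e).ne_zero

open scoped TensorProduct

/-- In characteristic zero, an element `f` of an extension `K / k` that does not lie in `k` can be
separated from itself by two embeddings of `K` over `k`: the element `f ⊗ 1 - 1 ⊗ f` is not
nilpotent. -/
theorem not_isNilpotent_tmul_sub {k K : Type*} [Field k] [CharZero k] [Field K] [Algebra k K]
    {f : K} (hf : f ∉ (algebraMap k K).range) :
    ¬ IsNilpotent (f ⊗ₜ[k] (1 : K) - (1 : K) ⊗ₜ[k] f) := by
  by_cases halg : IsAlgebraic k f
  · let F := IntermediateField.adjoin k {f}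
    have hfin : FiniteDimensional k F :=
      IntermediateField.adjoin.finiteDimensional halg.isIntegral
    have : Algebra.FormallyUnramified k F := Algebra.FormallyUnramified.of_isSeparable k F
    have hred : IsReduced (K ⊗[k] F) :=
      Algebra.FormallyUnramified.isReduced_of_field K (K ⊗[k] F)
    let g : F := ⟨f, IntermediateField.mem_adjoin_simple_self k f⟩
    let j : K ⊗[k] F →ₐ[k] K ⊗[k] K := Algebra.TensorProduct.map (AlgHom.id k K) F.val
    have hj : Function.Injective j :=
      Module.Flat.lTensor_preserves_injective_linearMap (M := K) F.val.toLinearMap F.val.injective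
    have hjg : j (f ⊗ₜ[k] (1 : F) - (1 : K) ⊗ₜ[k] g) = f ⊗ₜ[k] (1 : K) - (1 : K) ⊗ₜ[k] f := by
      simp [j, g]
    rw [← hjg]
    rintro ⟨N, hN⟩
    have h0 : f ⊗ₜ[k] (1 : F) - (1 : K) ⊗ₜ[k] g = 0 :=
      IsNilpotent.eq_zero ⟨N, hj ((map_pow j.toRingHom _ N).trans
        (hN.trans (map_zero j.toRingHom).symm))⟩
    rw [h0, map_zero] at hjg
    -- a functional that vanishes at `1` but not at `f`
    have hf1 : f ∉ Submodule.span k {(1 : K)} := by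
      rw [Submodule.mem_span_singleton]
      rintro ⟨a, ha⟩
      exact hf ⟨a, by rw [← ha, Algebra.algebraMap_eq_smul_one]⟩
    obtain ⟨θ, hθ, hθ1⟩ := Submodule.exists_le_ker_of_notMem hf1
    have hθ1' : θ 1 = 0 := hθ1 (Submodule.mem_span_singleton_self 1)
    have := congrArg ((TensorProduct.lid k K).toLinearMap ∘ₗ LinearMap.rTensor K θ) hjg
    simp [hθ1'] at this
    exact hθ ((smul_eq_zero.1 this.symm).resolve_right one_ne_zero)
  · rintro ⟨N, hN⟩
    -- a functional that takes the powers of `f` below the `N`-th to `0` and the `N`-th to `1`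
    obtain ⟨θ, hθ⟩ : ∃ θ : K →ₗ[k] k, ∀ i, θ (f ^ i) = if N = i then 1 else 0 := by
      have hinj : Function.Injective (Polynomial.aeval (R := k) f).toLinearMap :=
        transcendental_iff_injective.1 halg
      obtain ⟨L, hL⟩ := LinearMap.exists_leftInverse_of_injective _ (LinearMap.ker_eq_bot.2 hinj)
      refine ⟨Polynomial.lcoeff k N ∘ₗ L, fun i => ?_⟩
      have := congrArg (fun g => g (Polynomial.X ^ i)) hL
      simp only [LinearMap.comp_apply, AlgHom.toLinearMap_apply, map_pow, Polynomial.aeval_X,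
        LinearMap.id_apply] at this
      rw [LinearMap.comp_apply, this, Polynomial.lcoeff_apply, Polynomial.coeff_X_pow]
    have h2 : (f ⊗ₜ[k] (1 : K) - (1 : K) ⊗ₜ[k] f) ^ N = ∑ i ∈ Finset.range (N + 1),
        (f ^ i) ⊗ₜ[k] ((-f) ^ (N - i) * (N.choose i : K)) := by
      rw [sub_eq_add_neg, ← TensorProduct.tmul_neg, add_pow]
      refine Finset.sum_congr rfl fun i _ => ?_
      rw [Algebra.TensorProduct.tmul_pow, Algebra.TensorProduct.tmul_pow, one_pow, one_pow,
        Algebra.TensorProduct.tmul_mul_tmul, mul_one, one_mul,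
        ← map_natCast (Algebra.TensorProduct.includeRight : K →ₐ[k] K ⊗[k] K) (N.choose i),
        Algebra.TensorProduct.includeRight_apply, Algebra.TensorProduct.tmul_mul_tmul, mul_one]
    rw [h2] at hN
    have := congrArg ((TensorProduct.lid k K).toLinearMap ∘ₗ LinearMap.rTensor K θ) hN
    simp [hθ] at this

/-- An element `f ∉ k` of an extension `K / k` in characteristic zero takes different values under
two embeddings over `k` of `K` in a domain. -/
theorem exists_separating_embeddings (F : Type*) (k : Type v) {K : Type v} [Field F] [Field k]
    [CharZero k] [Field K] [Algebra k K] [Algebra F k] [Algebra F K] [IsScalarTower F k K]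
    {f : K} (hf : f ∉ (algebraMap k K).range) :
    ∃ (T : Type v) (_ : CommRing T) (_ : IsDomain T) (_ : Algebra F T) (j₁ j₂ : K →ₐ[F] T),
      (∀ a : k, j₁ (algebraMap k K a) = j₂ (algebraMap k K a)) ∧ j₁ f ≠ j₂ f := by
  obtain ⟨P, hP, hδ⟩ : ∃ P : Ideal (K ⊗[k] K), P.IsPrime ∧
      (f ⊗ₜ[k] (1 : K) - (1 : K) ⊗ₜ[k] f) ∉ P := by
    by_contra! H
    refine not_isNilpotent_tmul_sub hf (mem_nilradical.1 ?_)
    rw [nilradical_eq_sInf]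
    exact Submodule.mem_sInf.2 fun I hI => H I hI
  let q : K ⊗[k] K →ₐ[k] (K ⊗[k] K) ⧸ P := Ideal.Quotient.mkₐ k P
  let j₁ := q.comp (Algebra.TensorProduct.includeLeft : K →ₐ[k] K ⊗[k] K)
  let j₂ := q.comp (Algebra.TensorProduct.includeRight : K →ₐ[k] K ⊗[k] K)
  refine ⟨(K ⊗[k] K) ⧸ P, inferInstance, inferInstance, inferInstance, j₁.restrictScalars F,
    j₂.restrictScalars F, fun a => (j₁.commutes a).trans (j₂.commutes a).symm, fun h => hδ ?_⟩
  rw [← Ideal.Quotient.eq_zero_iff_mem]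
  exact (map_sub q _ _).trans (sub_eq_zero.2 h)

/-- Let `R` be a finitely generated complex domain and `A` a subalgebra. If `p ∈ R` takes the same
value at any two points of the open set `b ≠ 0` of `Spec R` with the same image in `Spec A`, then
`p` lies in the fraction field of `A`. -/
theorem exists_mul_eq_of_constant_on_fibres {R : Type*} [CommRing R] [IsDomain R] [Algebra ℂ R]
    [Algebra.FiniteType ℂ R] (A : Subalgebra ℂ R) (p b : R) (hb : b ≠ 0)
    (h : ∀ x x' : R →ₐ[ℂ] ℂ, x b ≠ 0 → x' b ≠ 0 → (∀ a ∈ A, x a = x' a) → x p = x' p) :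
    ∃ r ∈ A, ∃ s ∈ A, s ≠ 0 ∧ p * s = r := by
  let K := FractionRing R
  let ι : R →ₐ[ℂ] K := IsScalarTower.toAlgHom ℂ R K
  have hι : Function.Injective ι := IsFractionRing.injective R K
  let k := IntermediateField.adjoin ℂ (ι '' A)
  have hadj : Algebra.adjoin ℂ (ι '' A) = A.map ι := by
    rw [← AlgHom.map_adjoin, Algebra.adjoin_eq]
  by_cases hp : ι p ∈ k
  · obtain ⟨r, hr, s, hs, hrs⟩ := (IntermediateField.mem_adjoin_iff_div).1 hp
    rw [hadj] at hr hs
    obtain ⟨r, hr, rfl⟩ := hr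
    obtain ⟨s, hs, rfl⟩ := hs
    by_cases hs0 : s = 0
    · have : p = 0 := hι (by simpa [hs0] using hrs)
      exact ⟨0, A.zero_mem, 1, A.one_mem, one_ne_zero, by simp [this]⟩
    · refine ⟨r, hr, s, hs, hs0, hι ?_⟩
      have : ι s ≠ 0 := fun h => hs0 (hι (by simpa using h))
      rw [map_mul, hrs]
      exact div_mul_cancel₀ _ this
  · exfalso
    obtain ⟨T, _, _, _, j₁, j₂, hj, hδ⟩ := exists_separating_embeddings ℂ k (f := ι p) (by
      rintro ⟨a, ha⟩
      exact hp (ha ▸ a.2))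
    let B : Subalgebra ℂ T := (j₁.comp ι).range ⊔ (j₂.comp ι).range
    have hB1 : ∀ r, j₁ (ι r) ∈ B := fun r => (le_sup_left : _ ≤ B) ⟨r, rfl⟩
    have hB2 : ∀ r, j₂ (ι r) ∈ B := fun r => (le_sup_right : _ ≤ B) ⟨r, rfl⟩
    have hBfg : Algebra.FiniteType ℂ B := by
      rw [← Subalgebra.fg_iff_finiteType]
      refine Subalgebra.FG.sup ?_ ?_ <;>
      · rw [Subalgebra.fg_iff_finiteType]
        exact Algebra.FiniteType.of_surjective _ (AlgHom.rangeRestrict_surjective _)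
    let i₁ : R →ₐ[ℂ] B := (j₁.comp ι).codRestrict B hB1
    let i₂ : R →ₐ[ℂ] B := (j₂.comp ι).codRestrict B hB2
    have hne : ∀ j : K →ₐ[ℂ] T, j (ι b) ≠ 0 := fun j hj0 =>
      hb (hι ((map_eq_zero_iff j j.toRingHom.injective).1 hj0 |>.trans (map_zero ι).symm))
    have hi1 : i₁ b ≠ 0 := fun h => hne j₁ (congrArg Subtype.val h)
    have hi2 : i₂ b ≠ 0 := fun h => hne j₂ (congrArg Subtype.val h)
    have hi3 : i₁ p - i₂ p ≠ 0 := fun h => hδ (congrArg Subtype.val (sub_eq_zero.1 h))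
    obtain ⟨x, hx⟩ := exists_algHom_ne_zero (T := B) (t := i₁ b * i₂ b * (i₁ p - i₂ p)) (by
      rw [isNilpotent_iff_eq_zero]
      exact mul_ne_zero (mul_ne_zero hi1 hi2) hi3)
    simp only [map_mul, map_sub, mul_ne_zero_iff] at hx
    refine hx.2 (sub_eq_zero.2 (h (x.comp i₁) (x.comp i₂) hx.1.1 hx.1.2 fun a ha => ?_))
    exact congrArg x (Subtype.ext (hj ⟨ι a, IntermediateField.subset_adjoin ℂ _ ⟨a, ha, rfl⟩⟩))

/-- The image of the open set `b ≠ 0` under a dominant map of affine varieties contains a non-empty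
open set `a ≠ 0`, here on the level of complex points. -/
theorem exists_ne_zero_forall_extends {R : Type*} [CommRing R] [IsDomain R] [Algebra ℂ R]
    [Algebra.FiniteType ℂ R] (A : Subalgebra ℂ R) [Algebra.FiniteType ℂ A] (b : R) (hb : b ≠ 0) :
    ∃ a : A, a ≠ 0 ∧ ∀ φ : A →ₐ[ℂ] ℂ, φ a ≠ 0 →
      ∃ x : R →ₐ[ℂ] ℂ, (∀ a : A, x a = φ a) ∧ x b ≠ 0 := by
  have : IsNoetherianRing A := Algebra.FiniteType.isNoetherianRing ℂ A
  have hft : Algebra.FiniteType A R := Algebra.FiniteType.of_restrictScalars_finiteType ℂ A R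
  have hfp : (algebraMap A R).FinitePresentation :=
    RingHom.FinitePresentation.of_finiteType.1 (RingHom.finiteType_algebraMap.2 hft)
  have hb' : Topology.IsConstructible (PrimeSpectrum.basicOpen b : Set (PrimeSpectrum R)) :=
    PrimeSpectrum.isConstructible_basicOpen
  obtain ⟨S, hS⟩ := PrimeSpectrum.exists_constructibleSetData_iff.2
    (PrimeSpectrum.isConstructible_comap_image hfp hb')
  have hbot : (⟨⊥, Ideal.isPrime_bot⟩ : PrimeSpectrum A) ∈ S.toSet := by
    rw [hS]
    refine ⟨⟨⊥, Ideal.isPrime_bot⟩, hb, PrimeSpectrum.ext ?_⟩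
    exact Ideal.comap_bot_of_injective _ Subtype.val_injective
  simp only [PrimeSpectrum.ConstructibleSetData.toSet, Set.mem_iUnion] at hbot
  obtain ⟨c, hcS, hc⟩ := hbot
  -- the piece of the image that contains the generic point is the open set `c.f ≠ 0`
  have hg : ∀ i, c.g i = 0 := fun i => hc.1 ⟨i, rfl⟩
  refine ⟨c.f, fun h => hc.2 fun _ hx => ?_, fun φ hφ => ?_⟩
  · rw [hx, h]
    exact Submodule.zero_mem _
  have hker : (RingHom.ker φ).IsPrime := RingHom.ker_isPrime φ
  have hmem : (⟨RingHom.ker φ, hker⟩ : PrimeSpectrum A) ∈ S.toSet := by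
    simp only [PrimeSpectrum.ConstructibleSetData.toSet, Set.mem_iUnion]
    refine ⟨c, hcS, ?_, fun h => hφ (h rfl)⟩
    rintro _ ⟨i, rfl⟩
    rw [hg i]
    exact Submodule.zero_mem _
  rw [hS] at hmem
  obtain ⟨Q, hbQ, hQ⟩ := hmem
  have hQ' : ∀ a : A, (a : R) ∈ Q.asIdeal ↔ φ a = 0 := fun a => by
    have := congrArg (fun P : PrimeSpectrum A => a ∈ P.asIdeal) hQ
    exact iff_of_eq this
  obtain ⟨x, hx⟩ := exists_algHom_ne_zero (T := R ⧸ Q.asIdeal) (t := Ideal.Quotient.mkₐ ℂ _ b) (by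
    rw [isNilpotent_iff_eq_zero]
    exact fun h => hbQ (Ideal.Quotient.eq_zero_iff_mem.1 h))
  refine ⟨x.comp (Ideal.Quotient.mkₐ ℂ _), fun a => ?_, hx⟩
  have h1 : ((a - algebraMap ℂ A (φ a) : A) : R) ∈ Q.asIdeal := (hQ' _).2 (by simp)
  have h2 : Ideal.Quotient.mkₐ ℂ Q.asIdeal ((a : R) - algebraMap ℂ R (φ a)) = 0 :=
    Ideal.Quotient.eq_zero_iff_mem.2 h1
  have h3 := congrArg x h2
  rw [map_zero, map_sub, map_sub, AlgHom.commutes, AlgHom.commutes, sub_eq_zero] at h3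
  exact h3

/-- The algebra of invariants of a finite group acting on a finitely generated complex algebra is
finitely generated. -/
theorem finiteType_invariants {R G : Type*} [CommRing R] [Algebra ℂ R] [Algebra.FiniteType ℂ R]
    [Group G] [Finite G] [MulSemiringAction G R] [SMulCommClass G ℂ R] :
    Algebra.FiniteType ℂ (FixedPoints.subalgebra ℂ R G) := by
  have : Algebra.IsInvariant (FixedPoints.subalgebra ℂ R G) R G := ⟨fun r hr => ⟨⟨r, hr⟩, rfl⟩⟩
  have hint : Algebra.IsIntegral (FixedPoints.subalgebra ℂ R G) R :=
    Algebra.IsInvariant.isIntegral _ R G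
  have hft : Algebra.FiniteType (FixedPoints.subalgebra ℂ R G) R :=
    Algebra.FiniteType.of_restrictScalars_finiteType ℂ _ R
  have : Module.Finite (FixedPoints.subalgebra ℂ R G) R := Algebra.IsIntegral.finite
  exact ⟨fg_of_fg_of_fg ℂ (FixedPoints.subalgebra ℂ R G) R Algebra.FiniteType.out
    Module.Finite.fg_top Subtype.val_injective⟩

/-- A finitely generated algebra that embeds in a polynomial ring in `N` variables has dimension at
most `N`. -/
theorem ringKrullDim_le_of_injective {A : Type*} [CommRing A] [Algebra ℂ A] [Nontrivial A]
    [Algebra.FiniteType ℂ A] {N : ℕ} (f : A →ₐ[ℂ] MvPolynomial (Fin N) ℂ)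
    (hf : Function.Injective f) : ringKrullDim A ≤ N := by
  obtain ⟨s, g, hg, hint⟩ := exists_integral_inj_algHom_of_fg ℂ A
  have hs : s ≤ N := by
    have h1 : AlgebraicIndependent ℂ fun i : Fin s => f (g (MvPolynomial.X i)) := by
      rw [algebraicIndependent_iff_injective_aeval]
      have : MvPolynomial.aeval (fun i : Fin s => f (g (MvPolynomial.X i))) = f.comp g :=
        MvPolynomial.algHom_ext fun i => by simp
      rw [this]
      exact hf.comp hg
    have := h1.cardinalMk_le_trdeg
    simpa using this
  have h2 : ringKrullDim A ≤ ringKrullDim (MvPolynomial (Fin s) ℂ) := by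
    let _ := g.toRingHom.toAlgebra
    have : Algebra.IsIntegral (MvPolynomial (Fin s) ℂ) A := ⟨hint⟩
    refine Order.krullDim_le_of_strictMono (PrimeSpectrum.comap (algebraMap _ A)) fun P Q hPQ => ?_
    exact Ideal.IsIntegral.comap_lt_comap (R := MvPolynomial (Fin s) ℂ) hPQ
  refine h2.trans ?_
  rw [MvPolynomial.ringKrullDim_of_isNoetherianRing]
  simpa using hs

end Algebra

/-! ### Derivatives and divisibility in polynomial rings -/

section Deriv

variable {n : ℕ}

theorem totalDegree_pderiv_lt (p : Poly n) (j : Fin (n + 1)) (h : MvPolynomial.pderiv j p ≠ 0) :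
    (MvPolynomial.pderiv j p).totalDegree < p.totalDegree := by
  obtain ⟨m, hm, hdeg⟩ : ∃ m ∈ (MvPolynomial.pderiv j p).support,
      (MvPolynomial.pderiv j p).totalDegree = m.degree := by
    obtain ⟨m, hm, h'⟩ := Finset.exists_mem_eq_sup _ (MvPolynomial.support_nonempty.2 h)
      (fun m : Fin (n + 1) →₀ ℕ => m.sum fun _ e => e)
    exact ⟨m, hm, h'⟩
  have hm' : m + Finsupp.single j 1 ∈ p.support := by
    rw [MvPolynomial.mem_support_iff, MvPolynomial.coeff_pderiv] at hm
    exact MvPolynomial.mem_support_iff.2 (left_ne_zero_of_mul hm)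
  have h1 := MvPolynomial.le_totalDegree hm'
  have h2 : ((m + Finsupp.single j 1).sum fun _ e => e) = m.degree + 1 := by
    change (m + Finsupp.single j 1).degree = _
    simp
  omega

theorem totalDegree_pderiv_le (p : Poly n) (j : Fin (n + 1)) :
    (MvPolynomial.pderiv j p).totalDegree ≤ p.totalDegree - 1 := by
  by_cases h : MvPolynomial.pderiv j p = 0
  · simp [h]
  · have := totalDegree_pderiv_lt p j h
    omega

theorem exists_pderiv_ne_zero {p : Poly n} (hp : p.totalDegree ≠ 0) :
    ∃ j, MvPolynomial.pderiv j p ≠ 0 := by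
  by_contra! H
  refine hp ?_
  rw [MvPolynomial.totalDegree_eq_zero_iff]
  intro m hm j
  by_contra hj
  have h1 : MvPolynomial.coeff (m - Finsupp.single j 1) (MvPolynomial.pderiv j p) = 0 := by
    rw [H j, MvPolynomial.coeff_zero]
  rw [MvPolynomial.coeff_pderiv, tsub_add_cancel_of_le
    (Finsupp.single_le_iff.2 (Nat.one_le_iff_ne_zero.2 hj))] at h1
  rcases mul_eq_zero.1 h1 with h | h
  · exact (MvPolynomial.mem_support_iff.1 hm) h
  · exact Nat.cast_add_one_ne_zero _ h

theorem totalDegree_ne_zero_of_not_isUnit {p : Poly n} (h0 : p ≠ 0) (hp : ¬ IsUnit p) :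
    p.totalDegree ≠ 0 := by
  intro h
  rw [MvPolynomial.totalDegree_eq_zero_iff_eq_C] at h
  rw [h] at hp h0
  refine hp (IsUnit.map _ (isUnit_iff_ne_zero.2 fun hc => h0 ?_))
  rw [hc, map_zero]

/-- An irreducible polynomial does not divide all its derivatives. -/
theorem exists_not_dvd_pderiv {P : Poly n} (hP : Irreducible P) :
    ∃ j, ¬ P ∣ MvPolynomial.pderiv j P := by
  obtain ⟨j, hj⟩ := exists_pderiv_ne_zero
    (totalDegree_ne_zero_of_not_isUnit hP.ne_zero hP.not_isUnit)
  exact ⟨j, fun h => absurd (MvPolynomial.totalDegree_le_of_dvd_of_isDomain h hj)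
    (not_le.2 (totalDegree_pderiv_lt P j hj))⟩

/-- A quotient of two polynomials of the same degree is constant. -/
theorem exists_eq_smul_of_dvd {p q : Poly n} (h : p ∣ q) (hq : q ≠ 0)
    (hd : q.totalDegree ≤ p.totalDegree) : ∃ c : ℂ, c ≠ 0 ∧ q = c • p := by
  obtain ⟨r, rfl⟩ := h
  have hp0 : p ≠ 0 := left_ne_zero_of_mul hq
  have hr0 : r ≠ 0 := right_ne_zero_of_mul hq
  rw [MvPolynomial.totalDegree_mul_of_isDomain hp0 hr0] at hd
  have hr : r.totalDegree = 0 := by omega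
  rw [MvPolynomial.totalDegree_eq_zero_iff_eq_C] at hr
  refine ⟨MvPolynomial.coeff 0 r, fun hc => hr0 (by rw [hr, hc, map_zero]), ?_⟩
  rw [MvPolynomial.smul_eq_C_mul, ← hr, mul_comm]

end Deriv

/-! ### Integrating factors -/

section IntegratingFactor

variable {n m : ℕ}

/-- The linear map `G ↦ G dω - dG ∧ ω`, where `ω` is the form with coefficients `a`. Its kernel
consists of the integrating factors of `ω`: the `G` for which `ω / G` is closed. -/
def integratingMap (a : Fin (n + 1) → Poly n) :
    Poly n →ₗ[ℂ] Fin (n + 1) → Fin (n + 1) → Poly n where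
  toFun G j k := G * (MvPolynomial.pderiv j (a k) - MvPolynomial.pderiv k (a j)) -
    (MvPolynomial.pderiv j G * a k - MvPolynomial.pderiv k G * a j)
  map_add' G G' := by
    funext j k
    simp only [map_add, Pi.add_apply]
    ring
  map_smul' c G := by
    funext j k
    simp only [Pi.smul_apply, RingHom.id_apply, MvPolynomial.smul_eq_C_mul,
      MvPolynomial.pderiv_C_mul]
    ring

theorem integratingMap_apply (a : Fin (n + 1) → Poly n) (G : Poly n) (j k : Fin (n + 1)) :
    integratingMap a G j k = G * (MvPolynomial.pderiv j (a k) - MvPolynomial.pderiv k (a j)) -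
      (MvPolynomial.pderiv j G * a k - MvPolynomial.pderiv k G * a j) := rfl

/-- The product of the `F i` is an integrating factor of the logarithmic form. -/
theorem integratingMap_logForm (l : Fin m → ℂ) (F : Fin m → Poly n) :
    integratingMap (logForm l F) (∏ i, F i) = 0 := by
  let P : Fin m → Poly n := fun i => ∏ k ∈ Finset.univ.erase i, F k
  have hP : ∀ i, F i * P i = ∏ i, F i := fun i =>
    Finset.mul_prod_erase Finset.univ F (Finset.mem_univ i)
  -- the part of `F dω - dF ∧ ω` that is visibly symmetric in the two indices
  have key : ∀ j k, (∏ i, F i) * MvPolynomial.pderiv j (logForm l F k) -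
      MvPolynomial.pderiv j (∏ i, F i) * logForm l F k =
      ∑ i, l i • ((∏ i, F i) * P i * MvPolynomial.pderiv j (MvPolynomial.pderiv k (F i)) -
        P i * P i * MvPolynomial.pderiv j (F i) * MvPolynomial.pderiv k (F i)) := by
    intro j k
    simp only [logForm, map_sum, Finset.mul_sum, ← Finset.sum_sub_distrib]
    refine Finset.sum_congr rfl fun i _ => ?_
    change (∏ i, F i) * MvPolynomial.pderiv j (l i • (P i * MvPolynomial.pderiv k (F i))) -
      MvPolynomial.pderiv j (∏ i, F i) * l i • (P i * MvPolynomial.pderiv k (F i)) = _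
    rw [← hP i]
    simp only [MvPolynomial.pderiv_mul, MvPolynomial.smul_eq_C_mul, MvPolynomial.pderiv_C]
    ring
  have hcomm : ∀ (j k) (p : Poly n), MvPolynomial.pderiv j (MvPolynomial.pderiv k p) =
      MvPolynomial.pderiv k (MvPolynomial.pderiv j p) := by
    intro j k p
    ext s
    simp only [MvPolynomial.coeff_pderiv]
    rw [add_right_comm]
    by_cases hjk : j = k
    · rw [hjk]
    · simp [hjk, Ne.symm hjk]
      ring
  funext j k
  have h1 := key j k
  have h2 := key k j
  have h3 : ∑ i, l i • ((∏ i, F i) * P i * MvPolynomial.pderiv j (MvPolynomial.pderiv k (F i)) -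
        P i * P i * MvPolynomial.pderiv j (F i) * MvPolynomial.pderiv k (F i)) =
      ∑ i, l i • ((∏ i, F i) * P i * MvPolynomial.pderiv k (MvPolynomial.pderiv j (F i)) -
        P i * P i * MvPolynomial.pderiv k (F i) * MvPolynomial.pderiv j (F i)) := by
    refine Finset.sum_congr rfl fun i _ => ?_
    rw [hcomm j k]
    ring_nf
  rw [← h1, ← h2] at h3
  rw [integratingMap_apply, Pi.zero_apply, Pi.zero_apply]
  linear_combination h3

end IntegratingFactor

/-! ### Residues -/

section Residue

variable {n m : ℕ}

/-- The residue of `ω / ∏ F` along a prime factor `P` of `F i` is `l i`. -/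
theorem dvd_logForm_sub (l : Fin m → ℂ) (F : Fin m → Poly n) {P R : Poly n} (hP : P ≠ 0)
    (i : Fin m) (hi : P ∣ F i) (hR : ∏ i, F i = P * R) (j : Fin (n + 1)) :
    P ∣ logForm l F j - l i • (R * MvPolynomial.pderiv j P) := by
  obtain ⟨Q, hQ⟩ := hi
  have hR' : (∏ k ∈ Finset.univ.erase i, F k) * Q = R := by
    have := Finset.mul_prod_erase Finset.univ F (Finset.mem_univ i)
    rw [hR, hQ] at this
    refine mul_left_cancel₀ hP ?_
    rw [← this]
    ring
  have hsum : logForm l F j = l i • ((∏ k ∈ Finset.univ.erase i, F k) *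
      MvPolynomial.pderiv j (F i)) + ∑ i' ∈ Finset.univ.erase i, l i' •
        ((∏ k ∈ Finset.univ.erase i', F k) * MvPolynomial.pderiv j (F i')) :=
    (Finset.add_sum_erase _ _ (Finset.mem_univ i)).symm
  rw [hsum, add_sub_right_comm]
  refine dvd_add ?_ (Finset.dvd_sum fun i' hi' => ?_)
  · rw [← smul_sub, ← hR', hQ, MvPolynomial.pderiv_mul]
    refine dvd_smul_of_dvd _ ?_
    exact ⟨(∏ k ∈ Finset.univ.erase i, F k) * MvPolynomial.pderiv j Q, by ring⟩
  · refine dvd_smul_of_dvd _ (Dvd.dvd.mul_right ?_ _)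
    have : P ∣ F i := ⟨Q, hQ⟩
    exact this.trans (Finset.dvd_prod_of_mem F (Finset.mem_erase.2
      ⟨(Finset.ne_of_mem_erase hi').symm, Finset.mem_univ i⟩))

/-- A common prime factor of two of the factors has the same residue in both descriptions of the form;
the constant `c` comes from the normalisation of the products. -/
theorem residue_eq {l l' : Fin m → ℂ} {F F' : Fin m → Poly n} (hl : logForm l F = logForm l' F')
    (hsq : Squarefree (∏ i, F i)) {c : ℂ} (hF : ∏ i, F' i = c • ∏ i, F i) {P : Poly n}
    (hP : Irreducible P) {i j : Fin m} (hi : P ∣ F i) (hj : P ∣ F' j) : l i = c * l' j := by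
  obtain ⟨R, hR⟩ := hi.trans (Finset.dvd_prod_of_mem F (Finset.mem_univ i))
  have hR' : ∏ i, F' i = P * (c • R) := by rw [hF, hR, mul_smul_comm]
  obtain ⟨k, hk⟩ := exists_not_dvd_pderiv hP
  by_contra hne
  have h1 := dvd_logForm_sub l F hP.ne_zero i hi hR k
  have h2 := dvd_logForm_sub l' F' hP.ne_zero j hj hR' k
  rw [hl] at h1
  have h3 := dvd_sub h2 h1
  have h4 : (logForm l' F' k - l' j • (c • R * MvPolynomial.pderiv k P)) -
      (logForm l' F' k - l i • (R * MvPolynomial.pderiv k P)) =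
      (l i - c * l' j) • (R * MvPolynomial.pderiv k P) := by
    simp only [MvPolynomial.smul_eq_C_mul, map_sub, map_mul]
    ring
  rw [h4] at h3
  have h5 : P ∣ R * MvPolynomial.pderiv k P := by
    have := dvd_smul_of_dvd (l i - c * l' j)⁻¹ h3
    rwa [smul_smul, inv_mul_cancel₀ (sub_ne_zero.2 hne), one_smul] at this
  rcases hP.prime.dvd_or_dvd h5 with h | h
  · obtain ⟨S, rfl⟩ := h
    exact hP.not_isUnit (hsq P ⟨S, by rw [hR, mul_assoc]⟩)
  · exact hk h

/-- Two sets of data with the same logarithmic form and proportional products agree up to order and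
scalars, provided that the first product is squarefree and the first residues are distinct. -/
theorem exists_perm_of_logForm_eq {d : Fin m → ℕ} (hd : ∀ i, 0 < d i) {l l' : Fin m → ℂ}
    {F F' : Fin m → Poly n} (hF : ∀ i, (F i).IsHomogeneous (d i))
    (hF' : ∀ i, (F' i).IsHomogeneous (d i)) (hF0 : ∀ i, F' i ≠ 0)
    (hl : logForm l F = logForm l' F') (hinj : Function.Injective l)
    (hsq : Squarefree (∏ i, F i)) {c : ℂ} (hc : ∏ i, F' i = c • ∏ i, F i) :
    ∃ (s : Equiv.Perm (Fin m)) (e : Fin m → ℂ), (∀ i, d (s i) = d i) ∧ (∀ i, e i ≠ 0) ∧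
      (∀ i, F' (s i) = e i • F i) ∧ ∀ i, l i = (∏ k, e k) * l' (s i) := by
  have hFne : ∀ i, F i ≠ 0 := fun i =>
    (ne_zero_of_dvd_ne_zero hsq.ne_zero (Finset.dvd_prod_of_mem F (Finset.mem_univ i)))
  have hc0 : c ≠ 0 := by
    rintro rfl
    rw [zero_smul] at hc
    exact Finset.prod_ne_zero_iff.2 (fun i _ => hF0 i) hc
  have hdvd : ∀ i, F i ∣ ∏ k, F' k := fun i => by
    rw [hc]
    exact dvd_smul_of_dvd c (Finset.dvd_prod_of_mem F (Finset.mem_univ i))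
  have hex : ∀ i, ∃ j, l i = c * l' j := fun i => by
    have hnu : ¬ IsUnit (F i) := fun hu => by
      have := (MvPolynomial.isUnit_iff_totalDegree_of_isReduced.1 hu).2
      rw [(hF i).totalDegree (hFne i)] at this
      exact (hd i).ne' this
    obtain ⟨P, hP, hPi⟩ := WfDvdMonoid.exists_irreducible_factor hnu (hFne i)
    obtain ⟨j, _, hj⟩ := hP.prime.exists_mem_finset_dvd (hPi.trans (hdvd i))
    exact ⟨j, residue_eq hl hsq hc hP hPi hj⟩
  choose s hs using hex
  have hsi : Function.Injective s := fun i i' h => hinj (by rw [hs i, hs i', h])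
  let τ : Equiv.Perm (Fin m) := Equiv.ofBijective s (Finite.injective_iff_bijective.1 hsi)
  have hdiv : ∀ i, F i ∣ F' (τ i) := fun i => by
    have h1 : IsRelPrime (F i) (∏ k ∈ Finset.univ.erase (τ i), F' k) := by
      refine IsRelPrime.prod_right fun j hj => ?_
      refine WfDvdMonoid.isRelPrime_of_no_irreducible_factors (fun h => hFne i h.1) ?_
      intro P hP hPi hPj
      have h := residue_eq hl hsq hc hP hPi hPj
      obtain ⟨i', rfl⟩ := τ.surjective j
      have : i = i' := hinj (h.trans (hs i').symm)
      exact Finset.ne_of_mem_erase hj (by rw [this])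
    refine h1.dvd_of_dvd_mul_right ?_
    rw [Finset.mul_prod_erase Finset.univ F' (Finset.mem_univ _)]
    exact hdvd i
  have hdeg : ∀ i, d i ≤ d (τ i) := fun i => by
    rw [← (hF i).totalDegree (hFne i), ← (hF' (τ i)).totalDegree (hF0 _)]
    exact MvPolynomial.totalDegree_le_of_dvd_of_isDomain (hdiv i) (hF0 _)
  have hdeg' : ∀ i, d (τ i) = d i := fun i =>
    ((Finset.sum_eq_sum_iff_of_le fun i _ => hdeg i).1
      (Equiv.sum_comp τ d).symm i (Finset.mem_univ i)).symm
  have hsc : ∀ i, ∃ e : ℂ, e ≠ 0 ∧ F' (τ i) = e • F i := fun i =>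
    exists_eq_smul_of_dvd (hdiv i) (hF0 _) (by
      rw [(hF i).totalDegree (hFne i), (hF' (τ i)).totalDegree (hF0 _), hdeg' i])
  choose e he0 he using hsc
  refine ⟨τ, e, hdeg', he0, he, fun i => ?_⟩
  have hce : c = ∏ k, e k := by
    have h1 : ∏ i, F' i = (∏ k, e k) • ∏ i, F i := by
      rw [← Equiv.prod_comp τ F', ← Finset.prod_smul]
      exact Finset.prod_congr rfl fun i _ => he i
    rw [hc] at h1
    exact smul_left_injective ℂ hsq.ne_zero h1
  rw [← hce]
  exact hs i

end Residue

/-! ### Families of logarithmic forms and their integrating factors -/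

section Generic

instance (n k : ℕ) : FiniteDimensional ℂ (HomPoly n k) :=
  Module.Finite.iff_fg.2 (MvPolynomial.homogeneousSubmodule_fg _ _ k)

instance (n e : ℕ) : FiniteDimensional ℂ (ProjForm n e) := by
  let f : ProjForm n e →ₗ[ℂ] (Fin (n + 1) → HomPoly n (e - 1)) :=
    LinearMap.pi fun j => (LinearMap.proj j ∘ₗ (ProjForm n e).subtype).codRestrict _ fun a => a.2.1 j
  refine FiniteDimensional.of_injective f fun a b h => Subtype.ext (funext fun j => ?_)
  exact congrArg Subtype.val (congrFun h j)

variable {n m : ℕ} {d : Fin m → ℕ}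

/-- The vector space of all `(λ, F)`, which contains the cone over the parameter space. -/
abbrev ParamVec (n : ℕ) (d : Fin m → ℕ) : Type := Residues d × (∀ i, HomPoly n (d i))

/-- The linear functional `(λ, F) ↦ λᵢ`. -/
def residueCoord (i : Fin m) : ParamVec n d →ₗ[ℂ] ℂ where
  toFun v := v.1.1 i
  map_add' _ _ := rfl
  map_smul' _ _ := rfl

/-- The linear map `(λ, F) ↦ Fᵢ`. -/
def factorMap (i : Fin m) : ParamVec n d →ₗ[ℂ] Poly n where
  toFun v := v.2 i
  map_add' _ _ := rfl
  map_smul' _ _ := rfl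

theorem residue_mem_polyFun (i : Fin m) :
    (fun v : ParamVec n d => v.1.1 i) ∈ polyFun (ParamVec n d) :=
  dual_mem_polyFun (residueCoord i)

theorem factor_mem_polyMap (i : Fin m) :
    (fun v : ParamVec n d => (v.2 i : Poly n)) ∈ polyMap (ParamVec n d) (Poly n) :=
  linear_mem_polyMap (factorMap i)

theorem prod_factor_mem_polyMap (s : Finset (Fin m)) :
    (fun v : ParamVec n d => ∏ i ∈ s, (v.2 i : Poly n)) ∈ polyMap (ParamVec n d) (Poly n) :=
  prod_mem_polyMap s fun i _ => factor_mem_polyMap i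

theorem logForm_mem_polyMap (j : Fin (n + 1)) :
    (fun v : ParamVec n d => logForm v.1.1 (fun i => (v.2 i : Poly n)) j) ∈
      polyMap (ParamVec n d) (Poly n) := by
  refine sum_mem_polyMap _ fun i _ => ?_
  have h1 := mem_polyMap_complex.2 (residue_mem_polyFun (n := n) (d := d) i)
  have h2 := mul_mem_polyMap (prod_factor_mem_polyMap (n := n) (d := d) (Finset.univ.erase i))
    (comp_mem_polyMap (MvPolynomial.pderiv (R := ℂ) j).toLinearMap (factor_mem_polyMap i))
  exact bilin_mem_polyMap (LinearMap.lsmul ℂ (Poly n)) h1 h2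

/-- The map `μ` is polynomial. -/
theorem dual_comp_mu_mem (φ : ProjForm n (∑ i, d i) →ₗ[ℂ] ℂ) :
    (fun v => φ (mu n d v)) ∈ polyFun (ParamVec n d) := by
  obtain ⟨ψ, hψ⟩ := φ.exists_extend
  have := comp_mem_polyFun ψ (pi_mem_polyMap (f := fun v : ParamVec n d =>
    logForm v.1.1 (fun i => (v.2 i : Poly n))) logForm_mem_polyMap)
  convert this using 2 with v
  rw [← hψ]
  rfl

theorem comp_mu_mem {p : ProjForm n (∑ i, d i) → ℂ} (hp : p ∈ polyFun (ProjForm n (∑ i, d i))) :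
    (fun v => p (mu n d v)) ∈ polyFun (ParamVec n d) :=
  polyFun_comp_mem dual_comp_mu_mem hp

theorem isHomogeneous_factor (v : ParamVec n d) (i : Fin m) :
    (v.2 i : Poly n).IsHomogeneous (d i) :=
  (MvPolynomial.mem_homogeneousSubmodule _ _).1 (v.2 i).2

theorem isHomogeneous_prod_factor (v : ParamVec n d) :
    (∏ i, (v.2 i : Poly n)).IsHomogeneous (∑ i, d i) :=
  MvPolynomial.IsHomogeneous.prod _ _ _ fun i _ => isHomogeneous_factor v i

/-- The data for which the integrating factors of degree `∑ dᵢ` of the logarithmic form are the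
multiples of `∏ Fᵢ` form an open set. -/
theorem exists_forall_integrating_factor (v₀ : ParamVec n d) (h₀ : ∏ i, (v₀.2 i : Poly n) ≠ 0)
    (h : ∀ G ∈ HomPoly n (∑ i, d i), integratingMap (logForm v₀.1.1 fun i => (v₀.2 i : Poly n)) G = 0 →
      ∃ c : ℂ, G = c • ∏ i, (v₀.2 i : Poly n)) :
    ∃ b ∈ polyFun (ParamVec n d), b v₀ ≠ 0 ∧ ∀ v, b v ≠ 0 → ∀ G ∈ HomPoly n (∑ i, d i),
      integratingMap (logForm v.1.1 fun i => (v.2 i : Poly n)) G = 0 →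
      ∃ c : ℂ, G = c • ∏ i, (v.2 i : Poly n) := by
  -- a functional that does not vanish at `∏ Fᵢ` cuts the integrating factors down to zero
  obtain ⟨s, hs⟩ := MvPolynomial.support_nonempty.2 h₀
  rw [MvPolynomial.mem_support_iff] at hs
  let κ : Poly n →ₗ[ℂ] ℂ := MvPolynomial.lcoeff ℂ s
  let T : ParamVec n d → HomPoly n (∑ i, d i) →ₗ[ℂ]
      (Fin (n + 1) → Fin (n + 1) → Poly n) × ℂ := fun v =>
    ((integratingMap (logForm v.1.1 fun i => (v.2 i : Poly n))).prod κ) ∘ₗ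
      (HomPoly n (∑ i, d i)).subtype
  have hT : ∀ G, (fun v => T v G) ∈ polyMap (ParamVec n d) _ := fun G => by
    refine prodMk_mem_polyMap (pi_mem_polyMap fun j => pi_mem_polyMap fun k => ?_)
      (const_mem_polyMap _)
    have hD : ∀ j k, (fun v : ParamVec n d =>
        MvPolynomial.pderiv j (logForm v.1.1 (fun i => (v.2 i : Poly n)) k)) ∈
          polyMap (ParamVec n d) (Poly n) := fun j k =>
      comp_mem_polyMap (MvPolynomial.pderiv (R := ℂ) j).toLinearMap (logForm_mem_polyMap k)
    have hc : ∀ p : Poly n, (fun _ : ParamVec n d => p) ∈ polyMap (ParamVec n d) (Poly n) :=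
      fun p => const_mem_polyMap p
    exact Submodule.sub_mem _
      (mul_mem_polyMap (hc (G : Poly n)) (Submodule.sub_mem _ (hD j k) (hD k j)))
      (Submodule.sub_mem _
        (mul_mem_polyMap (hc (MvPolynomial.pderiv j (G : Poly n))) (logForm_mem_polyMap k))
        (mul_mem_polyMap (hc (MvPolynomial.pderiv k (G : Poly n))) (logForm_mem_polyMap j)))
  have hT₀ : Function.Injective (T v₀) := by
    rw [← LinearMap.ker_eq_bot, LinearMap.ker_eq_bot']
    intro G hG
    obtain ⟨c, hc⟩ := h G G.2 (congrArg Prod.fst hG)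
    have h2 : κ (G : Poly n) = 0 := congrArg Prod.snd hG
    rw [hc, map_smul, smul_eq_mul] at h2
    rw [(mul_eq_zero.1 h2).resolve_right hs, zero_smul] at hc
    exact Subtype.ext hc
  obtain ⟨b, hb, hb₀, hbi⟩ := exists_injective_of_ne_zero T hT v₀ hT₀
  refine ⟨fun v => b v * κ (∏ i, (v.2 i : Poly n)), Subalgebra.mul_mem _ hb
    (comp_mem_polyFun κ (prod_factor_mem_polyMap _)), mul_ne_zero hb₀ hs, fun v hv G hG hGi => ?_⟩
  have hκ : κ (∏ i, (v.2 i : Poly n)) ≠ 0 := right_ne_zero_of_mul hv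
  let F : HomPoly n (∑ i, d i) := ⟨∏ i, (v.2 i : Poly n), isHomogeneous_prod_factor v⟩
  let c := κ G / κ (∏ i, (v.2 i : Poly n))
  have h0 : (⟨G, hG⟩ - c • F : HomPoly n (∑ i, d i)) = 0 := by
    refine hbi v (left_ne_zero_of_mul hv) ?_
    rw [map_zero]
    refine Prod.ext ?_ ?_
    · change integratingMap _ (G - c • ∏ i, (v.2 i : Poly n)) = 0
      rw [map_sub, map_smul, hGi, integratingMap_logForm, smul_zero, sub_zero]
    · change κ (G - c • ∏ i, (v.2 i : Poly n)) = 0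
      rw [map_sub, map_smul, smul_eq_mul, div_mul_cancel₀ _ hκ, sub_self]
  exact ⟨c, congrArg Subtype.val (sub_eq_zero.1 h0)⟩

/-- For monomials `Fᵢ` the integrating factors are spanned by monomials, and the exponents of such
a monomial differ from those of `∏ Fᵢ` by a multiple of the vector of residues along the
coordinate hyperplanes. -/
theorem integratingMap_monomial (l : Fin m → ℂ) (e : Fin m → (Fin (n + 1) →₀ ℕ)) (G : Poly n)
    (hG : integratingMap (logForm l fun i => MvPolynomial.monomial (e i) (1 : ℂ)) G = 0)
    (β : Fin (n + 1) →₀ ℕ) (hβ : MvPolynomial.coeff β G ≠ 0) (j k : Fin (n + 1)) :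
    (∑ i, l i * e i k) * ((β j : ℂ) - ((∑ i, e i) j : ℕ)) =
      (∑ i, l i * e i j) * ((β k : ℂ) - ((∑ i, e i) k : ℕ)) := by
  by_cases hjk : j = k
  · rw [hjk]
  let w : Fin (n + 1) → ℂ := fun j => ∑ i, l i * e i j
  let E : Fin (n + 1) →₀ ℕ := ∑ i, e i
  let a := logForm l fun i => MvPolynomial.monomial (e i) (1 : ℂ)
  let M : Poly n := MvPolynomial.monomial E 1
  have ha : ∀ j, MvPolynomial.X j * a j = MvPolynomial.C (w j) * M := by
    intro j
    simp only [a, logForm, Finset.mul_sum, w, map_sum, Finset.sum_mul]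
    refine Finset.sum_congr rfl fun i _ => ?_
    have h1 : (∏ k ∈ Finset.univ.erase i, MvPolynomial.monomial (e k) (1 : ℂ)) *
        MvPolynomial.monomial (e i) 1 = M := by
      rw [mul_comm, Finset.mul_prod_erase Finset.univ (fun k => MvPolynomial.monomial (e k) (1 : ℂ))
        (Finset.mem_univ i), ← MvPolynomial.monomial_sum_one]
    rw [mul_smul_comm, mul_left_comm, MvPolynomial.X_mul_pderiv_monomial, mul_smul_comm, h1,
      MvPolynomial.smul_eq_C_mul, map_mul, mul_assoc, map_natCast, nsmul_eq_mul]
  have hX : ∀ j k, j ≠ k → MvPolynomial.X j * (MvPolynomial.X k * MvPolynomial.pderiv j (a k)) =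
      MvPolynomial.C (w k * (E j : ℕ)) * M := by
    intro j k hjk
    have h1 : MvPolynomial.X k * MvPolynomial.pderiv j (a k) =
        MvPolynomial.pderiv j (MvPolynomial.X k * a k) := by
      rw [MvPolynomial.pderiv_mul, MvPolynomial.pderiv_X_of_ne hjk.symm]
      ring
    rw [h1, ha, MvPolynomial.pderiv_C_mul, mul_left_comm, MvPolynomial.X_mul_pderiv_monomial,
      map_mul, mul_assoc, map_natCast, nsmul_eq_mul]
  have hcoef : ∀ j, MvPolynomial.coeff β (MvPolynomial.X j * MvPolynomial.pderiv j G) =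
      β j * MvPolynomial.coeff β G := by
    intro j
    rw [MvPolynomial.coeff_X_mul']
    split_ifs with h
    · rw [Finsupp.mem_support_iff] at h
      have h1 : β - Finsupp.single j 1 + Finsupp.single j 1 = β :=
        tsub_add_cancel_of_le (Finsupp.single_le_iff.2 (Nat.one_le_iff_ne_zero.2 h))
      rw [MvPolynomial.coeff_pderiv, h1, mul_comm]
      congr 1
      rw [← Nat.cast_add_one]
      congr 1
      simp
      omega
    · rw [Finsupp.notMem_support_iff] at h
      simp [h]
  have h1 := congrFun (congrFun hG j) k
  rw [integratingMap_apply, Pi.zero_apply, Pi.zero_apply] at h1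
  change G * (MvPolynomial.pderiv j (a k) - MvPolynomial.pderiv k (a j)) -
      (MvPolynomial.pderiv j G * a k - MvPolynomial.pderiv k G * a j) = 0 at h1
  have h2 : M * (MvPolynomial.C (w k * (E j : ℕ)) * G - MvPolynomial.C (w j * (E k : ℕ)) * G -
      (MvPolynomial.C (w k) * (MvPolynomial.X j * MvPolynomial.pderiv j G) -
        MvPolynomial.C (w j) * (MvPolynomial.X k * MvPolynomial.pderiv k G))) = 0 := by
    linear_combination (MvPolynomial.X j * MvPolynomial.X k) * h1 - G * hX j k hjk +
      G * hX k j (Ne.symm hjk) + MvPolynomial.X j * MvPolynomial.pderiv j G * ha k -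
      MvPolynomial.X k * MvPolynomial.pderiv k G * ha j
  have hM : M ≠ 0 := by simp [M]
  have h3 := congrArg (MvPolynomial.coeff β) ((mul_eq_zero.1 h2).resolve_left hM)
  simp only [MvPolynomial.coeff_sub, MvPolynomial.coeff_C_mul, hcoef, MvPolynomial.coeff_zero] at h3
  change w k * ((β j : ℂ) - (E j : ℕ)) = w j * ((β k : ℂ) - (E k : ℕ))
  refine mul_right_cancel₀ hβ ?_
  linear_combination -h3

/-- If the exponents and residues admit no resonance, then the monomials with these exponents are an
example in which `∏ Fᵢ` is the only integrating factor. -/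
theorem exists_of_no_resonance (l : Residues d) (e : Fin m → (Fin (n + 1) →₀ ℕ))
    (he : ∀ i, (e i).degree = d i)
    (hres : ∀ β : Fin (n + 1) →₀ ℕ, (∀ j k, (∑ i, l.1 i * e i k) * ((β j : ℂ) - ((∑ i, e i) j : ℕ)) =
      (∑ i, l.1 i * e i j) * ((β k : ℂ) - ((∑ i, e i) k : ℕ))) → β = ∑ i, e i) :
    ∃ v₀ : ParamVec n d, ∏ i, (v₀.2 i : Poly n) ≠ 0 ∧ ∀ G,
      integratingMap (logForm v₀.1.1 fun i => (v₀.2 i : Poly n)) G = 0 →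
      ∃ c : ℂ, G = c • ∏ i, (v₀.2 i : Poly n) := by
  refine ⟨(l, fun i => ⟨MvPolynomial.monomial (e i) 1, ?_⟩), ?_, fun G hG => ?_⟩
  · exact MvPolynomial.isHomogeneous_monomial _ (he i)
  · exact Finset.prod_ne_zero_iff.2 fun i _ => by simp
  · refine ⟨MvPolynomial.coeff (∑ i, e i) G, ?_⟩
    change G = _ • ∏ i, MvPolynomial.monomial (e i) (1 : ℂ)
    rw [← MvPolynomial.monomial_sum_one, MvPolynomial.smul_monomial, smul_eq_mul, mul_one]
    ext β
    rw [MvPolynomial.coeff_monomial]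
    split_ifs with h
    · rw [h]
    · by_contra hβ
      exact h (hres β (integratingMap_monomial l.1 e G hG β hβ)).symm

end Generic

/-! ### Squarefree products and distinct residues -/

section Generic

variable {n m : ℕ} {d : Fin m → ℕ}

/-- The linear form `x₀ - c x₁`. -/
def linForm (hn : 1 ≤ n) (c : ℂ) : Poly n :=
  MvPolynomial.X 0 - MvPolynomial.C c * MvPolynomial.X ⟨1, by omega⟩

theorem isHomogeneous_linForm (hn : 1 ≤ n) (c : ℂ) : (linForm hn c).IsHomogeneous 1 :=
  (MvPolynomial.isHomogeneous_X ℂ _).sub (MvPolynomial.isHomogeneous_C_mul_X c _)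

theorem eval_linForm (hn : 1 ≤ n) (c c' : ℂ) :
    MvPolynomial.eval (fun j : Fin (n + 1) => if j = 0 then c' else 1) (linForm hn c) = c' - c := by
  have : (⟨1, by omega⟩ : Fin (n + 1)) ≠ 0 := by simp [Fin.ext_iff]
  simp [linForm, this]

theorem pderiv_linForm (hn : 1 ≤ n) (c : ℂ) : MvPolynomial.pderiv 0 (linForm hn c) = 1 := by
  have : (⟨1, by omega⟩ : Fin (n + 1)) ≠ 0 := by simp [Fin.ext_iff]
  rw [linForm, map_sub, MvPolynomial.pderiv_C_mul, MvPolynomial.pderiv_X_self,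
    MvPolynomial.pderiv_X_of_ne this, mul_zero, sub_zero]

theorem linForm_ne_zero (hn : 1 ≤ n) (c : ℂ) : linForm hn c ≠ 0 := fun h => by
  have := pderiv_linForm hn c
  rw [h, map_zero] at this
  exact zero_ne_one this

theorem irreducible_linForm (hn : 1 ≤ n) (c : ℂ) : Irreducible (linForm hn c) := by
  refine MvPolynomial.irreducible_of_totalDegree_eq_one
    ((isHomogeneous_linForm hn c).totalDegree (linForm_ne_zero hn c)) fun x hx => ?_
  refine isUnit_iff_ne_zero.2 ?_
  rintro rfl
  refine linForm_ne_zero hn c (MvPolynomial.ext _ _ fun s => ?_)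
  rw [zero_dvd_iff.1 (hx s), MvPolynomial.coeff_zero]

theorem not_linForm_dvd (hn : 1 ≤ n) {c c' : ℂ} (h : c ≠ c') :
    ¬ linForm hn c ∣ linForm hn c' := by
  rintro ⟨q, hq⟩
  have := congrArg (MvPolynomial.eval (fun j : Fin (n + 1) => if j = 0 then c else 1)) hq
  rw [map_mul, eval_linForm, eval_linForm, sub_self, zero_mul, sub_eq_zero] at this
  exact h this

/-- A product `F` of distinct linear forms is coprime to its derivative. -/
theorem prod_linForm_dvd (hn : 1 ≤ n) {ι : Type*} [Fintype ι] {c : ι → ℂ}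
    (hc : Function.Injective c) {A B : Poly n}
    (h : A * ∏ s, linForm hn (c s) = B * MvPolynomial.pderiv 0 (∏ s, linForm hn (c s))) :
    ∏ s, linForm hn (c s) ∣ B := by
  classical
  refine Fintype.prod_dvd_of_isRelPrime (fun s t hst => ?_) fun s => ?_
  · exact (irreducible_linForm hn (c s)).isRelPrime_iff_not_dvd.2
      (not_linForm_dvd hn fun h => hst (hc h))
  · have hp := (irreducible_linForm hn (c s)).prime
    have hF := Finset.mul_prod_erase Finset.univ (fun s => linForm hn (c s)) (Finset.mem_univ s)
    rw [← hF, MvPolynomial.pderiv_mul, pderiv_linForm, one_mul] at h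
    have h1 : linForm hn (c s) ∣ B * ∏ t ∈ Finset.univ.erase s, linForm hn (c t) :=
      ⟨A * (∏ t ∈ Finset.univ.erase s, linForm hn (c t)) -
        B * MvPolynomial.pderiv 0 (∏ t ∈ Finset.univ.erase s, linForm hn (c t)), by
          linear_combination -h⟩
    rcases hp.dvd_or_dvd h1 with h2 | h2
    · exact h2
    · obtain ⟨t, ht, htd⟩ := hp.exists_mem_finset_dvd h2
      exact absurd htd (not_linForm_dvd hn fun h => Finset.ne_of_mem_erase ht (hc h).symm)

/-- The data for which `∏ Fᵢ` is squarefree contain a non-empty open set. Squarefreeness is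
expressed by the injectivity of the map `(A, B) ↦ A F - B ∂₀F` on pairs of polynomials of degree
less than that of `F`. -/
theorem exists_forall_squarefree (hn : 1 ≤ n) (hd : 0 < ∑ i, d i) :
    ∃ b ∈ polyFun (ParamVec n d), (∃ v, b v ≠ 0) ∧
      ∀ v, b v ≠ 0 → Squarefree (∏ i, (v.2 i : Poly n)) := by
  let D := ∑ i, d i
  let R := MvPolynomial.restrictTotalDegree (Fin (n + 1)) ℂ (D - 1)
  let T : ParamVec n d → R × R →ₗ[ℂ] Poly n := fun v =>
    LinearMap.mulRight ℂ (∏ i, (v.2 i : Poly n)) ∘ₗ R.subtype ∘ₗ LinearMap.fst ℂ R R -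
      LinearMap.mulRight ℂ (MvPolynomial.pderiv 0 (∏ i, (v.2 i : Poly n))) ∘ₗ R.subtype ∘ₗ
        LinearMap.snd ℂ R R
  have hTapp : ∀ v A B, T v (A, B) = (A : Poly n) * (∏ i, (v.2 i : Poly n)) -
    (B : Poly n) * MvPolynomial.pderiv 0 (∏ i, (v.2 i : Poly n)) := fun _ _ _ => rfl
  have hT : ∀ u, (fun v => T v u) ∈ polyMap (ParamVec n d) (Poly n) := by
    rintro ⟨A, B⟩
    have hc : ∀ p : Poly n, (fun _ : ParamVec n d => p) ∈ polyMap (ParamVec n d) (Poly n) :=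
      fun p => const_mem_polyMap p
    exact Submodule.sub_mem _ (mul_mem_polyMap (hc A) (prod_factor_mem_polyMap _))
      (mul_mem_polyMap (hc B) (comp_mem_polyMap (MvPolynomial.pderiv (R := ℂ) 0).toLinearMap
        (prod_factor_mem_polyMap _)))
  -- the example: products of distinct linear forms
  let c : (Σ i : Fin m, Fin (d i)) → ℂ := fun s => ((Fintype.equivFin _ s : ℕ) : ℂ)
  have hc : Function.Injective c := fun s t h =>
    (Fintype.equivFin _).injective (Fin.ext (Nat.cast_injective h))
  let v₁ : ParamVec n d := (0, fun i => ⟨∏ t : Fin (d i), linForm hn (c ⟨i, t⟩), by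
    have := MvPolynomial.IsHomogeneous.prod Finset.univ (fun t : Fin (d i) => linForm hn (c ⟨i, t⟩))
      (fun _ => 1) fun t _ => isHomogeneous_linForm hn _
    simpa using this⟩)
  have hv₁ : ∏ i, (v₁.2 i : Poly n) = ∏ s, linForm hn (c s) :=
    (Fintype.prod_sigma fun s => linForm hn (c s)).symm
  have hv₁0 : ∏ i, (v₁.2 i : Poly n) ≠ 0 := by
    rw [hv₁]
    exact Finset.prod_ne_zero_iff.2 fun s _ => linForm_ne_zero hn _
  have hT₁ : Function.Injective (T v₁) := by
    rw [← LinearMap.ker_eq_bot, LinearMap.ker_eq_bot']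
    rintro ⟨A, B⟩ hAB
    rw [hTapp, sub_eq_zero] at hAB
    have hB : (B : Poly n) = 0 := by
      by_contra hB
      have h1 : ∏ i, (v₁.2 i : Poly n) ∣ B := by
        rw [hv₁] at hAB ⊢
        exact prod_linForm_dvd hn hc hAB
      have h2 := MvPolynomial.totalDegree_le_of_dvd_of_isDomain h1 hB
      rw [(isHomogeneous_prod_factor v₁).totalDegree hv₁0] at h2
      have h3 := (MvPolynomial.mem_restrictTotalDegree _ _ _).1 B.2
      omega
    rw [hB, zero_mul] at hAB
    have hA : (A : Poly n) = 0 := (mul_eq_zero.1 hAB).resolve_right hv₁0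
    exact Prod.ext (Subtype.ext hA) (Subtype.ext hB)
  obtain ⟨b, hb, hb₁, hbi⟩ := exists_injective_of_ne_zero T hT v₁ hT₁
  refine ⟨b, hb, ⟨v₁, hb₁⟩, fun v hv => ?_⟩
  have hinj := hbi v hv
  have hF0 : ∏ i, (v.2 i : Poly n) ≠ 0 := fun h0 => by
    have h1 : (1 : Poly n) ∈ R := (MvPolynomial.mem_restrictTotalDegree _ _ _).2 (by simp)
    have h2 : T v (⟨1, h1⟩, 0) = T v 0 := by
      rw [hTapp, h0, map_zero]
      simp
    exact one_ne_zero (congrArg (fun u : R × R => (u.1 : Poly n)) (hinj h2))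
  rintro P ⟨Q, hQ⟩
  by_contra hP
  rw [mul_assoc] at hQ
  have hPQ0 : P * Q ≠ 0 := fun h => hF0 (by rw [hQ, h, mul_zero])
  have hP0 : P ≠ 0 := left_ne_zero_of_mul hPQ0
  have hQ0 : Q ≠ 0 := right_ne_zero_of_mul hPQ0
  have hPd := totalDegree_ne_zero_of_not_isUnit hP0 hP
  have hdeg := (isHomogeneous_prod_factor v).totalDegree hF0
  have hdPQ := MvPolynomial.totalDegree_mul_of_isDomain hP0 hQ0
  rw [hQ, MvPolynomial.totalDegree_mul_of_isDomain hP0 hPQ0] at hdeg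
  have hB : P * Q ∈ R := (MvPolynomial.mem_restrictTotalDegree _ _ _).2 (by omega)
  have hA : MvPolynomial.pderiv 0 (P * Q) + Q * MvPolynomial.pderiv 0 P ∈ R := by
    refine Submodule.add_mem _ ((MvPolynomial.mem_restrictTotalDegree _ _ _).2 ?_)
      ((MvPolynomial.mem_restrictTotalDegree _ _ _).2 ?_)
    · have := totalDegree_pderiv_le (P * Q) 0
      omega
    · have h1 := totalDegree_pderiv_le P 0
      have h2 := MvPolynomial.totalDegree_mul Q (MvPolynomial.pderiv 0 P)
      omega
  have h2 : T v (⟨_, hA⟩, ⟨_, hB⟩) = T v 0 := by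
    rw [hTapp, map_zero, hQ]
    simp only [MvPolynomial.pderiv_mul]
    ring
  exact hPQ0 (congrArg (fun u : R × R => (u.2 : Poly n)) (hinj h2))

/-- The data with distinct residues form a non-empty open set. -/
theorem exists_forall_injective (n : ℕ) (hd : ∀ i, 0 < d i) :
    ∃ b ∈ polyFun (ParamVec n d), (∃ v, b v ≠ 0) ∧
      ∀ v, b v ≠ 0 → Function.Injective v.1.1 := by
  let p : Fin m × Fin m → polyFun (ParamVec n d) := fun s =>
    ⟨fun v => v.1.1 s.1 - v.1.1 s.2, Subalgebra.sub_mem _ (residue_mem_polyFun s.1)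
      (residue_mem_polyFun s.2)⟩
  have hp : ∀ s ∈ (Finset.univ : Finset (Fin m)).offDiag, p s ≠ 0 := by
    rintro ⟨i, j⟩ hij h
    have hij' : i ≠ j := (Finset.mem_offDiag.1 hij).2.2
    let l : Fin m → ℂ := Pi.single i (d j : ℂ) - Pi.single j (d i : ℂ)
    have hl : l ∈ Residues d := by
      change ∑ k, (d k : ℂ) * l k = 0
      simp only [l, Pi.sub_apply, mul_sub, Finset.sum_sub_distrib]
      simp [Pi.single_apply, mul_comm]
    have h1 := congrFun (congrArg Subtype.val h) ((⟨l, hl⟩, 0) : ParamVec n d)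
    have h2 : l i - l j = 0 := h1
    simp only [l, Pi.sub_apply, Pi.single_eq_same, Pi.single_eq_of_ne hij',
      Pi.single_eq_of_ne hij'.symm] at h2
    have h3 : ((d j + d i : ℕ) : ℂ) = 0 := by
      push_cast
      linear_combination h2
    have := hd i
    have h4 : d j + d i = 0 := by exact_mod_cast h3
    omega
  have hb : ∏ s ∈ (Finset.univ : Finset (Fin m)).offDiag, p s ≠ 0 := Finset.prod_ne_zero_iff.2 hp
  refine ⟨_, (∏ s ∈ (Finset.univ : Finset (Fin m)).offDiag, p s).2, ?_, fun v hv i j hij => ?_⟩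
  · by_contra! h
    exact hb (Subtype.ext (funext h))
  · by_contra hne
    refine hv ?_
    change evalAt v (∏ s ∈ (Finset.univ : Finset (Fin m)).offDiag, p s) = 0
    rw [map_prod]
    exact Finset.prod_eq_zero (i := (i, j)) (Finset.mem_offDiag.2
      ⟨Finset.mem_univ _, Finset.mem_univ _, hne⟩) (sub_eq_zero.2 hij)

end Generic

/-! ### Examples without resonance -/

section Generic

variable {n m : ℕ} {d : Fin m → ℕ}

/-- With at least three factors, the monomials `x₀ ^ d₀`, `x₁ ^ d₁`, `x₂ ^ dᵢ` (`i ≥ 2`) with residues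
along the first two coordinate hyperplanes of irrational ratio have no resonance. -/
theorem exists_example_of_three_le (hn : 2 ≤ n) (hm : 3 ≤ m) (hd : ∀ i, 0 < d i) :
    ∃ v₀ : ParamVec n d, ∏ i, (v₀.2 i : Poly n) ≠ 0 ∧ ∀ G,
      integratingMap (logForm v₀.1.1 fun i => (v₀.2 i : Poly n)) G = 0 →
      ∃ c : ℂ, G = c • ∏ i, (v₀.2 i : Poly n) := by
  let x : Fin 3 → Fin (n + 1) := fun j => ⟨j, by omega⟩
  let y : Fin 3 → Fin m := fun j => ⟨j, by omega⟩
  have hx : Function.Injective x := fun a b h => Fin.ext (Fin.mk.inj h)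
  have hy : Function.Injective y := fun a b h => Fin.ext (Fin.mk.inj h)
  let pos : Fin m → Fin 3 := fun i => if i = y 0 then 0 else if i = y 1 then 1 else 2
  have hpos0 : ∀ i, pos i = 0 ↔ i = y 0 := fun i => by
    simp only [pos]
    split_ifs with h1 h2 <;> simp [h1]
  have hpos1 : ∀ i, pos i = 1 ↔ i = y 1 := fun i => by
    simp only [pos]
    split_ifs with h1 h2
    · rw [h1]
      simp [hy.eq_iff]
    · simp [h2]
    · simp [h2]
  let e : Fin m → (Fin (n + 1) →₀ ℕ) := fun i => Finsupp.single (x (pos i)) (d i)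
  have hd' : ∀ i, (d i : ℂ) ≠ 0 := fun i => Nat.cast_ne_zero.2 (hd i).ne'
  let l : Fin m → ℂ := Pi.single (y 0) (1 / d (y 0) : ℂ) + Pi.single (y 1) (Complex.I / d (y 1)) -
    Pi.single (y 2) ((1 + Complex.I) / d (y 2))
  have hl : l ∈ Residues d := by
    change ∑ k, (d k : ℂ) * l k = 0
    simp only [l, Pi.sub_apply, Pi.add_apply, mul_sub, mul_add, Finset.sum_sub_distrib,
      Finset.sum_add_distrib]
    simp only [Pi.single_apply, mul_ite, mul_zero, Finset.sum_ite_eq', Finset.mem_univ, if_true,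
      mul_div_cancel₀ _ (hd' _)]
    ring
  have hl0 : l (y 0) = 1 / d (y 0) := by
    simp [l, hy.eq_iff]
  have hl1 : l (y 1) = Complex.I / d (y 1) := by
    simp [l, hy.eq_iff]
  have hw0 : ∑ i, l i * e i (x 0) = 1 := by
    have h1 : ∀ i, l i * (e i (x 0) : ℂ) = if i = y 0 then l i * d i else 0 := fun i => by
      simp only [e, Finsupp.single_apply, hx.eq_iff, hpos0]
      split_ifs <;> simp
    simp only [h1, Finset.sum_ite_eq', Finset.mem_univ, if_true, hl0]
    exact div_mul_cancel₀ _ (hd' _)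
  have hw1 : ∑ i, l i * e i (x 1) = Complex.I := by
    have h1 : ∀ i, l i * (e i (x 1) : ℂ) = if i = y 1 then l i * d i else 0 := fun i => by
      simp only [e, Finsupp.single_apply, hx.eq_iff, hpos1]
      split_ifs <;> simp
    simp only [h1, Finset.sum_ite_eq', Finset.mem_univ, if_true, hl1]
    exact div_mul_cancel₀ _ (hd' _)
  refine exists_of_no_resonance ⟨l, hl⟩ e (fun i => by simp [e]) fun β hβ => ?_
  have h01 := hβ (x 0) (x 1)
  change (∑ i, l i * e i (x 1)) * _ = (∑ i, l i * e i (x 0)) * _ at h01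
  rw [hw0, hw1] at h01
  have hre : (β (x 0) : ℝ) = ((∑ i, e i) (x 0) : ℕ) := by
    simpa [sub_eq_zero] using congrArg Complex.im h01
  have hre' : β (x 0) = (∑ i, e i) (x 0) := by exact_mod_cast hre
  ext k
  have h0k := hβ (x 0) k
  change (∑ i, l i * e i k) * _ = (∑ i, l i * e i (x 0)) * _ at h0k
  rw [hw0, one_mul, hre', sub_self, mul_zero] at h0k
  exact_mod_cast sub_eq_zero.1 h0k.symm

/-- The arithmetic behind the case of two factors: if neither of `d₁ = g s` and `d₂ = g t` divides
the other, then `s, t ≥ 2`. -/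
theorem exists_bezout {d₁ d₂ : ℕ} (h₁ : 0 < d₁) (h₂ : 0 < d₂) (h₁₂ : ¬ d₁ ∣ d₂) (h₂₁ : ¬ d₂ ∣ d₁) :
    ∃ g s t b b' : ℕ, d₁ = g * s ∧ d₂ = g * t ∧ 2 ≤ s ∧ 2 ≤ t ∧ t * b = s * b' + 1 ∧
      b < d₁ ∧ b' < d₂ := by
  obtain ⟨g, s, t, hg, hst, rfl, rfl⟩ : ∃ g s t : ℕ, 0 < g ∧ Nat.Coprime s t ∧ d₁ = g * s ∧
      d₂ = g * t := by
    obtain ⟨s, t, hst, hs, ht⟩ := Nat.exists_coprime d₁ d₂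
    exact ⟨Nat.gcd d₁ d₂, s, t, Nat.gcd_pos_of_pos_left _ h₁, hst, by rw [mul_comm]; exact hs,
      by rw [mul_comm]; exact ht⟩
  have hs : 2 ≤ s := by
    by_contra h
    interval_cases s
    · simp at h₁
    · simp at h₁₂
  have ht : 2 ≤ t := by
    by_contra h
    interval_cases t
    · simp at h₂
    · simp at h₂₁
  obtain ⟨b, hb, hmod⟩ := Nat.exists_mul_mod_eq_one_of_coprime hst.symm hs
  have hdiv := Nat.div_add_mod (t * b) s
  rw [hmod] at hdiv
  refine ⟨g, s, t, b, t * b / s, rfl, rfl, hs, ht, hdiv.symm, ?_, ?_⟩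
  · exact hb.trans_le (Nat.le_mul_of_pos_left s hg)
  · refine lt_of_lt_of_le ?_ (Nat.le_mul_of_pos_left t hg)
    refine Nat.div_lt_of_lt_mul ?_
    rw [mul_comm s t]
    exact Nat.mul_lt_mul_of_pos_left hb (by omega)

/-- With two factors none of whose degrees divides the other, there are monomials in three variables
without resonance. -/
theorem exists_example_of_two (hn : 2 ≤ n) {d : Fin 2 → ℕ} (hd : ∀ i, 0 < d i)
    (h₂ : ∀ i j, i ≠ j → ¬ d i ∣ d j) :
    ∃ v₀ : ParamVec n d, ∏ i, (v₀.2 i : Poly n) ≠ 0 ∧ ∀ G,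
      integratingMap (logForm v₀.1.1 fun i => (v₀.2 i : Poly n)) G = 0 →
      ∃ c : ℂ, G = c • ∏ i, (v₀.2 i : Poly n) := by
  obtain ⟨g, s, t, b, b', h1, h2, hs, ht, hb, hb1, hb2⟩ :=
    exists_bezout (hd 0) (hd 1) (h₂ 0 1 (by decide)) (h₂ 1 0 (by decide))
  let x : Fin 3 → Fin (n + 1) := fun j => ⟨j, by omega⟩
  have hx : Function.Injective x := fun a b h => Fin.ext (Fin.mk.inj h)
  let e : Fin 2 → (Fin (n + 1) →₀ ℕ) := ![Finsupp.single (x 0) (d 0 - b) + Finsupp.single (x 1) b,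
    Finsupp.single (x 1) b' + Finsupp.single (x 2) (d 1 - b')]
  let l : Fin 2 → ℂ := ![t, -s]
  have hl : l ∈ Residues d := by
    change ∑ k, (d k : ℂ) * l k = 0
    simp only [Fin.sum_univ_two, l, Matrix.cons_val_zero, Matrix.cons_val_one, h1, h2]
    push_cast
    ring
  have he : ∀ i, (e i).degree = d i := by
    intro i
    fin_cases i
    · change (Finsupp.single (x 0) (d 0 - b) + Finsupp.single (x 1) b).degree = d 0
      rw [map_add, Finsupp.degree_single, Finsupp.degree_single]
      omega
    · change (Finsupp.single (x 1) b' + Finsupp.single (x 2) (d 1 - b')).degree = d 1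
      rw [map_add, Finsupp.degree_single, Finsupp.degree_single]
      omega
  have hw0 : ∑ i, l i * e i (x 0) = ((t * (d 0 - b : ℕ) : ℕ) : ℂ) := by
    simp [Fin.sum_univ_two, l, e, hx.eq_iff]
  have hw1 : ∑ i, l i * e i (x 1) = 1 := by
    have : ((t * b : ℕ) : ℂ) = ((s * b' + 1 : ℕ) : ℂ) := by rw [hb]
    push_cast at this
    simp [Fin.sum_univ_two, l, e, hx.eq_iff]
    linear_combination this
  have hw2 : ∑ i, l i * e i (x 2) = -((s * (d 1 - b' : ℕ) : ℕ) : ℂ) := by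
    simp [Fin.sum_univ_two, l, e, hx.eq_iff]
  have hE0 : (∑ i, e i) (x 0) = d 0 - b := by
    simp [Fin.sum_univ_two, e, hx.eq_iff]
  have hE2 : (∑ i, e i) (x 2) = d 1 - b' := by
    simp [Fin.sum_univ_two, e, hx.eq_iff]
  refine exists_of_no_resonance ⟨l, hl⟩ e he fun β hβ => ?_
  have hk : ∀ k, (β k : ℂ) - ((∑ i, e i) k : ℕ) = (∑ i, l i * e i k) *
      ((β (x 1) : ℂ) - ((∑ i, e i) (x 1) : ℕ)) := fun k => by
    have := hβ (x 1) k
    change (∑ i, l i * e i k) * _ = (∑ i, l i * e i (x 1)) * _ at this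
    rw [hw1, one_mul] at this
    exact this.symm
  -- the multiple of the vector of residues is an integer `r`, which has to be zero
  obtain ⟨r, hr⟩ : ∃ r : ℤ, (r : ℂ) = (β (x 1) : ℂ) - ((∑ i, e i) (x 1) : ℕ) :=
    ⟨(β (x 1) : ℤ) - ((∑ i, e i) (x 1) : ℕ), by push_cast; rfl⟩
  have hr0 : r = 0 := by
    have h0 := hk (x 0)
    have h2' := hk (x 2)
    rw [hw0, hE0, ← hr] at h0
    rw [hw2, hE2, ← hr] at h2'
    have h0' : (β (x 0) : ℤ) - (d 0 - b : ℕ) = t * (d 0 - b : ℕ) * r := by exact_mod_cast h0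
    have h2'' : (β (x 2) : ℤ) - (d 1 - b' : ℕ) = -(s * (d 1 - b' : ℕ)) * r := by
      exact_mod_cast h2'
    have p0 : (1 : ℤ) ≤ (d 0 - b : ℕ) := by omega
    have p2 : (1 : ℤ) ≤ (d 1 - b' : ℕ) := by omega
    generalize ((d 0 - b : ℕ) : ℤ) = u at *
    generalize ((d 1 - b' : ℕ) : ℤ) = u' at *
    have q0 : (0 : ℤ) ≤ β (x 0) := by positivity
    have q2 : (0 : ℤ) ≤ β (x 2) := by positivity
    have hs' : (2 : ℤ) ≤ s := by exact_mod_cast hs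
    have ht' : (2 : ℤ) ≤ t := by exact_mod_cast ht
    rcases lt_trichotomy r 0 with hr | hr | hr
    · exfalso
      nlinarith [mul_le_mul_of_nonneg_left (show r ≤ -1 by omega)
        (show (0 : ℤ) ≤ t * u by positivity), mul_le_mul_of_nonneg_right ht' (show (0 : ℤ) ≤ u by omega)]
    · exact hr
    · exfalso
      nlinarith [mul_le_mul_of_nonneg_left (show 1 ≤ r by omega)
        (show (0 : ℤ) ≤ s * u' by positivity), mul_le_mul_of_nonneg_right hs' (show (0 : ℤ) ≤ u' by omega)]
  ext k
  have := hk k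
  rw [← hr, hr0, Int.cast_zero, mul_zero, sub_eq_zero] at this
  exact_mod_cast this

end Generic

/-! ### Generic injectivity -/

section Generic

variable {n m : ℕ} {d : Fin m → ℕ}

/-- There are `(λ, F)` for which `∏ Fᵢ` is the only integrating factor of the logarithmic form up to
scalars. -/
theorem exists_example (hn : 2 ≤ n) (hm : 2 ≤ m) (hd : ∀ i, 0 < d i)
    (h₂ : m = 2 → ∀ i j, i ≠ j → ¬ d i ∣ d j) :
    ∃ v₀ : ParamVec n d, ∏ i, (v₀.2 i : Poly n) ≠ 0 ∧ ∀ G,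
      integratingMap (logForm v₀.1.1 fun i => (v₀.2 i : Poly n)) G = 0 →
      ∃ c : ℂ, G = c • ∏ i, (v₀.2 i : Poly n) := by
  rcases hm.eq_or_lt with rfl | hm
  · exact exists_example_of_two hn hd (h₂ rfl)
  · exact exists_example_of_three_le hn hm hd

/-- Generic injectivity on the level of `μ`: for `v` in a non-empty open set, `μ v` determines `v` up
to the order of the entries and scalars. -/
theorem exists_generic (hn : 2 ≤ n) (hm : 2 ≤ m) (hd : ∀ i, 0 < d i)
    (h₂ : m = 2 → ∀ i j, i ≠ j → ¬ d i ∣ d j) :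
    ∃ b ∈ polyFun (ParamVec n d), (∃ v, b v ≠ 0) ∧ ∀ v, b v ≠ 0 →
      (v ∈ ParamCone n d ∧ mu n d v ≠ 0) ∧
      ∀ v' : ParamVec n d, (∀ i, v'.2 i ≠ 0) → mu n d v = mu n d v' →
      ∃ (s : degreePerm d) (e : Fin m → ℂ), (∀ i, e i ≠ 0) ∧
        (∀ i, (v'.2 (s.1 i) : Poly n) = e i • (v.2 i : Poly n)) ∧
        ∀ i, v.1.1 i = (∏ k, e k) * v'.1.1 (s.1 i) := by
  obtain ⟨v₀, h0, hex⟩ := exists_example hn hm hd h₂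
  have hD : 0 < ∑ i, d i :=
    Finset.sum_pos (fun i _ => hd i) ⟨⟨0, by omega⟩, Finset.mem_univ _⟩
  obtain ⟨b₁, hb₁, hb₁0, h₁⟩ := exists_forall_integrating_factor v₀ h0 fun G _ => hex G
  obtain ⟨b₂, hb₂, hb₂0, h₂⟩ := exists_forall_squarefree (d := d) (by omega : 1 ≤ n) hD
  obtain ⟨b₃, hb₃, hb₃0, h₃⟩ := exists_forall_injective n hd
  refine ⟨fun v => b₁ v * (b₂ v * b₃ v), Subalgebra.mul_mem _ hb₁ (Subalgebra.mul_mem _ hb₂ hb₃),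
    ?_, fun v hv => ?_⟩
  · obtain ⟨v, hv⟩ := polyFun_mul_ne_zero hb₂ hb₃ hb₂0 hb₃0
    obtain ⟨v, hv⟩ := polyFun_mul_ne_zero hb₁ (Subalgebra.mul_mem _ hb₂ hb₃) ⟨_, hb₁0⟩
      ⟨v, mul_ne_zero hv.1 hv.2⟩
    exact ⟨v, mul_ne_zero hv.1 hv.2⟩
  have hv₁ := h₁ v (left_ne_zero_of_mul hv)
  have hv₂ := h₂ v (left_ne_zero_of_mul (right_ne_zero_of_mul hv))
  have hv₃ := h₃ v (right_ne_zero_of_mul (right_ne_zero_of_mul hv))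
  have main : ∀ v' : ParamVec n d, (∀ i, v'.2 i ≠ 0) → mu n d v = mu n d v' →
      ∃ (s : degreePerm d) (e : Fin m → ℂ), (∀ i, e i ≠ 0) ∧
        (∀ i, (v'.2 (s.1 i) : Poly n) = e i • (v.2 i : Poly n)) ∧
        ∀ i, v.1.1 i = (∏ k, e k) * v'.1.1 (s.1 i) := by
    intro v' hv' hmu
    have hlog : logForm v.1.1 (fun i => (v.2 i : Poly n)) =
        logForm v'.1.1 (fun i => (v'.2 i : Poly n)) := congrArg Subtype.val hmu
    obtain ⟨c, hc⟩ := hv₁ (∏ i, (v'.2 i : Poly n)) (isHomogeneous_prod_factor v')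
      (by rw [hlog]; exact integratingMap_logForm _ _)
    obtain ⟨s, e, hs, he, hF, hl⟩ := exists_perm_of_logForm_eq hd (isHomogeneous_factor v)
      (isHomogeneous_factor v') (fun i h => hv' i (Subtype.ext h)) hlog hv₃ hv₂ hc
    exact ⟨⟨s, hs⟩, e, he, hF, hl⟩
  have hne : ∀ i, v.2 i ≠ 0 := fun i h => ne_zero_of_dvd_ne_zero hv₂.ne_zero
    (Finset.dvd_prod_of_mem (fun i => (v.2 i : Poly n)) (Finset.mem_univ i)) (congrArg Subtype.val h)
  -- if `μ v = 0`, then `μ v = μ (0, F)`, so that the residues vanish, which are distinct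
  have hnot : ∀ l : Residues d, ¬ (l.1 = 0 ∧ mu n d v = mu n d (l, v.2)) := by
    rintro l ⟨hl0, h⟩
    obtain ⟨s, e, -, -, hl⟩ := main (l, v.2) hne h
    have : (⟨0, by omega⟩ : Fin m) = ⟨1, by omega⟩ := hv₃ (by
      rw [hl, hl]
      change _ * l.1 _ = _ * l.1 _
      simp [hl0])
    simp [Fin.ext_iff] at this
  have hmu0 : mu n d (0, v.2) = 0 := by
    have := mu_smul n d v 0 fun _ => 1
    simpa using this
  refine ⟨⟨⟨fun h => ?_, hne⟩, fun h => ?_⟩, main⟩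
  · exact hnot v.1 ⟨congrArg Subtype.val h, rfl⟩
  · exact hnot 0 ⟨rfl, h.trans hmu0.symm⟩

end Generic

/-! ### Open sets of cones -/

section Cone

variable {W X : Type*} [AddCommGroup W] [Module ℂ W]

theorem zariski_isOpen_iff {U : Set W} :
    @IsOpen W (zariski W) U ↔ ∀ v ∈ U, ∃ p ∈ polyFun W, p v ≠ 0 ∧ ∀ w, p w ≠ 0 → w ∈ U := by
  constructor
  · intro hU
    induction hU with
    | basic s hs =>
      obtain ⟨p, hp, rfl⟩ := hs
      exact fun v hv => ⟨p, hp, hv, fun w hw => hw⟩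
    | univ => exact fun v _ => ⟨1, Subalgebra.one_mem _, one_ne_zero, fun w _ => trivial⟩
    | inter s t _ _ hs ht =>
      intro v hv
      obtain ⟨p, hp, hpv, hps⟩ := hs v hv.1
      obtain ⟨q, hq, hqv, hqt⟩ := ht v hv.2
      exact ⟨p * q, Subalgebra.mul_mem _ hp hq, mul_ne_zero hpv hqv, fun w hw =>
        ⟨hps w (left_ne_zero_of_mul hw), hqt w (right_ne_zero_of_mul hw)⟩⟩
    | sUnion S _ hS =>
      rintro v ⟨s, hs, hv⟩
      obtain ⟨p, hp, hpv, hps⟩ := hS s hs v hv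
      exact ⟨p, hp, hpv, fun w hw => ⟨s, hs, hps w hw⟩⟩
  · intro h
    have : U = ⋃₀ {V | V ⊆ U ∧ ∃ p ∈ polyFun W, V = {w | p w ≠ 0}} := by
      ext v
      constructor
      · intro hv
        obtain ⟨p, hp, hpv, hpU⟩ := h v hv
        exact ⟨_, ⟨fun w hw => hpU w hw, p, hp, rfl⟩, hpv⟩
      · rintro ⟨V, ⟨hV, -⟩, hv⟩
        exact hV hv
    rw [this]
    exact TopologicalSpace.GenerateOpen.sUnion _ fun V hV => .basic _ hV.2

theorem cone_isOpen_iff {C : Set W} (π : C → X) {U : Set X} :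
    @IsOpen X (coneStructure π).toTopologicalSpace U ↔ ∀ v : C, π v ∈ U →
      ∃ p ∈ polyFun W, p v.1 ≠ 0 ∧ ∀ w : C, p w.1 ≠ 0 → π w ∈ U := by
  change @IsOpen C (TopologicalSpace.induced Subtype.val (zariski W)) (π ⁻¹' U) ↔ _
  let : TopologicalSpace W := zariski W
  rw [isOpen_induced_iff]
  constructor
  · rintro ⟨O, hO, hOU⟩ v hv
    have hvO : v.1 ∈ O := by
      have : v ∈ π ⁻¹' U := hv
      rwa [← hOU] at this
    obtain ⟨p, hp, hpv, hpO⟩ := zariski_isOpen_iff.1 hO v hvO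
    refine ⟨p, hp, hpv, fun w hw => ?_⟩
    have : w ∈ Subtype.val ⁻¹' O := hpO w hw
    rwa [hOU] at this
  · intro h
    refine ⟨⋃₀ {V | Subtype.val ⁻¹' V ⊆ π ⁻¹' U ∧ ∃ p ∈ polyFun W, V = {w | p w ≠ 0}},
      TopologicalSpace.GenerateOpen.sUnion _ fun V hV => .basic _ hV.2, ?_⟩
    ext v
    constructor
    · rintro ⟨V, ⟨hV, -⟩, hv⟩
      exact hV hv
    · intro hv
      obtain ⟨p, hp, hpv, hpU⟩ := h v hv
      exact ⟨{w | p w ≠ 0}, ⟨fun w hw => hpU w hw, p, hp, rfl⟩, hpv⟩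

theorem projSpace_isOpen_iff {U : Set (ProjSpace W)} :
    IsOpen U ↔ ∀ v : {v : W // v ≠ 0}, ProjSpace.proj W v ∈ U →
      ∃ p ∈ polyFun W, p v.1 ≠ 0 ∧ ∀ w : {v : W // v ≠ 0}, p w.1 ≠ 0 → ProjSpace.proj W w ∈ U :=
  cone_isOpen_iff (C := {v : W | v ≠ 0}) (ProjSpace.proj W)

theorem projSpace_proj_eq_iff {v w : {v : W // v ≠ 0}} :
    ProjSpace.proj W v = ProjSpace.proj W w ↔ ∃ c : ℂ, c ≠ 0 ∧ v.1 = c • w.1 := by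
  constructor
  · intro h
    obtain ⟨c, hc⟩ := (Projectivization.mk_eq_mk_iff ℂ _ _ v.2 w.2).1 h
    exact ⟨c, c.ne_zero, hc.symm⟩
  · rintro ⟨c, hc, h⟩
    exact (Projectivization.mk_eq_mk_iff' ℂ _ _ v.2 w.2).2 ⟨c, h.symm⟩

theorem projSpace_proj_surjective (y : ProjSpace W) : ∃ v, ProjSpace.proj W v = y :=
  ⟨⟨Projectivization.rep y, Projectivization.rep_nonzero y⟩, Projectivization.mk_rep y⟩

/-- The points of projective space with a representative at which `p` does not vanish. -/
def nonvanishing (p : W → ℂ) : Set (ProjSpace W) :=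
  {y | ∃ v, ProjSpace.proj W v = y ∧ p v.1 ≠ 0}

theorem isOpen_nonvanishing {p : W → ℂ} (hp : p ∈ polyFun W) : IsOpen (nonvanishing p) := by
  rw [projSpace_isOpen_iff]
  rintro v ⟨w, hwv, hw⟩
  obtain ⟨c, hc, h⟩ := projSpace_proj_eq_iff.1 hwv
  refine ⟨fun u => p (c • u), ?_, by simpa only [← h] using hw, fun u hu => ?_⟩
  · exact polyFun_comp_mem (fun φ => dual_mem_polyFun (φ ∘ₗ LinearMap.lsmul ℂ W c)) hp
  · exact ⟨⟨c • u.1, smul_ne_zero hc u.2⟩, projSpace_proj_eq_iff.2 ⟨c, hc, rfl⟩, hu⟩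

end Cone

/-! ### The parameter space and its permutations -/

section Param

variable {n m : ℕ} {d : Fin m → ℕ}

theorem paramSpace_isOpen_iff {U : Set (ParamSpace n d)} :
    IsOpen U ↔ ∀ v : ParamCone n d, ParamSpace.proj n d v ∈ U →
      ∃ p ∈ polyFun (ParamVec n d), p v.1 ≠ 0 ∧
        ∀ w : ParamCone n d, p w.1 ≠ 0 → ParamSpace.proj n d w ∈ U :=
  cone_isOpen_iff (ParamSpace.proj n d)

theorem paramSpace_proj_surjective (x : ParamSpace n d) : ∃ v, ParamSpace.proj n d v = x :=
  ⟨⟨x.rep, x.1.rep_nonzero, fun i => (x.2 i).rep_nonzero⟩,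
    Prod.ext x.1.mk_rep (funext fun i => (x.2 i).mk_rep)⟩

/-- The result of scaling the entries of `(λ, F)`. -/
def scaleVec (c : ℂ) (a : Fin m → ℂ) (v : ParamVec n d) : ParamVec n d :=
  (c • v.1, fun i => a i • v.2 i)

theorem scaleVec_mem {c : ℂ} {a : Fin m → ℂ} (hc : c ≠ 0) (ha : ∀ i, a i ≠ 0) {v : ParamVec n d}
    (hv : v ∈ ParamCone n d) : scaleVec c a v ∈ ParamCone n d :=
  ⟨smul_ne_zero hc hv.1, fun i => smul_ne_zero (ha i) (hv.2 i)⟩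

theorem proj_eq_iff {v w : ParamCone n d} :
    ParamSpace.proj n d v = ParamSpace.proj n d w ↔
      ∃ (c : ℂ) (a : Fin m → ℂ), c ≠ 0 ∧ (∀ i, a i ≠ 0) ∧ v.1 = scaleVec c a w.1 := by
  constructor
  · intro h
    obtain ⟨c, hc⟩ := (Projectivization.mk_eq_mk_iff ℂ _ _ v.2.1 w.2.1).1 (congrArg Prod.fst h)
    choose a ha using fun i => (Projectivization.mk_eq_mk_iff ℂ _ _ (v.2.2 i) (w.2.2 i)).1
      (congrFun (congrArg Prod.snd h) i)
    exact ⟨c, fun i => a i, c.ne_zero, fun i => (a i).ne_zero,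
      Prod.ext hc.symm (funext fun i => (ha i).symm)⟩
  · rintro ⟨c, a, hc, ha, h⟩
    refine Prod.ext ?_ (funext fun i => ?_)
    · exact (Projectivization.mk_eq_mk_iff' ℂ _ _ v.2.1 w.2.1).2 ⟨c, (congrArg Prod.fst h).symm⟩
    · exact (Projectivization.mk_eq_mk_iff' ℂ _ _ (v.2.2 i) (w.2.2 i)).2
        ⟨a i, (congrFun (congrArg Prod.snd h) i).symm⟩

theorem mu_scaleVec (c : ℂ) (a : Fin m → ℂ) (v : ParamVec n d) :
    mu n d (scaleVec c a v) = (c * ∏ i, a i) • mu n d v := mu_smul n d v c a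

/-- The action of a permutation on the vectors `(λ, F)`. -/
def permVec (s : degreePerm d) : ParamVec n d →ₗ[ℂ] ParamVec n d where
  toFun v := (permResidues s v.1, fun i => castHom n (degreePerm_inv s i) (v.2 (s.1⁻¹ i)))
  map_add' _ _ := rfl
  map_smul' _ _ := rfl

theorem permVec_residue (s : degreePerm d) (v : ParamVec n d) (i : Fin m) :
    (permVec s v).1.1 i = v.1.1 (s.1⁻¹ i) := rfl

theorem permVec_factor (s : degreePerm d) (v : ParamVec n d) (i : Fin m) :
    ((permVec s v).2 i : Poly n) = v.2 (s.1⁻¹ i) := rfl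

theorem paramVec_ext {v w : ParamVec n d} (h1 : ∀ i, v.1.1 i = w.1.1 i)
    (h2 : ∀ i, (v.2 i : Poly n) = w.2 i) : v = w :=
  Prod.ext (Subtype.ext (funext h1)) (funext fun i => Subtype.ext (h2 i))

theorem permVec_mul (s t : degreePerm d) (v : ParamVec n d) :
    permVec (s * t) v = permVec s (permVec t v) := rfl

theorem permVec_one (v : ParamVec n d) : permVec 1 v = v := rfl

theorem permVec_mem (s : degreePerm d) {v : ParamVec n d} (hv : v ∈ ParamCone n d) :
    permVec s v ∈ ParamCone n d := by
  refine ⟨fun h => hv.1 (permResidues_injective s (h.trans (map_zero _).symm)), fun i h => ?_⟩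
  exact hv.2 _ (castHom_injective n _ (h.trans (map_zero _).symm))

theorem proj_permVec (s : degreePerm d) (v : ParamCone n d) :
    ParamSpace.proj n d ⟨permVec s v.1, permVec_mem s v.2⟩ = s • ParamSpace.proj n d v := rfl

theorem mu_permVec (s : degreePerm d) (v : ParamVec n d) : mu n d (permVec s v) = mu n d v := by
  refine Subtype.ext (funext fun j => ?_)
  change ∑ i, v.1.1 (s.1⁻¹ i) • ((∏ k ∈ Finset.univ.erase i, (v.2 (s.1⁻¹ k) : Poly n)) *
    MvPolynomial.pderiv j (v.2 (s.1⁻¹ i) : Poly n)) =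
    ∑ i, v.1.1 i • ((∏ k ∈ Finset.univ.erase i, (v.2 k : Poly n)) *
      MvPolynomial.pderiv j (v.2 i : Poly n))
  rw [← Equiv.sum_comp s.1⁻¹ fun i => v.1.1 i • ((∏ k ∈ Finset.univ.erase i, (v.2 k : Poly n)) *
      MvPolynomial.pderiv j (v.2 i : Poly n))]
  refine Finset.sum_congr rfl fun i _ => ?_
  congr 2
  refine Finset.prod_nbij' (fun k => s.1⁻¹ k) (fun k => s.1 k) ?_ ?_ ?_ ?_ ?_ <;> simp
  intro a h h'
  exact h (by rw [← h']; simp)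

instance : ContinuousConstSMul (degreePerm d) (ParamSpace n d) where
  continuous_const_smul s := by
    refine ⟨fun U hU => ?_⟩
    rw [paramSpace_isOpen_iff] at hU ⊢
    intro v hv
    obtain ⟨p, hp, hpv, hpU⟩ := hU ⟨permVec s v.1, permVec_mem s v.2⟩ hv
    refine ⟨fun w => p (permVec s w), polyFun_comp_mem
      (fun φ => dual_mem_polyFun (φ ∘ₗ permVec s)) hp, hpv, fun w hw => ?_⟩
    exact hpU ⟨permVec s w.1, permVec_mem s w.2⟩ hw

end Param

/-! ### The Segre algebra and its invariants -/

section Segre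

variable {n m : ℕ} {d : Fin m → ℕ}

/-- The function `(λ, F) ↦ φ(λ) ∏ ψᵢ(Fᵢ)`. -/
def segreFun (φ : Module.Dual ℂ (Residues d)) (ψ : ∀ i, Module.Dual ℂ (HomPoly n (d i)))
    (w : ParamVec n d) : ℂ := φ w.1 * ∏ i, ψ i (w.2 i)

variable (n d) in
/-- The algebra generated by the functions that are linear in `λ` and in every `Fᵢ`, which is the
homogeneous coordinate ring of the Segre embedding of the parameter space. -/
def segreAlg : Subalgebra ℂ (ParamVec n d → ℂ) :=
  Algebra.adjoin ℂ (Set.range fun x : Module.Dual ℂ (Residues d) ×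
    (∀ i, Module.Dual ℂ (HomPoly n (d i))) => segreFun x.1 x.2)

theorem segreFun_mem (φ : Module.Dual ℂ (Residues d)) (ψ : ∀ i, Module.Dual ℂ (HomPoly n (d i))) :
    segreFun φ ψ ∈ segreAlg n d := Algebra.subset_adjoin ⟨(φ, ψ), rfl⟩

theorem segreAlg_le : segreAlg n d ≤ polyFun (ParamVec n d) := by
  refine Algebra.adjoin_le ?_
  rintro _ ⟨⟨φ, ψ⟩, rfl⟩
  have h : (fun w : ParamVec n d => φ w.1) * ∏ i, (fun w : ParamVec n d => ψ i (w.2 i)) ∈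
      polyFun (ParamVec n d) :=
    Subalgebra.mul_mem _ (dual_mem_polyFun (W := ParamVec n d) (φ ∘ₗ LinearMap.fst ℂ _ _))
      (Subalgebra.prod_mem _ fun i _ =>
        dual_mem_polyFun (W := ParamVec n d) (ψ i ∘ₗ
          LinearMap.proj (φ := fun i => HomPoly n (d i)) i ∘ₗ LinearMap.snd ℂ _ _))
  have e : segreFun φ ψ = (fun w : ParamVec n d => φ w.1) *
      ∏ i, (fun w : ParamVec n d => ψ i (w.2 i)) := by
    ext w
    simp [segreFun]
  change segreFun φ ψ ∈ _
  rw [e]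
  exact h

theorem segreAlg_scaleVec {f : ParamVec n d → ℂ} (hf : f ∈ segreAlg n d) {c : ℂ} {a : Fin m → ℂ}
    (h : c * ∏ i, a i = 1) (w : ParamVec n d) : f (scaleVec c a w) = f w := by
  induction hf using Algebra.adjoin_induction with
  | mem f hf =>
    obtain ⟨⟨φ, ψ⟩, rfl⟩ := hf
    simp only [segreFun, scaleVec, map_smul, smul_eq_mul, Finset.prod_mul_distrib]
    rw [mul_mul_mul_comm, h, one_mul]
  | algebraMap r => rfl
  | add f g _ _ hf hg => simp only [Pi.add_apply, hf, hg]
  | mul f g _ _ hf hg => simp only [Pi.mul_apply, hf, hg]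

instance instFiniteTypeSegreAlg : Algebra.FiniteType ℂ (segreAlg n d) := by
  rw [← Subalgebra.fg_iff_finiteType]
  let e := Module.finBasis ℂ (Module.Dual ℂ (Residues d))
  let g := fun i => Module.finBasis ℂ (Module.Dual ℂ (HomPoly n (d i)))
  let T : Set (ParamVec n d → ℂ) := Set.range fun x : Fin _ × (∀ i, Fin _) =>
    segreFun (e x.1) fun i => g i (x.2 i)
  refine Subalgebra.fg_def.2 ⟨T, Set.finite_range _, le_antisymm (Algebra.adjoin_le ?_)
    (Algebra.adjoin_le ?_)⟩
  · rintro _ ⟨x, rfl⟩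
    exact segreFun_mem _ _
  · rintro _ ⟨⟨φ, ψ⟩, rfl⟩
    have : segreFun φ ψ = ∑ j, ∑ p : ∀ i, Fin _, (e.repr φ j * ∏ i, (g i).repr (ψ i) (p i)) •
        segreFun (e j) (fun i => g i (p i)) := by
      ext w
      have h1 : φ w.1 = ∑ j, e.repr φ j * e j w.1 := by
        have := congrArg (fun φ => φ w.1) (e.sum_repr φ)
        simpa only [LinearMap.sum_apply, LinearMap.smul_apply, smul_eq_mul] using this.symm
      have h2 : ∀ i, ψ i (w.2 i) = ∑ j, (g i).repr (ψ i) j * g i j (w.2 i) := fun i => by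
        have := congrArg (fun φ => φ (w.2 i)) ((g i).sum_repr (ψ i))
        simpa only [LinearMap.sum_apply, LinearMap.smul_apply, smul_eq_mul] using this.symm
      simp only [segreFun, h1, h2]
      rw [Finset.prod_univ_sum, Finset.sum_mul_sum, Fintype.piFinset_univ]
      simp only [Finset.sum_apply, Pi.smul_apply, smul_eq_mul, Finset.prod_mul_distrib, segreFun]
      exact Finset.sum_congr rfl fun j _ => Finset.sum_congr rfl fun p _ => by ring
    change segreFun φ ψ ∈ _
    rw [this]
    refine Subalgebra.sum_mem _ fun j _ => Subalgebra.sum_mem _ fun p _ =>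
      Subalgebra.smul_mem _ (Algebra.subset_adjoin ?_) _
    exact ⟨(j, p), rfl⟩

theorem segreAlg_permVec (s : degreePerm d) {f : ParamVec n d → ℂ} (hf : f ∈ segreAlg n d) :
    (fun w => f (permVec s w)) ∈ segreAlg n d := by
  induction hf using Algebra.adjoin_induction with
  | mem f hf =>
    obtain ⟨⟨φ, ψ⟩, rfl⟩ := hf
    have h : (fun w => segreFun φ ψ (permVec s w)) = segreFun (φ ∘ₗ permResidues s)
        (fun i => ψ (s.1 i) ∘ₗ castHom n (s.2 i).symm) := by
      ext w
      simp only [segreFun]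
      rw [← Equiv.prod_comp s.1]
      congr 1
      refine Finset.prod_congr rfl fun i _ => congrArg (ψ (s.1 i)) (Subtype.ext ?_)
      change (w.2 (s.1⁻¹ (s.1 i)) : Poly n) = w.2 i
      exact congrArg (fun k => (w.2 k : Poly n)) (by simp)
    change (fun w => segreFun φ ψ (permVec s w)) ∈ _
    rw [h]
    exact segreFun_mem _ _
  | algebraMap r => exact Subalgebra.algebraMap_mem _ r
  | add f g _ _ hf hg => exact Subalgebra.add_mem _ hf hg
  | mul f g _ _ hf hg => exact Subalgebra.mul_mem _ hf hg

/-- The automorphism of the Segre algebra induced by a permutation. -/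
def permSegre (s : degreePerm d) : segreAlg n d →ₐ[ℂ] segreAlg n d where
  toFun f := ⟨fun w => f.1 (permVec s w), segreAlg_permVec s f.2⟩
  map_one' := rfl
  map_mul' _ _ := rfl
  map_zero' := rfl
  map_add' _ _ := rfl
  commutes' _ := rfl

variable (n d) in
/-- The elements of the Segre algebra that are invariant under permutations. -/
def invariantAlg : Subalgebra ℂ (ParamVec n d → ℂ) where
  carrier := {f | f ∈ segreAlg n d ∧ ∀ (s : degreePerm d) w, f (permVec s w) = f w}
  mul_mem' hf hg := ⟨Subalgebra.mul_mem _ hf.1 hg.1, fun s w => by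
    simp only [Pi.mul_apply, hf.2, hg.2]⟩
  add_mem' hf hg := ⟨Subalgebra.add_mem _ hf.1 hg.1, fun s w => by
    simp only [Pi.add_apply, hf.2, hg.2]⟩
  algebraMap_mem' r := ⟨Subalgebra.algebraMap_mem _ r, fun _ _ => rfl⟩

theorem fg_invariantAlg : (invariantAlg n d).FG := by
  let _ : MulSemiringAction (degreePerm d) (segreAlg n d) :=
    { smul := fun s f => permSegre s⁻¹ f
      one_smul := fun f => Subtype.ext (funext fun w => rfl)
      mul_smul := fun s t f => Subtype.ext (funext fun w => congrArg f.1 (by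
        rw [mul_inv_rev, permVec_mul]))
      smul_zero := fun _ => rfl
      smul_add := fun _ _ _ => rfl
      smul_one := fun _ => rfl
      smul_mul := fun _ _ _ => rfl }
  have : SMulCommClass (degreePerm d) ℂ (segreAlg n d) := ⟨fun _ _ _ => rfl⟩
  have h := finiteType_invariants (R := segreAlg n d) (G := degreePerm d)
  rw [← Subalgebra.fg_iff_finiteType] at h
  have h2 : invariantAlg n d =
      (FixedPoints.subalgebra ℂ (segreAlg n d) (degreePerm d)).map (segreAlg n d).val := by
    ext f
    constructor
    · rintro ⟨hf, hinv⟩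
      exact ⟨⟨f, hf⟩, fun s => Subtype.ext (funext fun w => hinv s⁻¹ w), rfl⟩
    · rintro ⟨f, hf, rfl⟩
      refine ⟨f.2, fun s w => ?_⟩
      have := congrFun (congrArg Subtype.val (hf s⁻¹)) w
      change f.1 (permVec s⁻¹⁻¹ w) = f.1 w at this
      rwa [inv_inv] at this
  rw [h2]
  exact h.map _

theorem segreFun_ne_zero_iff {κ₀ : Module.Dual ℂ (Residues d)}
    {κ : ∀ i, Module.Dual ℂ (HomPoly n (d i))} {w : ParamVec n d} :
    segreFun κ₀ κ w ≠ 0 ↔ κ₀ w.1 ≠ 0 ∧ ∀ i, κ i (w.2 i) ≠ 0 := by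
  simp [segreFun, Finset.prod_eq_zero_iff]

/-- In coordinates that are normalised by linear functionals, a polynomial function becomes an
element of the Segre algebra, up to a power of the denominator. -/
theorem exists_eq_pow_mul (κ₀ : Module.Dual ℂ (Residues d))
    (κ : ∀ i, Module.Dual ℂ (HomPoly n (d i))) {p : ParamVec n d → ℂ}
    (hp : p ∈ polyFun (ParamVec n d)) : ∃ N : ℕ, ∃ q ∈ segreAlg n d, ∀ w, segreFun κ₀ κ w ≠ 0 →
      q w = segreFun κ₀ κ w ^ N * p (scaleVec (κ₀ w.1)⁻¹ (fun i => (κ i (w.2 i))⁻¹) w) := by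
  have hz : ∀ w, segreFun κ₀ κ w ≠ 0 → κ₀ w.1 ≠ 0 ∧ ∀ i, κ i (w.2 i) ≠ 0 := fun w hw =>
    segreFun_ne_zero_iff.1 hw
  induction hp using Algebra.adjoin_induction with
  | mem p hp =>
    obtain ⟨Φ, rfl⟩ := hp
    let Φ₀ : Module.Dual ℂ (Residues d) := Φ ∘ₗ LinearMap.inl ℂ _ _
    let Φ' : ∀ i, Module.Dual ℂ (HomPoly n (d i)) := fun i =>
      Φ ∘ₗ LinearMap.inr ℂ _ _ ∘ₗ LinearMap.single ℂ (fun i => HomPoly n (d i)) i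
    refine ⟨1, segreFun Φ₀ κ + ∑ i, segreFun κ₀ (Function.update κ i (Φ' i)),
      Subalgebra.add_mem _ (segreFun_mem _ _) (Subalgebra.sum_mem _ fun i _ => segreFun_mem _ _),
      fun w hw => ?_⟩
    have hsplit : ∀ u : ParamVec n d, Φ u = Φ₀ u.1 + ∑ i, Φ' i (u.2 i) := fun u => by
      have h1 : u = LinearMap.inl ℂ _ _ u.1 + LinearMap.inr ℂ _ _ u.2 := by simp
      have h2 : u.2 = ∑ i, LinearMap.single ℂ (fun i => HomPoly n (d i)) i (u.2 i) :=
        (Finset.univ_sum_single u.2).symm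
      conv_lhs => rw [h1, h2]
      simp only [map_add, map_sum]
      rfl
    have hup : ∀ i, ∏ k, Function.update κ i (Φ' i) k (w.2 k) =
        Φ' i (w.2 i) * ∏ k ∈ Finset.univ.erase i, κ k (w.2 k) := fun i => by
      rw [← Finset.mul_prod_erase _ _ (Finset.mem_univ i), Function.update_self]
      congr 1
      refine Finset.prod_congr rfl fun k hk => ?_
      rw [Function.update_of_ne (Finset.ne_of_mem_erase hk)]
    change _ = segreFun κ₀ κ w ^ 1 * Φ (scaleVec (κ₀ w.1)⁻¹ (fun i => (κ i (w.2 i))⁻¹) w)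
    rw [hsplit]
    simp only [Pi.add_apply, Finset.sum_apply, segreFun, hup, pow_one, scaleVec, map_smul,
      smul_eq_mul, mul_add, Finset.mul_sum]
    obtain ⟨hw0, hwi⟩ := hz w hw
    refine congrArg₂ _ ?_ (Finset.sum_congr rfl fun i _ => ?_)
    · field_simp
    · rw [← Finset.mul_prod_erase _ (fun k => κ k (w.2 k)) (Finset.mem_univ i)]
      have := hwi i
      field_simp
  | algebraMap c => exact ⟨0, _, Subalgebra.algebraMap_mem _ c, fun w _ => by simp⟩
  | add p q _ _ hp hq =>
    obtain ⟨N, f, hf, hfw⟩ := hp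
    obtain ⟨M, g, hg, hgw⟩ := hq
    refine ⟨N + M, segreFun κ₀ κ ^ M * f + segreFun κ₀ κ ^ N * g,
      Subalgebra.add_mem _ (Subalgebra.mul_mem _ (Subalgebra.pow_mem _ (segreFun_mem _ _) _) hf)
        (Subalgebra.mul_mem _ (Subalgebra.pow_mem _ (segreFun_mem _ _) _) hg), fun w hw => ?_⟩
    simp only [Pi.add_apply, Pi.mul_apply, Pi.pow_apply, hfw w hw, hgw w hw]
    ring
  | mul p q _ _ hp hq =>
    obtain ⟨N, f, hf, hfw⟩ := hp
    obtain ⟨M, g, hg, hgw⟩ := hq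
    refine ⟨N + M, f * g, Subalgebra.mul_mem _ hf hg, fun w hw => ?_⟩
    simp only [Pi.mul_apply, hfw w hw, hgw w hw]
    ring

theorem exists_dual_eq_one {E : Type*} [AddCommGroup E] [Module ℂ E] {x : E} (hx : x ≠ 0) :
    ∃ φ : Module.Dual ℂ E, φ x = 1 := by
  obtain ⟨φ, hφ⟩ := Module.Projective.exists_dual_ne_zero ℂ hx
  exact ⟨(φ x)⁻¹ • φ, by simp [inv_mul_cancel₀ hφ]⟩

/-- Near a point of the cone the coordinates can be normalised, by a map `r` with denominator `z`,
such that polynomial functions become elements of the Segre algebra up to a power of `z`. -/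
theorem exists_normalisation {v : ParamVec n d} (hv : v ∈ ParamCone n d) :
    ∃ z ∈ segreAlg n d, ∃ r : ParamVec n d → ParamVec n d, z v = 1 ∧ r v = v ∧
      (∀ w, z w ≠ 0 → ∃ (c : ℂ) (a : Fin m → ℂ), c ≠ 0 ∧ (∀ i, a i ≠ 0) ∧
        r w = scaleVec c a w) ∧
      ∀ p ∈ polyFun (ParamVec n d), ∃ N : ℕ, ∃ q ∈ segreAlg n d,
        ∀ w, z w ≠ 0 → q w = z w ^ N * p (r w) := by
  obtain ⟨κ₀, h₀⟩ := exists_dual_eq_one hv.1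
  choose κ hκ using fun i => exists_dual_eq_one (hv.2 i)
  refine ⟨segreFun κ₀ κ, segreFun_mem _ _,
    fun w => scaleVec (κ₀ w.1)⁻¹ (fun i => (κ i (w.2 i))⁻¹) w, by simp [segreFun, h₀, hκ],
    by simp [scaleVec, h₀, hκ], fun w hw => ?_, fun p hp => exists_eq_pow_mul κ₀ κ hp⟩
  obtain ⟨hw0, hwi⟩ := segreFun_ne_zero_iff.1 hw
  exact ⟨_, _, inv_ne_zero hw0, fun i => inv_ne_zero (hwi i), rfl⟩

/-- An ideal of the Segre algebra that is stable under permutations and does not vanish at a point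
contains an invariant with value `1` at this point. -/
theorem exists_invariant_mem (I : Ideal (segreAlg n d))
    (hI : ∀ (s : degreePerm d), ∀ q ∈ I, permSegre s q ∈ I) {v : ParamVec n d} {q : segreAlg n d}
    (hq : q ∈ I) (hqv : q.1 v ≠ 0) : ∃ Q ∈ I, Q.1 ∈ invariantAlg n d ∧ Q.1 v = 1 := by
  classical
  let g : degreePerm d → segreAlg n d := fun s => 1 - (q.1 v)⁻¹ • permSegre s q
  have hg : ∀ s w, (g s).1 w = 1 - (q.1 v)⁻¹ * q.1 (permVec s w) := fun s w => rfl
  have hval : ∀ w, (1 - ∏ s, g s).1 w = 1 - ∏ s, (g s).1 w := fun w => by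
    have : ((∏ s, g s : segreAlg n d) : ParamVec n d → ℂ) = ∏ s, (g s).1 := by simp
    change 1 - (∏ s, g s : segreAlg n d).1 w = _
    rw [this, Finset.prod_apply]
  refine ⟨1 - ∏ s, g s, ?_, ⟨Subtype.property _, fun t w => ?_⟩, ?_⟩
  · rw [← Ideal.Quotient.eq_zero_iff_mem, map_sub, map_prod, map_one, sub_eq_zero, eq_comm]
    refine Finset.prod_eq_one fun s _ => ?_
    rw [map_sub, map_one, sub_eq_self, Ideal.Quotient.eq_zero_iff_mem]
    exact Submodule.smul_of_tower_mem I _ (hI s q hq)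
  · rw [hval, hval]
    congr 1
    refine Fintype.prod_equiv (Equiv.mulRight t) _ _ fun s => ?_
    rw [hg, hg, Equiv.coe_mulRight, permVec_mul]
  · rw [hval, Finset.prod_eq_zero (Finset.mem_univ 1), sub_zero]
    rw [hg, permVec_one, inv_mul_cancel₀ hqv, sub_self]

end Segre

/-! ### Descent to the image of the parametrization -/

section Descent

variable {n m : ℕ} {d : Fin m → ℕ}

variable (n d) in
/-- The pull-back of polynomial functions under `μ`. -/
def muPull : polyFun (ProjForm n (∑ i, d i)) →ₐ[ℂ] polyFun (ParamVec n d) where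
  toFun p := ⟨fun w => p.1 (mu n d w), comp_mu_mem p.2⟩
  map_one' := rfl
  map_mul' _ _ := rfl
  map_zero' := rfl
  map_add' _ _ := rfl
  commutes' _ := rfl

/-- A point at which all polynomials vanish that vanish on the image of `μ` defines a character of
the coordinate ring of this image. -/
theorem exists_character {y : ProjForm n (∑ i, d i)}
    (hy : ∀ p ∈ polyFun (ProjForm n (∑ i, d i)), (∀ w, p (mu n d w) = 0) → p y = 0) :
    ∃ φ : (muPull n d).range →ₐ[ℂ] ℂ, ∀ p, φ ((muPull n d).rangeRestrict p) = p.1 y := by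
  have hker : ∀ p, (muPull n d).rangeRestrict p = 0 → evalAt y p = 0 := fun p hp =>
    hy p.1 p.2 fun w => congrFun (congrArg (fun q => q.1.1) hp) w
  let e := Ideal.quotientKerAlgEquivOfSurjective (muPull n d).rangeRestrict_surjective
  refine ⟨(Ideal.Quotient.liftₐ (RingHom.ker (muPull n d).rangeRestrict) (evalAt y) hker).comp
    e.symm.toAlgHom, fun p => ?_⟩
  have : e.symm ((muPull n d).rangeRestrict p) = Ideal.Quotient.mkₐ ℂ _ p := by
    rw [AlgEquiv.symm_apply_eq]
    rfl
  change Ideal.Quotient.liftₐ _ _ hker (e.symm ((muPull n d).rangeRestrict p)) = _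
  rw [this]
  rfl

/-- The image under `μ` of a dense open set contains a dense open set of the closure of the image of
`μ`, here cut out by the polynomials that vanish on this image. -/
theorem exists_forall_mem_image_mu {b : ParamVec n d → ℂ} (hb : b ∈ polyFun (ParamVec n d))
    (hb0 : ∃ v, b v ≠ 0) : ∃ a ∈ polyFun (ProjForm n (∑ i, d i)), (∃ w, a (mu n d w) ≠ 0) ∧
      ∀ y, (∀ p ∈ polyFun (ProjForm n (∑ i, d i)), (∀ w, p (mu n d w) = 0) → p y = 0) →
        a y ≠ 0 → ∃ w, b w ≠ 0 ∧ mu n d w = y := by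
  have : Algebra.FiniteType ℂ (muPull n d).range :=
    Algebra.FiniteType.of_surjective _ (muPull n d).rangeRestrict_surjective
  obtain ⟨⟨_, a, rfl⟩, ha0, ha⟩ := exists_ne_zero_forall_extends (muPull n d).range ⟨b, hb⟩
    (fun h => hb0.elim fun v hv => hv (congrFun (congrArg Subtype.val h) v))
  refine ⟨a.1, a.2, ?_, fun y hy hay => ?_⟩
  · by_contra! h
    exact ha0 (Subtype.ext (Subtype.ext (funext h)))
  · obtain ⟨φ, hφ⟩ := exists_character hy
    obtain ⟨x, hx, hxb⟩ := ha φ (by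
      have := hφ a
      rw [show (⟨_, a, rfl⟩ : (muPull n d).range) = (muPull n d).rangeRestrict a from rfl, this]
      exact hay)
    obtain ⟨w, rfl⟩ := exists_eq_evalAt x
    refine ⟨w, hxb, ?_⟩
    have hp : ∀ p : polyFun (ProjForm n (∑ i, d i)), p.1 (mu n d w) = p.1 y := fun p =>
      (hx ((muPull n d).rangeRestrict p)).trans (hφ p)
    rw [← sub_eq_zero]
    by_contra h
    obtain ⟨φ, hφ⟩ := Module.Projective.exists_dual_ne_zero ℂ h
    refine hφ ?_
    rw [map_sub, sub_eq_zero]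
    exact hp ⟨_, dual_mem_polyFun φ⟩

/-- The conclusion of generic injectivity, phrased by the two group actions. -/
theorem exists_eq_scaleVec {v v' : ParamVec n d} {s : degreePerm d} {e : Fin m → ℂ}
    (he : ∀ i, e i ≠ 0) (h1 : ∀ i, (v'.2 (s.1 i) : Poly n) = e i • (v.2 i : Poly n))
    (h2 : ∀ i, v.1.1 i = (∏ k, e k) * v'.1.1 (s.1 i)) :
    v' = permVec s (scaleVec (∏ k, e k)⁻¹ e v) := by
  have he' : ∏ k, e k ≠ 0 := Finset.prod_ne_zero_iff.2 fun i _ => he i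
  refine paramVec_ext (fun i => ?_) fun i => ?_
  · rw [permVec_residue]
    change _ = (∏ k, e k)⁻¹ * v.1.1 (s.1⁻¹ i)
    rw [h2, inv_mul_cancel_left₀ he']
    simp
  · rw [permVec_factor]
    change _ = e (s.1⁻¹ i) • (v.2 (s.1⁻¹ i) : Poly n)
    rw [← h1]
    exact congrArg (fun k => (v'.2 k : Poly n)) (by simp)

/-- The invariants of the Segre algebra descend to rational functions of `μ`, with a denominator of
which only the exponent depends on the invariant. -/
theorem exists_denominator {b : ParamVec n d → ℂ} (hb : b ∈ polyFun (ParamVec n d))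
    (hb0 : ∃ v, b v ≠ 0)
    (hbv : ∀ v v', b v ≠ 0 → b v' ≠ 0 → mu n d v = mu n d v' →
      ∃ (s : degreePerm d) (c : ℂ) (a : Fin m → ℂ), c * ∏ i, a i = 1 ∧
        v' = permVec s (scaleVec c a v)) :
    ∃ D ∈ polyFun (ProjForm n (∑ i, d i)), (∃ w, D (mu n d w) ≠ 0) ∧
      ∀ g ∈ invariantAlg n d, ∃ N : ℕ, ∃ P ∈ polyFun (ProjForm n (∑ i, d i)),
        ∀ w, g w * D (mu n d w) ^ N = P (mu n d w) := by
  classical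
  obtain ⟨T, hT⟩ := fg_invariantAlg (n := n) (d := d)
  have hTmem : ∀ g ∈ T, g ∈ invariantAlg n d := fun g hg => hT ▸ Algebra.subset_adjoin hg
  have key : ∀ g ∈ T, ∃ s ∈ polyFun (ProjForm n (∑ i, d i)), (∃ w, s (mu n d w) ≠ 0) ∧
      ∃ r ∈ polyFun (ProjForm n (∑ i, d i)), ∀ w, g w * s (mu n d w) = r (mu n d w) := by
    intro g hg
    obtain ⟨hg1, hg2⟩ := hTmem g hg
    obtain ⟨_, ⟨r, rfl⟩, _, ⟨s, rfl⟩, hs, hrs⟩ := exists_mul_eq_of_constant_on_fibres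
      (muPull n d).range ⟨g, segreAlg_le hg1⟩ ⟨b, hb⟩
      (fun h => hb0.elim fun v hv => hv (congrFun (congrArg Subtype.val h) v))
      (fun x x' hx hx' hxx => by
        obtain ⟨v, rfl⟩ := exists_eq_evalAt x
        obtain ⟨v', rfl⟩ := exists_eq_evalAt x'
        have hmu : mu n d v = mu n d v' := by
          rw [← sub_eq_zero]
          by_contra h
          obtain ⟨φ, hφ⟩ := Module.Projective.exists_dual_ne_zero ℂ h
          refine hφ ?_
          rw [map_sub, sub_eq_zero]
          exact hxx _ ⟨⟨_, dual_mem_polyFun φ⟩, rfl⟩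
        obtain ⟨t, c, a, hca, rfl⟩ := hbv v v' hx hx' hmu
        change g v = g _
        rw [hg2, segreAlg_scaleVec hg1 hca])
    refine ⟨s.1, s.2, ?_, r.1, r.2, fun w => congrFun (congrArg Subtype.val hrs) w⟩
    by_contra! h
    exact hs (Subtype.ext (funext h))
  choose! s hs hs0 r hr hrs using key
  let D : ProjForm n (∑ i, d i) → ℂ := ∏ g ∈ T, s g
  have hD : D ∈ polyFun (ProjForm n (∑ i, d i)) := Subalgebra.prod_mem _ hs
  refine ⟨D, hD, ?_, fun g hg => ?_⟩
  · have hnz : (∏ g ∈ T.attach, muPull n d ⟨s g.1, hs g.1 g.2⟩) ≠ 0 := by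
      refine Finset.prod_ne_zero_iff.2 fun g _ h => ?_
      obtain ⟨w, hw⟩ := hs0 g.1 g.2
      exact hw (congrFun (congrArg Subtype.val h) w)
    by_contra! h
    refine hnz (Subtype.ext (funext fun w => ?_))
    have hw := h w
    simp only [D, Finset.prod_apply] at hw
    rw [← Finset.prod_attach] at hw
    change (polyFun (ParamVec n d)).val _ w = 0
    rw [map_prod, Finset.prod_apply]
    exact hw
  · rw [← hT] at hg
    induction hg using Algebra.adjoin_induction with
    | mem g hg =>
      refine ⟨1, r g * ∏ k ∈ T.erase g, s k, Subalgebra.mul_mem _ (hr g hg)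
        (Subalgebra.prod_mem _ fun k hk => hs k (Finset.mem_of_mem_erase hk)), fun w => ?_⟩
      simp only [D, Finset.prod_apply, pow_one, Pi.mul_apply]
      rw [← Finset.mul_prod_erase T (fun k => s k (mu n d w)) hg, ← mul_assoc, hrs g hg]
    | algebraMap c => exact ⟨0, _, Subalgebra.algebraMap_mem _ c, fun w => by simp⟩
    | add f g _ _ hf hg =>
      obtain ⟨N, P, hP, hPw⟩ := hf
      obtain ⟨M, Q, hQ, hQw⟩ := hg
      refine ⟨N + M, D ^ M * P + D ^ N * Q,
        Subalgebra.add_mem _ (Subalgebra.mul_mem _ (Subalgebra.pow_mem _ hD _) hP)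
          (Subalgebra.mul_mem _ (Subalgebra.pow_mem _ hD _) hQ), fun w => ?_⟩
      simp only [Pi.add_apply, Pi.mul_apply, Pi.pow_apply, ← hPw, ← hQw]
      ring
    | mul f g _ _ hf hg =>
      obtain ⟨N, P, hP, hPw⟩ := hf
      obtain ⟨M, Q, hQ, hQw⟩ := hg
      refine ⟨N + M, P * Q, Subalgebra.mul_mem _ hP hQ, fun w => ?_⟩
      simp only [Pi.mul_apply, ← hPw, ← hQw]
      ring

end Descent

/-! ### Invariant functions on the parameter space -/

section Invariant

variable {n m : ℕ} {d : Fin m → ℕ}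

open scoped Classical in
/-- An invariant regular function on an open set is locally a quotient of two invariants of the
Segre algebra; the denominator can be taken to vanish at all points off the open set. -/
theorem exists_invariant_fraction {U : Set (ParamSpace n d)} (hU : IsOpen U)
    (hUs : ∀ (s : degreePerm d) x, x ∈ U → s • x ∈ U) {f : ParamSpace n d → ℂ}
    (hf : SpaceWithFunctions.RegularOn U f)
    (hfs : ∀ (s : degreePerm d), ∀ x ∈ U, f (s • x) = f x) (v : ParamCone n d)
    (hv : ParamSpace.proj n d v ∈ U) :
    ∃ P ∈ invariantAlg n d, ∃ Q ∈ invariantAlg n d, Q v.1 = 1 ∧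
      (∀ w : ParamCone n d, Q w.1 ≠ 0 → ParamSpace.proj n d w ∈ U) ∧
      ∀ w : ParamCone n d, ParamSpace.proj n d w ∈ U →
        f (ParamSpace.proj n d w) * Q w.1 = P w.1 := by
  have hUs' : ∀ (s : degreePerm d) x, s • x ∈ U → x ∈ U := fun s x h => by
    have := hUs s⁻¹ _ h
    rwa [inv_smul_smul] at this
  -- the denominators of `f` that vanish off `U`
  let I : Ideal (segreAlg n d) :=
    { carrier := {q | (∀ w : ParamCone n d, ParamSpace.proj n d w ∉ U → q.1 w.1 = 0) ∧
        ∃ p ∈ segreAlg n d, ∀ w : ParamCone n d, ParamSpace.proj n d w ∈ U →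
          f (ParamSpace.proj n d w) * q.1 w.1 = p w.1}
      zero_mem' := ⟨fun _ _ => rfl, 0, Subalgebra.zero_mem _, fun w _ => mul_zero _⟩
      add_mem' := by
        rintro q q' ⟨h1, p, hp, h2⟩ ⟨h1', p', hp', h2'⟩
        refine ⟨fun w hw => ?_, p + p', Subalgebra.add_mem _ hp hp', fun w hw => ?_⟩
        · change q.1 w.1 + q'.1 w.1 = 0
          rw [h1 w hw, h1' w hw, add_zero]
        · change _ * (q.1 w.1 + q'.1 w.1) = p w.1 + p' w.1
          rw [mul_add, h2 w hw, h2' w hw]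
      smul_mem' := by
        rintro g q ⟨h1, p, hp, h2⟩
        refine ⟨fun w hw => ?_, g.1 * p, Subalgebra.mul_mem _ g.2 hp, fun w hw => ?_⟩
        · change g.1 w.1 * q.1 w.1 = 0
          rw [h1 w hw, mul_zero]
        · change _ * (g.1 w.1 * q.1 w.1) = g.1 w.1 * p w.1
          rw [mul_left_comm, h2 w hw] }
  have hI : ∀ (s : degreePerm d), ∀ q ∈ I, permSegre s q ∈ I := by
    rintro s q ⟨h1, p, hp, h2⟩
    refine ⟨fun w hw => h1 ⟨_, permVec_mem s w.2⟩ fun h => hw (hUs' s _ h), _,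
      segreAlg_permVec s hp, fun w hw => ?_⟩
    have := h2 ⟨_, permVec_mem s w.2⟩ (hUs s _ hw)
    rw [proj_permVec, hfs s _ hw] at this
    exact this
  obtain ⟨z, hz, r, hzv, hrv, hr, hpoly⟩ := exists_normalisation v.2
  obtain ⟨u, hu, huv, huU⟩ := paramSpace_isOpen_iff.1 hU v hv
  obtain ⟨p, hp, q, hq, hqv, hpq⟩ := hf v hv
  have hrmem : ∀ w : ParamCone n d, z w.1 ≠ 0 → ∃ h : r w.1 ∈ ParamCone n d,
      ParamSpace.proj n d ⟨r w.1, h⟩ = ParamSpace.proj n d w := fun w hw => by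
    obtain ⟨c, a, hc, ha, h⟩ := hr w.1 hw
    have hm : r w.1 ∈ ParamCone n d := h ▸ scaleVec_mem hc ha w.2
    exact ⟨hm, proj_eq_iff.2 ⟨c, a, hc, ha, h⟩⟩
  obtain ⟨N₁, g₁, hg₁, hg₁w⟩ := hpoly _ (Subalgebra.mul_mem _ (Subalgebra.mul_mem _ hq hq) hu)
  obtain ⟨N₂, g₂, hg₂, hg₂w⟩ := hpoly _ (Subalgebra.mul_mem _ (Subalgebra.mul_mem _ hp hq) hu)
  have hmem : (⟨z ^ (N₂ + 1) * g₁, Subalgebra.mul_mem _ (Subalgebra.pow_mem _ hz _) hg₁⟩ :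
      segreAlg n d) ∈ I := by
    refine ⟨fun w hw => ?_, z ^ (N₁ + 1) * g₂,
      Subalgebra.mul_mem _ (Subalgebra.pow_mem _ hz _) hg₂, fun w hw => ?_⟩
    · by_cases h : z w.1 = 0
      · simp [h]
      · obtain ⟨hm, hpr⟩ := hrmem w h
        have : u (r w.1) = 0 := by
          by_contra h0
          exact hw (hpr ▸ huU ⟨_, hm⟩ h0)
        simp [hg₁w w.1 h, this]
    · by_cases h : z w.1 = 0
      · simp [h]
      · obtain ⟨hm, hpr⟩ := hrmem w h
        simp only [Pi.mul_apply, Pi.pow_apply, hg₁w w.1 h, hg₂w w.1 h]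
        by_cases h0 : q (r w.1) = 0
        · simp [h0]
        · have := hpq ⟨_, hm⟩ (hpr ▸ hw) h0
          rw [hpr] at this
          rw [this]
          field_simp
          ring
  obtain ⟨Q, hQ, hQi, hQv⟩ := exists_invariant_mem I hI (v := v.1) hmem (by
    have h0 : z v.1 ≠ 0 := by rw [hzv]; exact one_ne_zero
    simp only [Pi.mul_apply, Pi.pow_apply, hg₁w v.1 h0, hzv, hrv, one_pow, one_mul]
    exact mul_ne_zero (mul_ne_zero hqv hqv) huv)
  obtain ⟨hQ1, p', hp', hQ2⟩ := hQ
  have hQs := hQi.2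
  -- averaging the numerator makes it invariant
  have hcard : (Fintype.card (degreePerm d) : ℂ) ≠ 0 :=
    Nat.cast_ne_zero.2 Fintype.card_ne_zero
  let P : ParamVec n d → ℂ := (Fintype.card (degreePerm d) : ℂ)⁻¹ •
    ∑ s : degreePerm d, fun w => p' (permVec s w)
  have hP : ∀ w, P w = (Fintype.card (degreePerm d) : ℂ)⁻¹ * ∑ s : degreePerm d,
      p' (permVec s w) := fun w => by
    simp [P]
  refine ⟨P, ⟨Subalgebra.smul_mem _ (Subalgebra.sum_mem _ fun s _ => segreAlg_permVec s hp') _,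
    fun t w => ?_⟩, Q.1, hQi, hQv, fun w hw => ?_, fun w hw => ?_⟩
  · rw [hP, hP]
    congr 1
    exact Fintype.sum_equiv (Equiv.mulRight t) _ _ fun s => by
      rw [Equiv.coe_mulRight, permVec_mul]
  · by_contra h
    exact hw (hQ1 w h)
  · have : ∀ s : degreePerm d, p' (permVec s w.1) = f (ParamSpace.proj n d w) * Q.1 w.1 :=
      fun s => by
        rw [← hQ2 ⟨_, permVec_mem s w.2⟩ (hUs s _ hw), proj_permVec, hfs s _ hw, hQs]
    rw [hP]
    simp only [this]
    rw [Finset.sum_const, Finset.card_univ, nsmul_eq_mul, inv_mul_cancel_left₀ hcard]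

end Invariant

/-! ### The logarithmic component -/

section Component

variable {n m : ℕ} {d : Fin m → ℕ}

theorem mem_paramCone_of_mu_ne_zero {w : ParamVec n d} (hw : mu n d w ≠ 0) :
    w ∈ ParamCone n d := by
  refine ⟨fun h => hw (Subtype.ext (funext fun j => ?_)), fun i h =>
    hw (Subtype.ext (funext fun j => ?_))⟩
  · simp [mu, logForm, h]
  · change ∑ k, w.1.1 k • ((∏ l ∈ Finset.univ.erase k, (w.2 l : Poly n)) *
      MvPolynomial.pderiv j (w.2 k : Poly n)) = 0
    refine Finset.sum_eq_zero fun k _ => ?_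
    by_cases hk : k = i
    · subst hk
      simp [h]
    · rw [Finset.prod_eq_zero (i := i) (Finset.mem_erase.2 ⟨fun h => hk h.symm, Finset.mem_univ i⟩)
        (by rw [h]; rfl), zero_mul, smul_zero]

/-- A logarithmic form that is projective has its residues in the hyperplane, so that it is a value
of `μ`. -/
theorem exists_mu_eq_of_mem_logForms {ω : ProjForm n (∑ i, d i)} (h : ω ∈ logForms n d) :
    ∃ w : ParamVec n d, mu n d w = ω := by
  obtain ⟨l, F, hF, hF0, hω⟩ := h
  have hE : ∀ i, ∑ j, MvPolynomial.X j * MvPolynomial.pderiv j (F i) = d i • F i := fun i =>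
    ((MvPolynomial.mem_homogeneousSubmodule _ _).1 (hF i)).sum_X_mul_pderiv
  have key : ∀ i, ∑ j, MvPolynomial.X j * (l i • ((∏ k ∈ Finset.univ.erase i, F k) *
      MvPolynomial.pderiv j (F i))) = ((d i : ℂ) * l i) • ∏ k, F k := by
    intro i
    have : ∀ j, MvPolynomial.X j * (l i • ((∏ k ∈ Finset.univ.erase i, F k) *
        MvPolynomial.pderiv j (F i))) = l i • ((∏ k ∈ Finset.univ.erase i, F k) *
          (MvPolynomial.X j * MvPolynomial.pderiv j (F i))) := fun j => by
      rw [mul_smul_comm, mul_left_comm]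
    simp only [this]
    rw [← Finset.smul_sum, ← Finset.mul_sum, hE, mul_smul_comm, mul_comm,
      Finset.mul_prod_erase Finset.univ F (Finset.mem_univ i),
      ← Nat.cast_smul_eq_nsmul ℂ, smul_smul, mul_comm]
  have h0 := ω.2.2
  rw [hω] at h0
  simp only [logForm, Finset.mul_sum] at h0
  rw [Finset.sum_comm] at h0
  simp only [key] at h0
  rw [← Finset.sum_smul, smul_eq_zero] at h0
  have hl : ∑ i, (d i : ℂ) * l i = 0 :=
    h0.resolve_right (Finset.prod_ne_zero_iff.2 fun i _ => hF0 i)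
  exact ⟨(⟨l, hl⟩, fun i => ⟨F i, hF i⟩), Subtype.ext hω.symm⟩

theorem mu_mem_logForms {w : ParamVec n d} (hw : w ∈ ParamCone n d) : mu n d w ∈ logForms n d :=
  ⟨_, _, fun i => (w.2 i).2, fun i h => hw.2 i (Subtype.ext h), rfl⟩

theorem proj_mu_mem_logComponent {w : ParamVec n d} (hw : mu n d w ≠ 0) :
    ProjSpace.proj _ ⟨mu n d w, hw⟩ ∈ LogComponent n d :=
  subset_closure ⟨_, hw, mu_mem_logForms (mem_paramCone_of_mu_ne_zero hw), rfl⟩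

/-- An open set that meets the logarithmic component contains a point given by a value of `μ`. -/
theorem exists_mu_of_isOpen {O : Set (ProjSpace (ProjForm n (∑ i, d i)))} (hO : IsOpen O)
    {y : ProjSpace (ProjForm n (∑ i, d i))} (hy : y ∈ LogComponent n d) (hyO : y ∈ O) :
    ∃ (w : ParamVec n d) (hw : mu n d w ≠ 0), ProjSpace.proj _ ⟨mu n d w, hw⟩ ∈ O := by
  obtain ⟨_, hzO, ω, hω, hωl, rfl⟩ := mem_closure_iff.1 hy O hO hyO
  obtain ⟨w, rfl⟩ := exists_mu_eq_of_mem_logForms hωl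
  exact ⟨w, hω, hzO⟩

/-- Polynomials that vanish on the image of `μ` vanish on the cone over the logarithmic component. -/
theorem eq_zero_of_mem_logComponent {y : {y : ProjForm n (∑ i, d i) // y ≠ 0}}
    (hy : ProjSpace.proj _ y ∈ LogComponent n d) {p : ProjForm n (∑ i, d i) → ℂ}
    (hp : p ∈ polyFun (ProjForm n (∑ i, d i))) (hpμ : ∀ w, p (mu n d w) = 0) : p y.1 = 0 := by
  by_contra h
  obtain ⟨w, hw, v, hvw, hv⟩ := exists_mu_of_isOpen (isOpen_nonvanishing hp) hy ⟨y, rfl, h⟩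
  obtain ⟨c, -, hc⟩ := projSpace_proj_eq_iff.1 hvw
  refine hv ?_
  have := hpμ (scaleVec c 1 w)
  rw [mu_scaleVec] at this
  simp only [Pi.one_apply, Finset.prod_const_one, mul_one] at this
  rwa [hc]

/-- A polynomial function on the space of projective forms whose non-vanishing cuts out the part of
the logarithmic component over which the parametrization is understood: there it is surjective and
injective up to permutations, and the invariants of the Segre algebra descend. -/
structure IsGenericDenominator (n : ℕ) (d : Fin m → ℕ) (Δ : ProjForm n (∑ i, d i) → ℂ) : Prop where
  mem : Δ ∈ polyFun (ProjForm n (∑ i, d i))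
  ne_zero : ∀ y, Δ y ≠ 0 → y ≠ 0
  exists_ne_zero : ∃ w, Δ (mu n d w) ≠ 0
  exists_mu_eq : ∀ y : {y : ProjForm n (∑ i, d i) // y ≠ 0},
    ProjSpace.proj _ y ∈ LogComponent n d → Δ y.1 ≠ 0 → ∃ w : ParamCone n d, mu n d w.1 = y.1
  exists_smul_eq : ∀ v v' : ParamCone n d, Δ (mu n d v.1) ≠ 0 → mu n d v.1 = mu n d v'.1 →
    ∃ s : degreePerm d, s • ParamSpace.proj n d v = ParamSpace.proj n d v'
  descends : ∀ g ∈ invariantAlg n d, ∃ N : ℕ, ∃ P ∈ polyFun (ProjForm n (∑ i, d i)),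
    ∀ w, g w * Δ (mu n d w) ^ N = P (mu n d w)

/-- The function is a product of three: a functional that does not vanish on some generic form, a
polynomial outside of whose zeros `μ` is surjective onto the cone over the logarithmic component, and
a common denominator of the descended invariants. -/
theorem exists_isGenericDenominator (hn : 2 ≤ n) (hm : 2 ≤ m) (hd : ∀ i, 0 < d i)
    (h₂ : m = 2 → ∀ i j, i ≠ j → ¬ d i ∣ d j) : ∃ Δ, IsGenericDenominator n d Δ := by
  obtain ⟨b, hb, ⟨v₀, hv₀⟩, hgen⟩ := exists_generic hn hm hd h₂
  have hmu : ∀ v v', b v ≠ 0 → (∀ i, v'.2 i ≠ 0) → mu n d v = mu n d v' →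
      ∃ (s : degreePerm d) (e : Fin m → ℂ), (∀ i, e i ≠ 0) ∧
        v' = permVec s (scaleVec (∏ k, e k)⁻¹ e v) := fun v v' hv hv' h => by
    obtain ⟨s, e, he, h1, h2⟩ := (hgen v hv).2 v' hv' h
    exact ⟨s, e, he, exists_eq_scaleVec he h1 h2⟩
  obtain ⟨a, ha, ha0, hsurj⟩ := exists_forall_mem_image_mu hb ⟨v₀, hv₀⟩
  obtain ⟨D, hD, hD0, hdesc⟩ := exists_denominator hb ⟨v₀, hv₀⟩ fun v v' hv hv' h => by
    obtain ⟨s, e, he, rfl⟩ := hmu v v' hv (hgen v' hv').1.1.2 h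
    exact ⟨s, _, _, inv_mul_cancel₀ (Finset.prod_ne_zero_iff.2 fun i _ => he i), rfl⟩
  obtain ⟨φ, hφ⟩ := Module.Projective.exists_dual_ne_zero ℂ (hgen v₀ hv₀).1.2
  refine ⟨(fun y => φ y) * a * D, ?_, fun y hy h => ?_, ?_, fun y hy hΔ => ?_,
    fun v v' hΔ h => ?_, fun g hg => ?_⟩
  · exact Subalgebra.mul_mem _ (Subalgebra.mul_mem _ (dual_mem_polyFun φ) ha) hD
  · simp [h] at hy
  · obtain ⟨w₁, hw₁⟩ := ha0
    obtain ⟨w₂, hw₂⟩ := hD0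
    obtain ⟨w₃, hw₃, hw₃'⟩ := polyFun_mul_ne_zero (comp_mu_mem (dual_mem_polyFun φ))
      (comp_mu_mem ha) ⟨v₀, hφ⟩ ⟨w₁, hw₁⟩
    obtain ⟨w, hw⟩ := polyFun_mul_ne_zero (Subalgebra.mul_mem _
      (comp_mu_mem (dual_mem_polyFun φ)) (comp_mu_mem ha)) (comp_mu_mem hD)
      ⟨w₃, mul_ne_zero hw₃ hw₃'⟩ ⟨w₂, hw₂⟩
    exact ⟨w, mul_ne_zero hw.1 hw.2⟩
  · obtain ⟨w, hw, hwy⟩ := hsurj y.1 (fun p hp h => eq_zero_of_mem_logComponent hy hp h)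
      (right_ne_zero_of_mul (left_ne_zero_of_mul hΔ))
    exact ⟨⟨w, (hgen w hw).1.1⟩, hwy⟩
  · -- a preimage `w` with `b w ≠ 0` of the common value, to which both points are compared
    have hne : mu n d v.1 ≠ 0 := fun h0 => by
      simp [h0] at hΔ
    obtain ⟨w, hw, hwy⟩ := hsurj (mu n d v.1) (fun p hp h => h v.1)
      (right_ne_zero_of_mul (left_ne_zero_of_mul hΔ))
    have hwC := (hgen w hw).1.1
    have hcomp : ∀ u : ParamCone n d, mu n d w = mu n d u.1 → ∃ s : degreePerm d,
        s • ParamSpace.proj n d ⟨w, hwC⟩ = ParamSpace.proj n d u := fun u hu => by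
      obtain ⟨s, e, he, hse⟩ := hmu w u.1 hw u.2.2 hu
      refine ⟨s, ?_⟩
      have he0 : (∏ k, e k)⁻¹ ≠ 0 := inv_ne_zero (Finset.prod_ne_zero_iff.2 fun i _ => he i)
      have hu' : u = ⟨_, permVec_mem s (scaleVec_mem he0 he hwC)⟩ := Subtype.ext hse
      rw [hu', proj_permVec s ⟨_, scaleVec_mem he0 he hwC⟩]
      congr 1
      exact (proj_eq_iff.2 ⟨_, _, he0, he, rfl⟩).symm
    obtain ⟨s, hs⟩ := hcomp v hwy
    obtain ⟨t, ht⟩ := hcomp v' (hwy.trans h)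
    exact ⟨t * s⁻¹, by rw [← hs, mul_smul, inv_smul_smul, ht]⟩
  · obtain ⟨N, P, hP, hPw⟩ := hdesc g hg
    refine ⟨N, ((fun y => φ y) * a) ^ N * P, Subalgebra.mul_mem _ (Subalgebra.pow_mem _
      (Subalgebra.mul_mem _ (dual_mem_polyFun φ) ha) _) hP, fun w => ?_⟩
    simp only [Pi.mul_apply, Pi.pow_apply, ← hPw]
    ring

end Component

/-! ### Regular functions on projective space -/

section Regular

variable {W : Type*} [AddCommGroup W] [Module ℂ W]

/-- In the chart `ℓ = 1`, a polynomial function becomes a polynomial function on the cone after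
multiplication by a power of `ℓ`. -/
theorem exists_homogenisation (ℓ : Module.Dual ℂ W) {p : W → ℂ} (hp : p ∈ polyFun W) :
    ∃ N : ℕ, ∃ q ∈ polyFun W, ∀ w, ℓ w ≠ 0 → q w = ℓ w ^ N * p ((ℓ w)⁻¹ • w) := by
  have hℓ := dual_mem_polyFun ℓ
  induction hp using Algebra.adjoin_induction with
  | mem p hp =>
    obtain ⟨φ, rfl⟩ := hp
    refine ⟨1, _, dual_mem_polyFun φ, fun w hw => ?_⟩
    change φ w = ℓ w ^ 1 * φ ((ℓ w)⁻¹ • w)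
    rw [map_smul, smul_eq_mul, pow_one, mul_inv_cancel_left₀ hw]
  | algebraMap c => exact ⟨0, _, Subalgebra.algebraMap_mem _ c, fun w _ => by simp⟩
  | add p q _ _ hp hq =>
    obtain ⟨N, f, hf, hfw⟩ := hp
    obtain ⟨M, g, hg, hgw⟩ := hq
    refine ⟨N + M, (fun w => ℓ w) ^ M * f + (fun w => ℓ w) ^ N * g,
      Subalgebra.add_mem _ (Subalgebra.mul_mem _ (Subalgebra.pow_mem _ hℓ _) hf)
        (Subalgebra.mul_mem _ (Subalgebra.pow_mem _ hℓ _) hg), fun w hw => ?_⟩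
    simp only [Pi.add_apply, Pi.mul_apply, Pi.pow_apply, hfw w hw, hgw w hw]
    ring
  | mul p q _ _ hp hq =>
    obtain ⟨N, f, hf, hfw⟩ := hp
    obtain ⟨M, g, hg, hgw⟩ := hq
    refine ⟨N + M, f * g, Subalgebra.mul_mem _ hf hg, fun w hw => ?_⟩
    simp only [Pi.mul_apply, hfw w hw, hgw w hw]
    ring

/-- The quotient of two polynomial functions on the affine chart `ℓ = 1` is a regular function on an
open set of projective space. -/
theorem exists_regularOn (ℓ : Module.Dual ℂ W) {p q : W → ℂ} (hp : p ∈ polyFun W)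
    (hq : q ∈ polyFun W) : ∃ (O : Set (ProjSpace W)) (g : ProjSpace W → ℂ), IsOpen O ∧
      SpaceWithFunctions.RegularOn O g ∧
      (∀ v : {v : W // v ≠ 0}, ProjSpace.proj W v ∈ O ↔ ℓ v.1 ≠ 0 ∧ q ((ℓ v.1)⁻¹ • v.1) ≠ 0) ∧
      ∀ v : {v : W // v ≠ 0}, g (ProjSpace.proj W v) =
        p ((ℓ v.1)⁻¹ • v.1) / q ((ℓ v.1)⁻¹ • v.1) := by
  have hrep : ∀ v : {v : W // v ≠ 0}, ∃ c : ℂ, c ≠ 0 ∧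
      (Projectivization.rep (ProjSpace.proj W v) : W) = c • v.1 := fun v => by
    obtain ⟨c, hc⟩ := Projectivization.exists_smul_eq_mk_rep ℂ v.1 v.2
    exact ⟨c, c.ne_zero, hc.symm⟩
  have hinv : ∀ (c : ℂ) (v : W), c ≠ 0 → (ℓ (c • v))⁻¹ • c • v = (ℓ v)⁻¹ • v := fun c v hc => by
    rw [map_smul, smul_smul, smul_eq_mul, mul_inv, mul_right_comm, inv_mul_cancel₀ hc, one_mul]
  let O : Set (ProjSpace W) := {x | ℓ (Projectivization.rep x) ≠ 0 ∧
    q ((ℓ (Projectivization.rep x))⁻¹ • Projectivization.rep x) ≠ 0}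
  have hO : ∀ v : {v : W // v ≠ 0}, ProjSpace.proj W v ∈ O ↔
      ℓ v.1 ≠ 0 ∧ q ((ℓ v.1)⁻¹ • v.1) ≠ 0 := fun v => by
    obtain ⟨c, hc, h⟩ := hrep v
    change ℓ _ ≠ 0 ∧ q ((ℓ _)⁻¹ • _) ≠ 0 ↔ _
    rw [h, hinv c v.1 hc, map_smul, smul_eq_mul, mul_ne_zero_iff]
    simp only [hc, ne_eq, not_false_eq_true, true_and]
  obtain ⟨N, f, hf, hfw⟩ := exists_homogenisation ℓ hp
  obtain ⟨M, g, hg, hgw⟩ := exists_homogenisation ℓ hq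
  have hval : ∀ v : {v : W // v ≠ 0},
      p ((ℓ (Projectivization.rep (ProjSpace.proj W v)))⁻¹ •
        Projectivization.rep (ProjSpace.proj W v)) /
      q ((ℓ (Projectivization.rep (ProjSpace.proj W v)))⁻¹ •
        Projectivization.rep (ProjSpace.proj W v)) =
        p ((ℓ v.1)⁻¹ • v.1) / q ((ℓ v.1)⁻¹ • v.1) := fun v => by
    obtain ⟨c, hc, h⟩ := hrep v
    rw [h, hinv c v.1 hc]
  have hℓ := dual_mem_polyFun ℓ
  refine ⟨O, fun x => p ((ℓ (Projectivization.rep x))⁻¹ • Projectivization.rep x) /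
    q ((ℓ (Projectivization.rep x))⁻¹ • Projectivization.rep x), ?_, ?_, hO, hval⟩
  · rw [projSpace_isOpen_iff]
    intro v hv
    obtain ⟨hv1, hv2⟩ := (hO v).1 hv
    refine ⟨(fun w => ℓ w) * g, Subalgebra.mul_mem _ hℓ hg, ?_, fun w hw => (hO w).2 ?_⟩
    · simp only [Pi.mul_apply, hgw _ hv1]
      exact mul_ne_zero hv1 (mul_ne_zero (pow_ne_zero _ hv1) hv2)
    · have h1 : ℓ w.1 ≠ 0 := left_ne_zero_of_mul hw
      have h2 : g w.1 ≠ 0 := right_ne_zero_of_mul hw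
      rw [hgw _ h1] at h2
      exact ⟨h1, right_ne_zero_of_mul h2⟩
  · intro v hv
    obtain ⟨hv1, hv2⟩ := (hO v).1 hv
    refine ⟨(fun w => ℓ w) ^ M * f, Subalgebra.mul_mem _ (Subalgebra.pow_mem _ hℓ _) hf,
      (fun w => ℓ w) ^ N * g, Subalgebra.mul_mem _ (Subalgebra.pow_mem _ hℓ _) hg, ?_,
      fun w hwO hw => ?_⟩
    · simp only [Pi.mul_apply, Pi.pow_apply, hgw _ hv1]
      exact mul_ne_zero (pow_ne_zero _ hv1) (mul_ne_zero (pow_ne_zero _ hv1) hv2)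
    · obtain ⟨h1, h2⟩ := (hO w).1 hwO
      refine (hval w).trans ?_
      simp only [Pi.mul_apply, Pi.pow_apply, hgw _ h1, hfw _ h1]
      field_simp

theorem projSpace_regularOn_mono {U O : Set (ProjSpace W)} {f : ProjSpace W → ℂ}
    (h : SpaceWithFunctions.RegularOn O f) (hU : U ⊆ O) : SpaceWithFunctions.RegularOn U f := by
  intro v hv
  obtain ⟨p, hp, q, hq, hqv, hpq⟩ := h v (hU hv)
  exact ⟨p, hp, q, hq, hqv, fun w hw => hpq w (hU hw)⟩

/-- Regularity on a subset of a subset of projective space, without the intermediate subset. -/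
theorem regularOn_subtype_iff {Y : Set (ProjSpace W)} {V : Set Y} {U : Set V} {f : V → ℂ} :
    SpaceWithFunctions.RegularOn U f ↔ ∀ y ∈ U, ∃ (O : Set (ProjSpace W)) (g : ProjSpace W → ℂ),
      IsOpen O ∧ (y : ProjSpace W) ∈ O ∧ SpaceWithFunctions.RegularOn O g ∧
        ∀ z ∈ U, (z : ProjSpace W) ∈ O → f z = g z := by
  constructor
  · intro h y hy
    obtain ⟨O₁, g₁, hO₁, hyO₁, hg₁, hfg⟩ := h y hy
    obtain ⟨O, g, hO, hyO, hg, hg₁g⟩ := hg₁ y.1 hyO₁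
    obtain ⟨O', hO', rfl⟩ := isOpen_induced_iff.1 hO₁
    refine ⟨O ∩ O', g, hO.inter hO', ⟨hyO, hyO₁⟩,
      projSpace_regularOn_mono hg Set.inter_subset_left, fun z hz hzO => ?_⟩
    rw [hfg z hz hzO.2, hg₁g z.1 hzO.2 hzO.1]
  · intro h y hy
    obtain ⟨O, g, hO, hyO, hg, hfg⟩ := h y hy
    exact ⟨Subtype.val ⁻¹' O, fun z => g z, hO.preimage continuous_subtype_val, hyO,
      fun z hz => ⟨O, g, hO, hz, hg, fun _ _ _ => rfl⟩, fun z hz hzO => hfg z hz hzO⟩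

end Regular

/-! ### The parametrization over the generic part of the component -/

section Birational

variable {n m : ℕ} {d : Fin m → ℕ} {Δ : ProjForm n (∑ i, d i) → ℂ}

/-- The points of the parameter space over the locus `Δ ≠ 0`. -/
def genericParam (Δ : ProjForm n (∑ i, d i) → ℂ) : Set (ParamSpace n d) :=
  {x | ∃ v : ParamCone n d, ParamSpace.proj n d v = x ∧ Δ (mu n d v.1) ≠ 0}

/-- The orbits over the locus `Δ ≠ 0`. -/
def genericQuot (Δ : ProjForm n (∑ i, d i) → ℂ) : Set (Quotient (permRel n d)) :=
  Quotient.mk (permRel n d) '' genericParam Δ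

/-- The locus `Δ ≠ 0` in the logarithmic component. -/
def genericComp (Δ : ProjForm n (∑ i, d i) → ℂ) : Set (LogComponent n d) :=
  {y | y.1 ∈ nonvanishing Δ}

theorem scaleVec_one_mem {c : ℂ} (hc : c ≠ 0) (v : ParamCone n d) :
    scaleVec c 1 v.1 ∈ ParamCone n d := scaleVec_mem hc (fun _ => one_ne_zero) v.2

theorem proj_scaleVec_one {c : ℂ} (hc : c ≠ 0) (v : ParamCone n d) :
    ParamSpace.proj n d ⟨scaleVec c 1 v.1, scaleVec_one_mem hc v⟩ = ParamSpace.proj n d v :=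
  proj_eq_iff.2 ⟨c, 1, hc, fun _ => one_ne_zero, rfl⟩

theorem mu_scaleVec_one (c : ℂ) (v : ParamVec n d) : mu n d (scaleVec c 1 v) = c • mu n d v := by
  rw [mu_scaleVec]
  simp

theorem coe_rho {x : rhoDomain n d} {v : ParamCone n d} (h : ParamSpace.proj n d v = x) :
    ∃ hv : mu n d v.1 ≠ 0,
      (rho n d x : ProjSpace (ProjForm n (∑ i, d i))) = ProjSpace.proj _ ⟨mu n d v.1, hv⟩ := by
  obtain ⟨x, hx⟩ := x
  obtain rfl : ParamSpace.proj n d v = x := h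
  exact ⟨(proj_mem_rhoDomain n d v).1 hx, rho_proj n d v _⟩

theorem smul_mem_rhoDomain (s : degreePerm d) {x : ParamSpace n d} (hx : x ∈ rhoDomain n d) :
    s • x ∈ rhoDomain n d := by
  obtain ⟨v, rfl⟩ := paramSpace_proj_surjective x
  rw [← proj_permVec, proj_mem_rhoDomain, mu_permVec]
  exact (proj_mem_rhoDomain n d v).1 hx

theorem rho_smul (s : degreePerm d) (x : rhoDomain n d) :
    rho n d ⟨s • x.1, smul_mem_rhoDomain s x.2⟩ = rho n d x := by
  obtain ⟨v, hv⟩ := paramSpace_proj_surjective x.1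
  obtain ⟨h1, h2⟩ := coe_rho hv
  obtain ⟨h3, h4⟩ := coe_rho (x := ⟨s • x.1, smul_mem_rhoDomain s x.2⟩)
    (v := ⟨permVec s v.1, permVec_mem s v.2⟩) (by rw [proj_permVec, hv])
  refine Subtype.ext (h4.trans (Eq.trans ?_ h2.symm))
  congr 2
  exact mu_permVec s v.1

theorem rho_mem_genericComp_iff {x : rhoDomain n d} : rho n d x ∈ genericComp Δ ↔ x.1 ∈ genericParam Δ := by
  constructor
  · rintro ⟨y, hy, hyΔ⟩
    obtain ⟨v, hv⟩ := paramSpace_proj_surjective x.1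
    obtain ⟨h1, h2⟩ := coe_rho hv
    obtain ⟨c, hc, h⟩ := projSpace_proj_eq_iff.1 (hy.trans h2)
    exact ⟨_, (proj_scaleVec_one hc v).trans hv, by rwa [mu_scaleVec_one, ← h]⟩
  · rintro ⟨v, hvx, hv⟩
    obtain ⟨h1, h2⟩ := coe_rho hvx
    exact ⟨_, h2.symm, hv⟩

theorem smul_mem_genericParam (s : degreePerm d) {x : ParamSpace n d} (hx : x ∈ genericParam Δ) :
    s • x ∈ genericParam Δ := by
  obtain ⟨v, rfl, hv⟩ := hx
  exact ⟨⟨permVec s v.1, permVec_mem s v.2⟩, rfl, by rwa [mu_permVec]⟩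

theorem mk_mem_genericQuot {x : ParamSpace n d} :
    Quotient.mk (permRel n d) x ∈ genericQuot Δ ↔ x ∈ genericParam Δ := by
  constructor
  · rintro ⟨x', hx', h⟩
    obtain ⟨s, rfl⟩ := Quotient.exact h
    have := smul_mem_genericParam s⁻¹ hx'
    rwa [inv_smul_smul] at this
  · exact fun h => ⟨x, h, rfl⟩

theorem out_mem_genericParam (q : genericQuot Δ) :
    q.1.out ∈ genericParam Δ := by
  rw [← mk_mem_genericQuot]
  have : Quotient.mk (permRel n d) q.1.out = q.1 := Quotient.out_eq _
  exact this.symm ▸ q.2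

theorem exists_mk_eq (q : genericQuot Δ) : ∃ (v : ParamCone n d) (hv : Δ (mu n d v.1) ≠ 0),
    q = ⟨Quotient.mk _ (ParamSpace.proj n d v), mk_mem_genericQuot.2 ⟨v, rfl, hv⟩⟩ := by
  obtain ⟨_, x, ⟨v, rfl, hv⟩, rfl⟩ := q
  exact ⟨v, hv, rfl⟩

namespace IsGenericDenominator

variable (hΔ : IsGenericDenominator n d Δ)
include hΔ

theorem mem_rhoDomain {x : ParamSpace n d} (hx : x ∈ genericParam Δ) : x ∈ rhoDomain n d := by
  obtain ⟨v, rfl, hv⟩ := hx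
  exact (proj_mem_rhoDomain n d v).2 (hΔ.ne_zero _ hv)

theorem exists_rho_eq {y : LogComponent n d} (hy : y ∈ genericComp Δ) :
    ∃ x : rhoDomain n d, rho n d x = y := by
  obtain ⟨u, hu, huΔ⟩ := hy
  obtain ⟨w, hw⟩ := hΔ.exists_mu_eq u (hu ▸ y.2) huΔ
  have hw0 : mu n d w.1 ≠ 0 := hw ▸ u.2
  refine ⟨⟨_, (proj_mem_rhoDomain n d w).2 hw0⟩, Subtype.ext ?_⟩
  rw [rho_proj n d w hw0, ← hu]
  congr 1
  exact Subtype.ext hw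

theorem rho_eq_iff {x x' : rhoDomain n d} (hx : rho n d x ∈ genericComp Δ) :
    rho n d x = rho n d x' ↔ ∃ s : degreePerm d, s • (x : ParamSpace n d) = x' := by
  constructor
  · intro h
    obtain ⟨v, hvx, hv⟩ := rho_mem_genericComp_iff.1 hx
    obtain ⟨v', hvx'⟩ := paramSpace_proj_surjective x'.1
    obtain ⟨h1, h2⟩ := coe_rho hvx
    obtain ⟨h3, h4⟩ := coe_rho hvx'
    obtain ⟨c, hc, hcv⟩ := projSpace_proj_eq_iff.1
      (h2.symm.trans ((congrArg Subtype.val h).trans h4))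
    obtain ⟨s, hs⟩ := hΔ.exists_smul_eq v ⟨_, scaleVec_one_mem hc v'⟩ hv
      (by rw [mu_scaleVec_one]; exact hcv)
    exact ⟨s, by rw [← hvx, hs, proj_scaleVec_one hc, hvx']⟩
  · rintro ⟨s, hs⟩
    rw [← rho_smul s x]
    congr 1
    exact Subtype.ext hs

/-- The open subset of the generic parameters given by an open set of projective space. -/
theorem isOpen_setOf_rho_mem {O : Set (ProjSpace (ProjForm n (∑ i, d i)))} (hO : IsOpen O) :
    IsOpen {x | ∃ h : x ∈ genericParam Δ,
      (rho n d ⟨x, hΔ.mem_rhoDomain h⟩ : ProjSpace (ProjForm n (∑ i, d i))) ∈ O} := by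
  rw [paramSpace_isOpen_iff]
  rintro v ⟨⟨w, hwv, hw⟩, hvO⟩
  obtain ⟨hw0, hw'⟩ := coe_rho (x := ⟨_, hΔ.mem_rhoDomain ⟨w, hwv, hw⟩⟩) hwv
  rw [hw'] at hvO
  obtain ⟨p, hp, hpw, hpO⟩ := projSpace_isOpen_iff.1 hO _ hvO
  obtain ⟨c, a, hc, ha, hca⟩ := proj_eq_iff.1 hwv
  have hk : c * ∏ i, a i ≠ 0 := mul_ne_zero hc (Finset.prod_ne_zero_iff.2 fun i _ => ha i)
  have hmem : (fun u => (p * Δ) ((c * ∏ i, a i) • mu n d u)) ∈ polyFun (ParamVec n d) :=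
    polyFun_comp_mem (fun φ => dual_comp_mu_mem (φ ∘ₗ LinearMap.lsmul ℂ _ (c * ∏ i, a i)))
      (Subalgebra.mul_mem _ hp hΔ.mem)
  refine ⟨_, hmem, ?_, fun u hu => ?_⟩
  · rw [← mu_scaleVec, ← hca]
    exact mul_ne_zero hpw hw
  · have hu1 : p ((c * ∏ i, a i) • mu n d u.1) ≠ 0 := left_ne_zero_of_mul hu
    have hu2 : Δ ((c * ∏ i, a i) • mu n d u.1) ≠ 0 := right_ne_zero_of_mul hu
    rw [← mu_scaleVec_one] at hu1 hu2
    have hmem' : ParamSpace.proj n d u ∈ genericParam Δ := ⟨_, proj_scaleVec_one hk u, hu2⟩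
    refine ⟨hmem', ?_⟩
    obtain ⟨h0, h1⟩ := coe_rho (x := ⟨_, hΔ.mem_rhoDomain hmem'⟩) (proj_scaleVec_one hk u)
    rw [h1]
    exact hpO _ hu1

theorem isOpen_genericParam : IsOpen (genericParam Δ) := by
  have := hΔ.isOpen_setOf_rho_mem isOpen_univ
  simpa using this

theorem isOpen_genericQuot : IsOpen (genericQuot Δ) := by
  change IsOpen (Quotient.mk (permRel n d) ⁻¹' genericQuot Δ)
  convert hΔ.isOpen_genericParam using 1
  ext x
  exact mk_mem_genericQuot

theorem isOpen_genericComp : IsOpen (genericComp Δ) :=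
  (isOpen_nonvanishing hΔ.mem).preimage continuous_subtype_val

theorem dense_genericParam : Dense (genericParam Δ) := by
  rw [dense_iff_inter_open]
  rintro U hU ⟨x, hx⟩
  obtain ⟨v, rfl⟩ := paramSpace_proj_surjective x
  obtain ⟨p, hp, hpv, hpU⟩ := paramSpace_isOpen_iff.1 hU v hx
  obtain ⟨w, hw, hwΔ⟩ := polyFun_mul_ne_zero hp (comp_mu_mem hΔ.mem) ⟨_, hpv⟩ hΔ.exists_ne_zero
  have hwC := mem_paramCone_of_mu_ne_zero (hΔ.ne_zero _ hwΔ)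
  exact ⟨_, hpU ⟨w, hwC⟩ hw, ⟨w, hwC⟩, rfl, hwΔ⟩

theorem dense_genericQuot : Dense (genericQuot Δ) :=
  Quotient.mk_surjective.denseRange.dense_image continuous_quotient_mk' hΔ.dense_genericParam

theorem dense_genericComp : Dense (genericComp Δ) := by
  rw [dense_iff_inter_open]
  rintro U hU ⟨y, hy⟩
  obtain ⟨O, hO, rfl⟩ := isOpen_induced_iff.1 hU
  obtain ⟨v, hv, hvO⟩ := exists_mu_of_isOpen hO y.2 hy
  obtain ⟨p, hp, hpv, hpO⟩ := projSpace_isOpen_iff.1 hO _ hvO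
  obtain ⟨w, hw, hwΔ⟩ := polyFun_mul_ne_zero (comp_mu_mem hp) (comp_mu_mem hΔ.mem)
    ⟨_, hpv⟩ hΔ.exists_ne_zero
  have hw0 := hΔ.ne_zero _ hwΔ
  exact ⟨⟨_, proj_mu_mem_logComponent hw0⟩, hpO ⟨_, hw0⟩ hw, ⟨_, hw0⟩, rfl, hwΔ⟩

/-- The map induced by `ρ` on the generic part of the quotient. -/
def quotRho (q : genericQuot Δ) : genericComp Δ :=
  ⟨rho n d ⟨q.1.out, hΔ.mem_rhoDomain (out_mem_genericParam q)⟩, rho_mem_genericComp_iff.2 (out_mem_genericParam q)⟩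

theorem quotRho_mk {x : ParamSpace n d} (hx : x ∈ genericParam Δ) :
    (hΔ.quotRho ⟨Quotient.mk _ x, mk_mem_genericQuot.2 hx⟩ : LogComponent n d) =
      rho n d ⟨x, hΔ.mem_rhoDomain hx⟩ := by
  obtain ⟨s, hs⟩ : permRel n d (Quotient.mk (permRel n d) x).out x := Quotient.mk_out x
  rw [← rho_smul s]
  change rho n d _ = rho n d _
  congr 1
  exact Subtype.ext hs.symm

theorem coe_quotRho_mk (v : ParamCone n d) (hv : Δ (mu n d v.1) ≠ 0) :
    (hΔ.quotRho ⟨Quotient.mk _ (ParamSpace.proj n d v),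
      mk_mem_genericQuot.2 ⟨v, rfl, hv⟩⟩ : ProjSpace (ProjForm n (∑ i, d i))) =
      ProjSpace.proj _ ⟨mu n d v.1, hΔ.ne_zero _ hv⟩ :=
  (congrArg Subtype.val (hΔ.quotRho_mk ⟨v, rfl, hv⟩)).trans (rho_proj n d v _)

theorem quotRho_bijective : Function.Bijective hΔ.quotRho := by
  constructor
  · intro q q' h
    obtain ⟨s, hs⟩ := (hΔ.rho_eq_iff (rho_mem_genericComp_iff.2 (out_mem_genericParam q))).1
      (congrArg Subtype.val h)
    refine Subtype.ext ?_
    have h1 : Quotient.mk (permRel n d) q.1.out = q.1 := Quotient.out_eq _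
    have h2 : Quotient.mk (permRel n d) q'.1.out = q'.1 := Quotient.out_eq _
    rw [← h1, ← h2]
    exact (Quotient.sound ⟨s, hs⟩ : Quotient.mk (permRel n d) _ = Quotient.mk _ _).symm
  · intro y
    obtain ⟨x, hx⟩ := hΔ.exists_rho_eq y.2
    have hxm : x.1 ∈ genericParam Δ := rho_mem_genericComp_iff.1 (hx ▸ y.2)
    exact ⟨_, Subtype.ext ((hΔ.quotRho_mk hxm).trans hx)⟩

theorem continuous_quotRho : Continuous hΔ.quotRho := by
  refine continuous_induced_rng.2 (continuous_induced_rng.2 ⟨fun O hO => ?_⟩)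
  refine isOpen_induced_iff.2 ⟨Quotient.mk _ '' {x | ∃ h : x ∈ genericParam Δ,
    (rho n d ⟨x, hΔ.mem_rhoDomain h⟩ : ProjSpace (ProjForm n (∑ i, d i))) ∈ O}, ?_, ?_⟩
  · exact isOpenMap_quotient_mk'_mul (Γ := degreePerm d) _ (hΔ.isOpen_setOf_rho_mem hO)
  · ext q
    constructor
    · rintro ⟨x, ⟨hx, hxO⟩, hxq⟩
      obtain rfl : q = ⟨Quotient.mk _ x, mk_mem_genericQuot.2 hx⟩ := Subtype.ext hxq.symm
      change ((hΔ.quotRho _ : LogComponent n d) : ProjSpace (ProjForm n (∑ i, d i))) ∈ O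
      rwa [hΔ.quotRho_mk hx]
    · intro hq
      exact ⟨q.1.out, ⟨out_mem_genericParam q, hq⟩, Quotient.out_eq _⟩

/-- The value of an invariant regular function at a point is given near the image of this point by
a quotient of polynomial functions; the denominator controls the membership in the open set. -/
theorem exists_descended_fraction {U : Set (ParamSpace n d)} (hU : IsOpen U)
    (hUs : ∀ (s : degreePerm d) x, x ∈ U → s • x ∈ U) {f : ParamSpace n d → ℂ}
    (hf : SpaceWithFunctions.RegularOn U f)
    (hfs : ∀ (s : degreePerm d), ∀ x ∈ U, f (s • x) = f x) (v : ParamCone n d)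
    (hv : ParamSpace.proj n d v ∈ U) (hvΔ : Δ (mu n d v.1) ≠ 0) :
    ∃ p ∈ polyFun (ProjForm n (∑ i, d i)), ∃ q ∈ polyFun (ProjForm n (∑ i, d i)),
      q (mu n d v.1) ≠ 0 ∧ (∀ y, q y ≠ 0 → Δ y ≠ 0) ∧
      ∀ w : ParamCone n d, q (mu n d w.1) ≠ 0 → ParamSpace.proj n d w ∈ U ∧
        f (ParamSpace.proj n d w) = p (mu n d w.1) / q (mu n d w.1) := by
  obtain ⟨P, hP, Q, hQ, hQv, hQU, hfQ⟩ := exists_invariant_fraction hU hUs hf hfs v hv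
  obtain ⟨N, P₁, hP₁, hPw⟩ := hΔ.descends P hP
  obtain ⟨M, Q₁, hQ₁, hQw⟩ := hΔ.descends Q hQ
  refine ⟨P₁ * Δ ^ (M + 1), Subalgebra.mul_mem _ hP₁ (Subalgebra.pow_mem _ hΔ.mem _),
    Q₁ * Δ ^ (N + 1), Subalgebra.mul_mem _ hQ₁ (Subalgebra.pow_mem _ hΔ.mem _), ?_,
    fun y hy h => ?_, fun w hw => ?_⟩
  · simp only [Pi.mul_apply, Pi.pow_apply, ← hQw, hQv, one_mul]
    exact mul_ne_zero (pow_ne_zero _ hvΔ) (pow_ne_zero _ hvΔ)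
  · simp [h] at hy
  · simp only [Pi.mul_apply, Pi.pow_apply, ← hQw, ← hPw] at hw ⊢
    have hQ0 : Q w.1 ≠ 0 := left_ne_zero_of_mul (left_ne_zero_of_mul hw)
    have hΔ0 : Δ (mu n d w.1) ≠ 0 := by
      rintro h
      simp [h] at hw
    have hwU := hQU w hQ0
    refine ⟨hwU, ?_⟩
    rw [eq_div_iff hw, ← hfQ w hwU]
    ring

/-- The denominator of the descended fraction for the zero function on an invariant open set cuts out
a neighbourhood in the image of that set. -/
theorem isOpenMap_quotRho : IsOpenMap hΔ.quotRho := by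
  intro T hT
  obtain ⟨T', hT', rfl⟩ := isOpen_induced_iff.1 hT
  rw [isOpen_iff_mem_nhds]
  rintro _ ⟨q, hq, rfl⟩
  obtain ⟨v, hv, rfl⟩ := exists_mk_eq q
  let U : Set (ParamSpace n d) := Quotient.mk (permRel n d) ⁻¹' T'
  have hU : IsOpen U := hT'.preimage continuous_quotient_mk'
  have hUs : ∀ (s : degreePerm d) x, x ∈ U → s • x ∈ U := fun s x hx => by
    have : Quotient.mk (permRel n d) (s • x) = Quotient.mk _ x := Quotient.sound ⟨s, rfl⟩
    change Quotient.mk (permRel n d) (s • x) ∈ T'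
    rw [this]
    exact hx
  obtain ⟨p, hp, r, hr, hrv, hrΔ, hrU⟩ := hΔ.exists_descended_fraction hU hUs (f := fun _ => 0)
    (fun v _ => ⟨0, Subalgebra.zero_mem _, 1, Subalgebra.one_mem _, one_ne_zero, fun w _ _ => by
      simp⟩) (fun _ _ _ => rfl) v hq hv
  refine Filter.mem_of_superset (IsOpen.mem_nhds (s := {y : genericComp Δ |
    y.1.1 ∈ nonvanishing r}) ?_ ?_) ?_
  · exact ((isOpen_nonvanishing hr).preimage continuous_subtype_val).preimage
      continuous_subtype_val
  · exact ⟨_, (hΔ.coe_quotRho_mk v hv).symm, hrv⟩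
  · rintro y ⟨u, hu, hur⟩
    obtain ⟨w, hw⟩ := hΔ.exists_mu_eq u (hu ▸ y.1.2) (hrΔ _ hur)
    have hwΔ : Δ (mu n d w.1) ≠ 0 := hw ▸ hrΔ _ hur
    refine ⟨⟨_, mk_mem_genericQuot.2 ⟨w, rfl, hwΔ⟩⟩, (hrU w (hw ▸ hur)).1, ?_⟩
    refine Subtype.ext (Subtype.ext ?_)
    rw [hΔ.coe_quotRho_mk w hwΔ, ← hu]
    congr 1
    exact Subtype.ext hw

end IsGenericDenominator

end Birational

/-! ### The birational isomorphism -/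

namespace IsGenericDenominator

variable {n m : ℕ} {d : Fin m → ℕ} {Δ : ProjForm n (∑ i, d i) → ℂ}
  (hΔ : IsGenericDenominator n d Δ)
include hΔ

theorem regularOn_comp_quotRho {U : Set (genericComp (d := d) Δ)} (hU : IsOpen U)
    {f : genericComp (d := d) Δ → ℂ} (hf : SpaceWithFunctions.RegularOn U f) :
    SpaceWithFunctions.RegularOn (hΔ.quotRho ⁻¹' U) (f ∘ hΔ.quotRho) := by
  classical
  let g : Quotient (permRel n d) → ℂ := fun q =>
    if h : q ∈ genericQuot Δ then f (hΔ.quotRho ⟨q, h⟩) else 0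
  have hg : ∀ q : genericQuot Δ, g q = f (hΔ.quotRho q) := fun q => by
    simp only [g, dif_pos q.2]
  intro q hq
  refine ⟨Subtype.val '' (hΔ.quotRho ⁻¹' U), g,
    hΔ.isOpen_genericQuot.isOpenMap_subtype_val _ (hU.preimage hΔ.continuous_quotRho),
    ⟨q, hq, rfl⟩, ?_, fun z _ _ => (hg z).symm⟩
  rintro v ⟨q', hq', hq'v⟩
  obtain ⟨x, hxv, hx⟩ := mk_mem_genericQuot.1 (hq'v ▸ q'.2)
  obtain ⟨c, a, hc, ha, hca⟩ := proj_eq_iff.1 hxv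
  have hvx : mu n d x.1 = (c * ∏ i, a i) • mu n d v.1 := by rw [hca, mu_scaleVec]
  have hmu0 : mu n d v.1 ≠ 0 := fun h => hΔ.ne_zero _ hx (by rw [hvx, h, smul_zero])
  -- the value of the induced map on the class of a point of the cone
  have hval : ∀ (w : ParamCone n d) (z : genericQuot Δ), z.1 = Quotient.mk _ (ParamSpace.proj n d w) →
      ∃ hw : mu n d w.1 ≠ 0, ((hΔ.quotRho z : LogComponent n d) :
        ProjSpace (ProjForm n (∑ i, d i))) = ProjSpace.proj _ ⟨mu n d w.1, hw⟩ := by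
    rintro w ⟨z, hz⟩ rfl
    have := hΔ.quotRho_mk (mk_mem_genericQuot.1 hz)
    obtain ⟨h1, h2⟩ := coe_rho (x := ⟨_, hΔ.mem_rhoDomain (mk_mem_genericQuot.1 hz)⟩)
      (v := w) rfl
    exact ⟨h1, (congrArg Subtype.val this).trans h2⟩
  obtain ⟨hv0, hv⟩ := hval v q' hq'v
  obtain ⟨O, g', hO, hyO, hg', hfg⟩ := regularOn_subtype_iff.1 hf _ hq'
  rw [hv] at hyO
  obtain ⟨r, hr, hrv, hrO⟩ := projSpace_isOpen_iff.1 hO _ hyO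
  obtain ⟨p, hp, q, hq, hqv, hpq⟩ := hg' _ hyO
  refine ⟨_, comp_mu_mem (Subalgebra.mul_mem _ hp hr), _,
    comp_mu_mem (Subalgebra.mul_mem _ hq hr), mul_ne_zero hqv hrv, fun w hw hqw => ?_⟩
  obtain ⟨z, hz, hzw⟩ := hw
  obtain ⟨hw0, hwv⟩ := hval w z hzw
  have hr0 : r (mu n d w.1) ≠ 0 := right_ne_zero_of_mul hqw
  have hq0 : q (mu n d w.1) ≠ 0 := left_ne_zero_of_mul hqw
  have hwO := hrO ⟨_, hw0⟩ hr0
  change g (Quotient.mk _ (ParamSpace.proj n d w)) = _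
  rw [← hzw, hg, hfg _ hz (hwv ▸ hwO), hwv, hpq ⟨_, hw0⟩ hwO hq0]
  exact (mul_div_mul_right _ _ hr0).symm

theorem regularOn_of_comp_quotRho {U : Set (genericComp (d := d) Δ)} (hU : IsOpen U)
    {f : genericComp (d := d) Δ → ℂ}
    (hf : SpaceWithFunctions.RegularOn (hΔ.quotRho ⁻¹' U) (f ∘ hΔ.quotRho)) :
    SpaceWithFunctions.RegularOn U f := by
  rw [regularOn_subtype_iff]
  intro y hy
  obtain ⟨q, rfl⟩ := hΔ.quotRho_bijective.2 y
  obtain ⟨O, g, hO, hqO, hg, hfg⟩ := hf q hy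
  obtain ⟨v, hv, rfl⟩ := exists_mk_eq q
  -- the invariant open subset of the parameter space on which `f ∘ ρ` is given by `g`
  let U₀ : Set (ParamSpace n d) := Quotient.mk (permRel n d) ⁻¹'
    (O ∩ Subtype.val '' (hΔ.quotRho ⁻¹' U))
  have hO' : IsOpen (O ∩ Subtype.val '' (hΔ.quotRho ⁻¹' U)) :=
    hO.inter (hΔ.isOpen_genericQuot.isOpenMap_subtype_val _ (hU.preimage hΔ.continuous_quotRho))
  have hmk : ∀ (s : degreePerm d) (x : ParamSpace n d),
      Quotient.mk (permRel n d) (s • x) = Quotient.mk _ x := fun s x => Quotient.sound ⟨s, rfl⟩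
  have hgU : SpaceWithFunctions.RegularOn U₀ (g ∘ Quotient.mk (permRel n d)) := fun w hw => by
    obtain ⟨p, hp, q, hq, hqw, hpq⟩ := hg w hw.1
    exact ⟨p, hp, q, hq, hqw, fun u hu => hpq u hu.1⟩
  obtain ⟨p, hp, r, hr, hrv, hrΔ, hrU⟩ := hΔ.exists_descended_fraction
    (hO'.preimage continuous_quotient_mk') (fun s x hx => by
      change Quotient.mk (permRel n d) (s • x) ∈ O ∩ Subtype.val '' (hΔ.quotRho ⁻¹' U)
      rw [hmk]
      exact hx) hgU (fun s x _ => by simp only [Function.comp_apply, hmk]) v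
    ⟨hqO, _, hy, rfl⟩ hv
  obtain ⟨ℓ, hℓ⟩ := exists_dual_eq_one (hΔ.ne_zero _ hv)
  obtain ⟨O₁, g₁, hO₁, hg₁, hmem, hval⟩ := exists_regularOn ℓ hp hr
  refine ⟨O₁, g₁, hO₁, ?_, hg₁, fun z hz hzO => ?_⟩
  · rw [hΔ.coe_quotRho_mk v hv, hmem]
    simp only [hℓ, inv_one, one_smul]
    exact ⟨one_ne_zero, hrv⟩
  · obtain ⟨u, hu⟩ := projSpace_proj_surjective (z : ProjSpace (ProjForm n (∑ i, d i)))
    rw [← hu, hmem] at hzO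
    have hu0 : (ℓ u.1)⁻¹ • u.1 ≠ 0 := hΔ.ne_zero _ (hrΔ _ hzO.2)
    have hu' : ProjSpace.proj _ ⟨_, hu0⟩ = (z : ProjSpace (ProjForm n (∑ i, d i))) :=
      (projSpace_proj_eq_iff.2 ⟨_, inv_ne_zero hzO.1, rfl⟩).trans hu
    obtain ⟨w, hw⟩ := hΔ.exists_mu_eq ⟨_, hu0⟩ (hu' ▸ z.1.2) (hrΔ _ hzO.2)
    obtain ⟨hwU, hwf⟩ := hrU w (hw ▸ hzO.2)
    have hwΔ : Δ (mu n d w.1) ≠ 0 := hw ▸ hrΔ _ hzO.2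
    have hzw : hΔ.quotRho ⟨Quotient.mk _ (ParamSpace.proj n d w),
        mk_mem_genericQuot.2 ⟨w, rfl, hwΔ⟩⟩ = z := by
      refine Subtype.ext (Subtype.ext ?_)
      rw [hΔ.coe_quotRho_mk w hwΔ, ← hu']
      congr 1
      exact Subtype.ext hw
    rw [← hu, hval, ← hzw]
    refine (hfg _ (by rw [Set.mem_preimage, hzw]; exact hz) hwU.1).trans ?_
    change (g ∘ Quotient.mk (permRel n d)) (ParamSpace.proj n d w) = _
    rw [hwf, hw]

/-- The isomorphism between the generic part of the quotient and the generic part of the logarithmic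
component. -/
def iso : Iso (genericQuot (d := d) Δ) (genericComp (d := d) Δ) where
  toHomeomorph := (Equiv.ofBijective _ hΔ.quotRho_bijective).toHomeomorphOfContinuousOpen
    hΔ.continuous_quotRho hΔ.isOpenMap_quotRho
  regularOn_iff _ _ hU := ⟨hΔ.regularOn_comp_quotRho hU, hΔ.regularOn_of_comp_quotRho hU⟩

theorem birationalModPerm : BirationalModPerm n d :=
  ⟨genericQuot Δ, genericComp Δ, hΔ.isOpen_genericQuot, hΔ.dense_genericQuot,
    hΔ.isOpen_genericComp, hΔ.dense_genericComp, hΔ.iso, fun _ hA =>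
      ⟨hΔ.mem_rhoDomain (mk_mem_genericQuot.1 hA), hΔ.quotRho_mk (mk_mem_genericQuot.1 hA)⟩⟩

end IsGenericDenominator

/-! ### Upper bounds for dimensions -/

section UpperBound

open TopologicalSpace

/-- A bound for the dimension of a projective variety by the dimension of its cone. The points of
the cone are given by characters `ev v` of a ring `R`, and `J` is the ideal of the vertex of the
cone; irreducible closed subsets correspond to prime ideals properly contained in `J`. -/
theorem topologicalKrullDim_le_of_cone {X C R : Type*} [TopologicalSpace X] [CommRing R]
    [Algebra ℂ R] {π : C → X} (hπ : Function.Surjective π) (ev : C → R →ₐ[ℂ] ℂ) (J : Ideal R)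
    [J.IsPrime] (h1 : ∀ f, IsOpen {x | ∃ v, π v = x ∧ ev v f ≠ 0})
    (h2 : ∀ v v' f g, π v = π v' → ev v f ≠ 0 → ev v' g ≠ 0 →
      ∃ w, π w = π v ∧ ev w f ≠ 0 ∧ ev w g ≠ 0)
    (h3 : ∀ Z : Set X, IsClosed Z → ∀ v, π v ∉ Z →
      ∃ f, (∀ w, π w ∈ Z → ev w f = 0) ∧ ev v f ≠ 0)
    (h4 : ∀ f ∉ J, ∀ v, ∃ w, π w = π v ∧ ev w f ≠ 0) (h5 : ∀ v, ∃ f ∈ J, ev v f ≠ 0)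
    {D : ℕ} (hR : ringKrullDim R ≤ D + 1) : topologicalKrullDim X ≤ D := by
  cases isEmpty_or_nonempty (IrreducibleCloseds X) with
  | inl h =>
    rw [topologicalKrullDim, Order.krullDim_eq_bot]
    exact bot_le
  | inr h =>
    let I : IrreducibleCloseds X → Ideal R := fun Z =>
      { carrier := {f | ∀ v, π v ∈ (Z : Set X) → ev v f = 0}
        zero_mem' := fun v _ => map_zero _
        add_mem' := fun hf hg v hv => by rw [map_add, hf v hv, hg v hv, add_zero]
        smul_mem' := fun r f hf v hv => by rw [smul_eq_mul, map_mul, hf v hv, mul_zero] }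
    have hI : ∀ Z, (I Z).IsPrime := fun Z => by
      constructor
      · intro h
        obtain ⟨x, hx⟩ := Z.isIrreducible.nonempty
        obtain ⟨v, rfl⟩ := hπ x
        have : (1 : R) ∈ I Z := h ▸ Submodule.mem_top
        exact one_ne_zero ((map_one (ev v)).symm.trans (this v hx))
      · intro f g hfg
        by_contra! hcon
        obtain ⟨hf, hg⟩ := hcon
        obtain ⟨v, hv, hvf⟩ : ∃ v, π v ∈ (Z : Set X) ∧ ev v f ≠ 0 := by
          by_contra! h
          exact hf h
        obtain ⟨v', hv', hvg⟩ : ∃ v, π v ∈ (Z : Set X) ∧ ev v g ≠ 0 := by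
          by_contra! h
          exact hg h
        obtain ⟨x, hxZ, ⟨u, hu, huf⟩, ⟨u', hu', hug⟩⟩ := Z.isIrreducible.isPreirreducible _ _
          (h1 f) (h1 g) ⟨_, hv, v, rfl, hvf⟩ ⟨_, hv', v', rfl, hvg⟩
        obtain ⟨w, hw, hwf, hwg⟩ := h2 u u' f g (hu.trans hu'.symm) huf hug
        refine mul_ne_zero hwf hwg ((map_mul (ev w) f g).symm.trans (hfg w ?_))
        rw [hw, hu]
        exact hxZ
    have hIJ : ∀ Z, I Z < J := fun Z => by
      obtain ⟨x, hx⟩ := Z.isIrreducible.nonempty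
      obtain ⟨v, rfl⟩ := hπ x
      refine lt_of_le_not_ge (fun f hf => ?_) fun h => ?_
      · by_contra hfJ
        obtain ⟨w, hw, hwf⟩ := h4 f hfJ v
        refine hwf (hf w ?_)
        rw [hw]
        exact hx
      · obtain ⟨f, hf, hvf⟩ := h5 v
        exact hvf (h hf v hx)
    have hlt : ∀ Z Z', Z < Z' → I Z' < I Z := fun Z Z' hZ => by
      refine lt_of_le_not_ge (fun f hf v hv => hf v (hZ.le hv)) fun h => hZ.not_ge fun x hx => ?_
      obtain ⟨v, rfl⟩ := hπ x
      by_contra hv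
      obtain ⟨f, hf, hvf⟩ := h3 Z Z.isClosed v hv
      exact hvf (h hf v hx)
    let F : WithTop (IrreducibleCloseds X)ᵒᵈ → PrimeSpectrum R := fun Z =>
      Z.recTopCoe ⟨J, ‹_›⟩ fun Z => ⟨I (OrderDual.ofDual Z), hI _⟩
    have hF : StrictMono F := by
      intro a b hab
      induction b with
      | top =>
        obtain ⟨a, rfl⟩ := WithTop.ne_top_iff_exists.1 hab.ne
        exact hIJ _
      | coe b =>
        obtain ⟨a, rfl⟩ := WithTop.ne_top_iff_exists.1 (hab.trans_le le_top).ne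
        exact hlt _ _ (OrderDual.ofDual_lt_ofDual.2 (WithTop.coe_lt_coe.1 hab))
    have h6 := (Order.krullDim_le_of_strictMono F hF).trans hR
    have : Nonempty (IrreducibleCloseds X)ᵒᵈ := h
    rw [Order.krullDim_WithTop, Order.krullDim_orderDual] at h6
    exact ENat.WithBot.add_le_add_one_right_iff.1 h6

end UpperBound

/-! ### Affine slices of the parameter space -/

section Slice

variable {n m : ℕ} {d : Fin m → ℕ}

/-- The vectors `(λ, G)` with `λ` in a subspace and `Gᵢ` in the kernel of a functional `ℓᵢ`. -/
def Slice (N : Submodule ℂ (Residues d)) (ℓ : ∀ i, Module.Dual ℂ (HomPoly n (d i))) : Type :=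
  N × ∀ i, LinearMap.ker (ℓ i)

instance (N : Submodule ℂ (Residues d)) (ℓ : ∀ i, Module.Dual ℂ (HomPoly n (d i))) :
    AddCommGroup (Slice N ℓ) := inferInstanceAs (AddCommGroup (N × ∀ i, LinearMap.ker (ℓ i)))

instance (N : Submodule ℂ (Residues d)) (ℓ : ∀ i, Module.Dual ℂ (HomPoly n (d i))) :
    Module ℂ (Slice N ℓ) := inferInstanceAs (Module ℂ (N × ∀ i, LinearMap.ker (ℓ i)))

instance (N : Submodule ℂ (Residues d)) (ℓ : ∀ i, Module.Dual ℂ (HomPoly n (d i))) :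
    FiniteDimensional ℂ (Slice N ℓ) :=
  inferInstanceAs (Module.Finite ℂ (N × ∀ i, LinearMap.ker (ℓ i)))

/-- The inclusion of a slice in the space of all `(λ, F)`. -/
def sliceIncl (N : Submodule ℂ (Residues d)) (ℓ : ∀ i, Module.Dual ℂ (HomPoly n (d i))) :
    Slice N ℓ →ₗ[ℂ] ParamVec n d :=
  LinearMap.prodMap N.subtype (LinearMap.pi fun i => (LinearMap.ker (ℓ i)).subtype ∘ₗ
    LinearMap.proj (φ := fun i => LinearMap.ker (ℓ i)) i)

theorem finrank_top_prod {E ι : Type*} {E' : ι → Type*} [AddCommGroup E] [Module ℂ E]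
    [FiniteDimensional ℂ E] [Finite ι] [∀ i, AddCommGroup (E' i)] [∀ i, Module ℂ (E' i)]
    [∀ i, FiniteDimensional ℂ (E' i)] {ℓ₀ : Module.Dual ℂ E} (h : ℓ₀ ≠ 0)
    (ℓ : ∀ i, Module.Dual ℂ (E' i)) :
    Module.finrank ℂ ((⊤ : Submodule ℂ E) × ∀ i, LinearMap.ker (ℓ i)) =
      Module.finrank ℂ (LinearMap.ker ℓ₀ × ∀ i, LinearMap.ker (ℓ i)) + 1 := by
  rw [Module.finrank_prod, Module.finrank_prod, finrank_top,
    ← Module.Dual.finrank_ker_add_one_of_ne_zero h]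
  ring

theorem finrank_slice_top {ℓ₀ : Module.Dual ℂ (Residues d)} (h : ℓ₀ ≠ 0)
    (ℓ : ∀ i, Module.Dual ℂ (HomPoly n (d i))) : Module.finrank ℂ (Slice ⊤ ℓ) =
      Module.finrank ℂ (Slice (LinearMap.ker ℓ₀) ℓ) + 1 :=
  finrank_top_prod h ℓ

theorem polyFun_comp_add_linear {U W : Type*} [AddCommGroup U] [Module ℂ U] [AddCommGroup W]
    [Module ℂ W] {p : W → ℂ} (hp : p ∈ polyFun W) (v : W) (L : U →ₗ[ℂ] W) :
    (fun u => p (v + L u)) ∈ polyFun U := by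
  refine polyFun_comp_mem (fun φ => ?_) hp
  simp only [map_add]
  exact Subalgebra.add_mem _ (const_mem_polyFun (φ v)) (dual_mem_polyFun (φ ∘ₗ L))

/-- The functions of `(λ, F)` that are invariant under the scalings that preserve `μ` are determined
by their restriction to the slice on which the `Fᵢ` are normalised. -/
theorem ringKrullDim_le_of_invariant {R : Type*} [CommRing R] [Algebra ℂ R] [Nontrivial R]
    [Algebra.FiniteType ℂ R] (ι : R →ₐ[ℂ] polyFun (ParamVec n d)) (hι : Function.Injective ι)
    (hinv : ∀ f (c : ℂ) (a : Fin m → ℂ) w, c * ∏ i, a i = 1 →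
      (ι f).1 (scaleVec c a w) = (ι f).1 w)
    {ℓ : ∀ i, Module.Dual ℂ (HomPoly n (d i))} {F : ∀ i, HomPoly n (d i)}
    (hF : ∀ i, ℓ i (F i) = 1) : ringKrullDim R ≤ Module.finrank ℂ (Slice (n := n) (d := d) ⊤ ℓ) := by
  let r : polyFun (ParamVec n d) →ₐ[ℂ] polyFun (Slice (n := n) (d := d) ⊤ ℓ) :=
    { toFun := fun p => ⟨_, polyFun_comp_add_linear p.2 (0, F) (sliceIncl ⊤ ℓ)⟩
      map_one' := rfl
      map_mul' := fun _ _ => rfl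
      map_zero' := rfl
      map_add' := fun _ _ => rfl
      commutes' := fun _ => rfl }
  have hr : Function.Injective (r.comp ι) := by
    rw [injective_iff_map_eq_zero]
    intro f hf
    refine (map_eq_zero_iff ι hι).1 ?_
    -- `f` vanishes where all `ℓᵢ(Fᵢ)` are non-zero, which is a dense set
    have hvan : ∀ w : ParamVec n d, (∀ i, ℓ i (w.2 i) ≠ 0) → (ι f).1 w = 0 := fun w hw => by
      have hprod : ∏ i, ℓ i (w.2 i) ≠ 0 := Finset.prod_ne_zero_iff.2 fun i _ => hw i
      have h1 := hinv f (∏ i, ℓ i (w.2 i)) (fun i => (ℓ i (w.2 i))⁻¹) w (by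
        rw [Finset.prod_inv_distrib, mul_inv_cancel₀ hprod])
      let u : Slice (n := n) (d := d) ⊤ ℓ := (⟨(∏ i, ℓ i (w.2 i)) • w.1, trivial⟩,
        fun i => ⟨(ℓ i (w.2 i))⁻¹ • w.2 i - F i, by
          rw [LinearMap.mem_ker, map_sub, map_smul, smul_eq_mul, inv_mul_cancel₀ (hw i), hF,
            sub_self]⟩)
      have hu : (0, F) + sliceIncl ⊤ ℓ u =
          scaleVec (∏ i, ℓ i (w.2 i)) (fun i => (ℓ i (w.2 i))⁻¹) w :=
        Prod.ext (zero_add _) (funext fun i => add_sub_cancel (F i) _)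
      rw [← h1, ← hu]
      exact congrFun (congrArg Subtype.val hf) u
    by_contra h
    obtain ⟨w, hw⟩ : ∃ w, (ι f).1 w ≠ 0 := by
      by_contra! h'
      exact h (Subtype.ext (funext h'))
    have hℓ : (∏ i, fun w : ParamVec n d => ℓ i (w.2 i)) ∈ polyFun (ParamVec n d) :=
      Subalgebra.prod_mem _ fun i _ => dual_mem_polyFun (W := ParamVec n d) (ℓ i ∘ₗ
        LinearMap.proj (φ := fun i => HomPoly n (d i)) i ∘ₗ LinearMap.snd ℂ _ _)
    obtain ⟨w', hw', hw'ℓ⟩ := polyFun_mul_ne_zero (ι f).2 hℓ ⟨w, hw⟩ ⟨(0, F), by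
      simp [Finset.prod_apply, hF]⟩
    rw [Finset.prod_apply] at hw'ℓ
    exact hw' (hvan w' fun i => Finset.prod_ne_zero_iff.1 hw'ℓ i (Finset.mem_univ i))
  have := ringKrullDim_le_of_injective
    ((polyFunEquiv (Slice (n := n) (d := d) ⊤ ℓ)).symm.toAlgHom.comp (r.comp ι))
    ((polyFunEquiv _).symm.injective.comp hr)
  exact this

/-- Two non-empty open conditions hold together at some non-zero parameter of a polynomial curve. -/
theorem exists_ne_zero_of_curve {W : Type*} [AddCommGroup W] [Module ℂ W] {p q : W → ℂ}
    (hp : p ∈ polyFun W) (hq : q ∈ polyFun W) {γ : ℂ → W}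
    (hγ : ∀ φ : Module.Dual ℂ W, (fun t => φ (γ t)) ∈ polyFun ℂ) {s t : ℂ} (hs : p (γ s) ≠ 0)
    (ht : q (γ t) ≠ 0) : ∃ u : ℂ, u ≠ 0 ∧ p (γ u) ≠ 0 ∧ q (γ u) ≠ 0 := by
  have hp' := polyFun_comp_mem hγ hp
  have hq' := polyFun_comp_mem hγ hq
  obtain ⟨u, hu⟩ := polyFun_mul_ne_zero hp' hq' ⟨s, hs⟩ ⟨t, ht⟩
  obtain ⟨u', hu', hu1⟩ := polyFun_mul_ne_zero (Subalgebra.mul_mem _ hp' hq')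
    (dual_mem_polyFun (LinearMap.id (R := ℂ) (M := ℂ))) ⟨u, mul_ne_zero hu.1 hu.2⟩
    ⟨1, one_ne_zero⟩
  exact ⟨u', hu1, left_ne_zero_of_mul hu', right_ne_zero_of_mul hu'⟩

theorem line_mem_polyFun {W : Type*} [AddCommGroup W] [Module ℂ W] (a b : W)
    (φ : Module.Dual ℂ W) : (fun t : ℂ => φ (t • a + b)) ∈ polyFun ℂ := by
  simp only [map_add, map_smul]
  exact Subalgebra.add_mem _ (dual_mem_polyFun ((LinearMap.id (R := ℂ) (M := ℂ)).smulRight (φ a)))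
    (const_mem_polyFun (φ b))

theorem smul_mem_polyFun {W : Type*} [AddCommGroup W] [Module ℂ W] (a : W)
    (φ : Module.Dual ℂ W) : (fun t : ℂ => φ (t • a)) ∈ polyFun ℂ := by
  simpa using line_mem_polyFun a 0 φ

theorem scaleVec_one_eq (t : ℂ) (v : ParamVec n d) : scaleVec t 1 v = t • (v.1, 0) + (0, v.2) := by
  refine Prod.ext ?_ (funext fun i => ?_) <;> simp [scaleVec]

/-- The evaluation of the Segre algebra at a vector. -/
def segreEval (w : ParamVec n d) : segreAlg n d →ₐ[ℂ] ℂ :=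
  (evalAt w).comp (Subalgebra.inclusion segreAlg_le)

theorem isOpen_setOf_segreAlg_ne_zero {f : ParamVec n d → ℂ} (hf : f ∈ segreAlg n d) :
    IsOpen {x | ∃ v : ParamCone n d, ParamSpace.proj n d v = x ∧ f v.1 ≠ 0} := by
  rw [paramSpace_isOpen_iff]
  rintro v ⟨w, hwv, hw⟩
  obtain ⟨c, a, hc, ha, hca⟩ := proj_eq_iff.1 hwv
  let L : ParamVec n d →ₗ[ℂ] ParamVec n d := LinearMap.prodMap (c • LinearMap.id)
    (LinearMap.pi fun i => a i • LinearMap.proj (φ := fun i => HomPoly n (d i)) i)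
  refine ⟨fun u => f (scaleVec c a u), polyFun_comp_mem (fun φ => dual_mem_polyFun (φ ∘ₗ L))
    (segreAlg_le hf), by simpa only [← hca] using hw, fun u hu => ?_⟩
  exact ⟨⟨_, scaleVec_mem hc ha u.2⟩, proj_eq_iff.2 ⟨c, a, hc, ha, rfl⟩, hu⟩

theorem scaleVec_scaleVec (c c' : ℂ) (a a' : Fin m → ℂ) (v : ParamVec n d) :
    scaleVec c a (scaleVec c' a' v) = scaleVec (c * c') (a * a') v :=
  Prod.ext (smul_smul _ _ _) (funext fun _ => smul_smul _ _ _)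

/-- The bound comes from the prime ideals of the Segre algebra. -/
theorem topologicalKrullDim_paramSpace_le {v : ParamVec n d} {ℓ₀ : Module.Dual ℂ (Residues d)}
    (hv₀ : ℓ₀ v.1 = 1) {ℓ : ∀ i, Module.Dual ℂ (HomPoly n (d i))} (hv : ∀ i, ℓ i (v.2 i) = 1) :
    topologicalKrullDim (ParamSpace n d) ≤
      Module.finrank ℂ (Slice (LinearMap.ker ℓ₀) ℓ) := by
  have hℓ₀ : ℓ₀ ≠ 0 := fun h => by simp [h] at hv₀
  have hprime : (RingHom.ker (segreEval (0 : ParamVec n d))).IsPrime := RingHom.ker_isPrime _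
  have hinv : ∀ (f : segreAlg n d) (c : ℂ) (a : Fin m → ℂ) w, c * ∏ i, a i = 1 →
      f.1 (scaleVec c a w) = f.1 w := fun f c a w h => segreAlg_scaleVec f.2 h w
  refine topologicalKrullDim_le_of_cone (C := ParamCone n d) paramSpace_proj_surjective
    (fun v => segreEval v.1) (RingHom.ker (segreEval (0 : ParamVec n d)))
    (fun f => isOpen_setOf_segreAlg_ne_zero f.2) (fun v v' f g h hf hg => ?_)
    (fun Z hZ v hv => ?_) (fun f hf v => ?_) (fun v => ?_) ?_
  · obtain ⟨c, a, hc, ha, hca⟩ := proj_eq_iff.1 h.symm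
    have hprod : ∏ i, a i ≠ 0 := Finset.prod_ne_zero_iff.2 fun i _ => ha i
    -- the function `g` has the same value at `v'` and at a rescaling of the first entry of `v`
    have hg' : g.1 (scaleVec (c * ∏ i, a i) 1 v.1) ≠ 0 := by
      rw [← segreAlg_scaleVec g.2 (c := (∏ i, a i)⁻¹) (a := a) (inv_mul_cancel₀ hprod),
        scaleVec_scaleVec, mul_one, mul_left_comm, inv_mul_cancel₀ hprod, mul_one, ← hca]
      exact hg
    have hf' : f.1 (scaleVec 1 1 v.1) ≠ 0 := by
      have : scaleVec 1 1 v.1 = v.1 := Prod.ext (one_smul _ _) (funext fun _ => one_smul _ _)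
      rw [this]
      exact hf
    obtain ⟨u, hu0, huf, hug⟩ := exists_ne_zero_of_curve (γ := fun t => scaleVec t 1 v.1)
      (segreAlg_le f.2) (segreAlg_le g.2) (fun φ => by
        simp only [scaleVec_one_eq]
        exact line_mem_polyFun _ _ φ) hf' hg'
    exact ⟨⟨_, scaleVec_one_mem hu0 v⟩, proj_scaleVec_one hu0 v, huf, hug⟩
  · obtain ⟨p, hp, hpv, hpZ⟩ := paramSpace_isOpen_iff.1 hZ.isOpen_compl v hv
    obtain ⟨z, hz, r, hzv, hrv, hr, hpoly⟩ := exists_normalisation v.2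
    obtain ⟨N, q, hq, hqw⟩ := hpoly p hp
    refine ⟨⟨z * q, Subalgebra.mul_mem _ hz hq⟩, fun w hw => ?_, ?_⟩
    · change z w.1 * q w.1 = 0
      by_cases h : z w.1 = 0
      · rw [h, zero_mul]
      · obtain ⟨c, a, hc, ha, h'⟩ := hr w.1 h
        have : p (r w.1) = 0 := by
          by_contra h0
          refine hpZ ⟨r w.1, h' ▸ scaleVec_mem hc ha w.2⟩ h0 ?_
          rwa [proj_eq_iff.2 ⟨c, a, hc, ha, h'⟩]
        rw [hqw _ h, this, mul_zero, mul_zero]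
    · change z v.1 * q v.1 ≠ 0
      have h0 : z v.1 ≠ 0 := by rw [hzv]; exact one_ne_zero
      rw [hqw _ h0, hzv, hrv, one_pow, one_mul, one_mul]
      exact hpv
  · have hf0 : f.1 ((0 : ℂ) • v.1) ≠ 0 := by
      rw [zero_smul]
      exact hf
    obtain ⟨u, hu0, huf, -⟩ := exists_ne_zero_of_curve (γ := fun t => t • v.1) (segreAlg_le f.2)
      (segreAlg_le f.2) (smul_mem_polyFun v.1) hf0 hf0
    exact ⟨⟨u • v.1, scaleVec_mem (a := fun _ => u) hu0 (fun _ => hu0) v.2⟩,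
      proj_eq_iff.2 ⟨u, fun _ => u, hu0, fun _ => hu0, rfl⟩, huf⟩
  · obtain ⟨κ₀, h₀⟩ := exists_dual_eq_one v.2.1
    choose κ hκ using fun i => exists_dual_eq_one (v.2.2 i)
    refine ⟨⟨_, segreFun_mem κ₀ κ⟩, ?_, ?_⟩
    · change segreFun κ₀ κ 0 = 0
      simp [segreFun]
    · change segreFun κ₀ κ v.1 ≠ 0
      simp [segreFun, h₀, hκ]
  · refine (ringKrullDim_le_of_invariant (Subalgebra.inclusion segreAlg_le)
      (Subalgebra.inclusion_injective _) (fun f c a w h => hinv f c a w h) hv).trans ?_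
    rw [finrank_slice_top hℓ₀]
    simp

/-- The bound comes from the prime ideals of the coordinate ring of the closure of the image of `μ`,
realised as the ring of the functions `p ∘ μ`. The points of this closure are evaluated by the
characters of `exists_character`, as they need not be values of `μ`. -/
theorem topologicalKrullDim_logComponent_le {v : ParamVec n d} {ℓ₀ : Module.Dual ℂ (Residues d)}
    (hv₀ : ℓ₀ v.1 = 1) {ℓ : ∀ i, Module.Dual ℂ (HomPoly n (d i))} (hv : ∀ i, ℓ i (v.2 i) = 1) :
    topologicalKrullDim (LogComponent n d) ≤
      Module.finrank ℂ (Slice (LinearMap.ker ℓ₀) ℓ) := by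
  have hℓ₀ : ℓ₀ ≠ 0 := fun h => by simp [h] at hv₀
  let C := {y : {y : ProjForm n (∑ i, d i) // y ≠ 0} // ProjSpace.proj _ y ∈ LogComponent n d}
  choose ev hev using fun y : C => exists_character (y := y.1.1) fun p hp h =>
    eq_zero_of_mem_logComponent y.2 hp h
  have hmu0 : mu n d 0 = 0 := by
    by_contra h
    exact (mem_paramCone_of_mu_ne_zero h).1 rfl
  obtain ⟨ev₀, hev₀⟩ := exists_character (n := n) (d := d) (y := 0) fun p _ h => hmu0 ▸ h 0
  let J : Ideal (muPull n d).range := RingHom.ker ev₀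
  have hJ : J.IsPrime := RingHom.ker_isPrime _
  have hsurj := (muPull n d).rangeRestrict_surjective
  have : Algebra.FiniteType ℂ (muPull n d).range := Algebra.FiniteType.of_surjective _ hsurj
  have hscale : ∀ (y : C) {u : ℂ} (hu : u ≠ 0), ∃ w : C, w.1.1 = u • y.1.1 ∧
      (⟨_, w.2⟩ : LogComponent n d) = ⟨_, y.2⟩ := fun y u hu => by
    have h : ProjSpace.proj _ ⟨u • y.1.1, smul_ne_zero hu y.1.2⟩ = ProjSpace.proj _ y.1 :=
      projSpace_proj_eq_iff.2 ⟨u, hu, rfl⟩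
    exact ⟨⟨⟨u • y.1.1, smul_ne_zero hu y.1.2⟩, h ▸ y.2⟩, rfl, Subtype.ext h⟩
  refine topologicalKrullDim_le_of_cone (C := C) (R := (muPull n d).range) (π := fun y => ⟨_, y.2⟩) (fun y => ?_) ev
    J (fun f => ?_) (fun v v' f g h hf hg => ?_) (fun Z hZ v hv => ?_)
    (fun f hf v => ?_) (fun v => ?_) ?_
  · obtain ⟨v, hv⟩ := projSpace_proj_surjective y.1
    exact ⟨⟨v, hv ▸ y.2⟩, Subtype.ext hv⟩
  · obtain ⟨p, rfl⟩ := hsurj f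
    convert (isOpen_nonvanishing p.2).preimage
      (continuous_subtype_val (p := (· ∈ LogComponent n d))) using 1
    ext y
    constructor
    · rintro ⟨v, rfl, hv⟩
      exact ⟨v.1, rfl, by rwa [← hev]⟩
    · rintro ⟨v, hvy, hv⟩
      exact ⟨⟨v, hvy ▸ y.2⟩, Subtype.ext hvy, by rwa [hev]⟩
  · obtain ⟨p, rfl⟩ := hsurj f
    obtain ⟨q, rfl⟩ := hsurj g
    rw [hev] at hf hg
    obtain ⟨c, hc, hcv⟩ := projSpace_proj_eq_iff.1 (congrArg Subtype.val h.symm)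
    rw [hcv] at hg
    rw [← one_smul ℂ v.1.1] at hf
    obtain ⟨u, hu0, huf, hug⟩ := exists_ne_zero_of_curve (γ := fun t => t • v.1.1) p.2 q.2
      (smul_mem_polyFun _) hf hg
    obtain ⟨w, hw, hwv⟩ := hscale v hu0
    exact ⟨w, hwv, by rwa [hev, hw], by rwa [hev, hw]⟩
  · obtain ⟨O, hO, hOZ⟩ := isOpen_induced_iff.1 hZ.isOpen_compl
    have hmem : ∀ w : C, ProjSpace.proj _ w.1 ∈ O ↔ (⟨_, w.2⟩ : LogComponent n d) ∉ Z := fun w => by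
      rw [← Set.mem_compl_iff, ← hOZ]
      rfl
    obtain ⟨p, hp, hpv, hpO⟩ := projSpace_isOpen_iff.1 hO v.1 ((hmem v).2 hv)
    refine ⟨(muPull n d).rangeRestrict ⟨p, hp⟩, fun w hw => ?_, by rwa [hev]⟩
    rw [hev]
    by_contra h
    exact (hmem w).1 (hpO w.1 h) hw
  · obtain ⟨p, rfl⟩ := hsurj f
    have hf0 : p.1 ((0 : ℂ) • v.1.1) ≠ 0 := by
      rw [zero_smul, ← hev₀]
      exact hf
    obtain ⟨u, hu0, huf, -⟩ := exists_ne_zero_of_curve (γ := fun t => t • v.1.1) p.2 p.2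
      (smul_mem_polyFun _) hf0 hf0
    obtain ⟨w, hw, hwv⟩ := hscale v hu0
    exact ⟨w, hwv, by rwa [hev, hw]⟩
  · obtain ⟨φ, hφ⟩ := exists_dual_eq_one v.1.2
    refine ⟨(muPull n d).rangeRestrict ⟨_, dual_mem_polyFun φ⟩, ?_, ?_⟩
    · rw [RingHom.mem_ker]
      exact (hev₀ _).trans (map_zero φ)
    · rw [hev]
      change φ v.1.1 ≠ 0
      rw [hφ]
      exact one_ne_zero
  · refine (ringKrullDim_le_of_invariant (Subalgebra.val _) Subtype.val_injective
      (fun f c a w h => ?_) hv).trans ?_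
    · obtain ⟨p, rfl⟩ := hsurj f
      change p.1 (mu n d (scaleVec c a w)) = p.1 (mu n d w)
      rw [mu_scaleVec, h, one_smul]
    · rw [finrank_slice_top hℓ₀]
      simp

end Slice

/-! ### Lower bounds for dimensions -/

section Quotient

open TopologicalSpace
open scoped Pointwise

/-- The quotient by a finite group preserves strict inclusions of irreducible closed sets: if two
such sets `Z ⊆ Z'` have the same image, then `Z'` is contained in a translate of `Z`, and iteration
of the translation shows that they are equal. -/
theorem strictMono_map_quotient {G X : Type*} [Group G] [Finite G] [TopologicalSpace X]
    [MulAction G X] [ContinuousConstSMul G X] :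
    StrictMono (IrreducibleCloseds.map (Quotient.mk (MulAction.orbitRel G X))
      continuous_quotient_mk') := by
  intro Z Z' hZ
  refine lt_of_le_not_ge (IrreducibleCloseds.map_mono _ hZ.le) fun h => hZ.not_ge ?_
  have hpre : Quotient.mk (MulAction.orbitRel G X) ⁻¹'
      (Quotient.mk (MulAction.orbitRel G X) '' (Z : Set X)) = ⋃ g : G, g • (Z : Set X) := by
    ext x
    simp only [Set.mem_preimage, Set.mem_image, Set.mem_iUnion, Set.mem_smul_set]
    constructor
    · rintro ⟨y, hy, hyx⟩
      obtain ⟨g, hg⟩ := Quotient.exact hyx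
      exact ⟨g⁻¹, y, hy, by rw [← hg]; exact inv_smul_smul g x⟩
    · rintro ⟨g, y, hy, rfl⟩
      exact ⟨y, hy, (Quotient.sound ⟨g, rfl⟩ : Quotient.mk (MulAction.orbitRel G X) _ = _).symm⟩
  have hclosed : IsClosed (Quotient.mk (MulAction.orbitRel G X) '' (Z : Set X)) := by
    refine (isQuotientMap_quotient_mk' (s := MulAction.orbitRel G X)).isClosed_preimage.1 ?_
    refine hpre ▸ isClosed_iUnion_of_finite fun g => ?_
    exact Z.isClosed.smul g
  have hcover : (Z' : Set X) ⊆ ⋃₀ Set.range fun g : G => g • (Z : Set X) := fun x hx => by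
    rw [Set.sUnion_range, ← hpre]
    have : Quotient.mk (MulAction.orbitRel G X) x ∈
        closure (Quotient.mk (MulAction.orbitRel G X) '' (Z : Set X)) :=
      h (subset_closure ⟨x, hx, rfl⟩)
    rwa [hclosed.closure_eq] at this
  obtain ⟨_, hg, hZ'⟩ := isIrreducible_iff_sUnion_isClosed.1 Z'.isIrreducible
    (Set.finite_range fun g : G => g • (Z : Set X)).toFinset (fun z hz => by
      obtain ⟨g, rfl⟩ := (Set.Finite.mem_toFinset _).1 hz
      exact Z.isClosed.smul g) (by rwa [Set.Finite.coe_toFinset])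
  obtain ⟨g, rfl⟩ := (Set.Finite.mem_toFinset _).1 hg
  have h1 : (Z : Set X) ⊆ g • (Z : Set X) := fun x hx => hZ' (hZ.le hx)
  have h2 : ∀ k : ℕ, g • (Z : Set X) ⊆ g ^ (k + 1) • (Z : Set X) := fun k => by
    induction k with
    | zero => rw [zero_add, pow_one]
    | succ k ih =>
      refine ih.trans ?_
      rw [pow_succ g (k + 1), mul_smul]
      exact Set.smul_set_mono h1
  have h3 : g • (Z : Set X) ⊆ Z := by
    have := h2 (orderOf g - 1)
    rwa [Nat.sub_add_cancel (orderOf_pos g), pow_orderOf_eq_one, one_smul] at this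
  exact fun x hx => h3 (hZ' hx)

end Quotient

section Affine

variable {U W : Type*} [AddCommGroup U] [Module ℂ U] [AddCommGroup W] [Module ℂ W]

theorem exists_mem_forall_ne_zero [FiniteDimensional ℂ U] (E : Submodule ℂ U) (L : U →ₗ[ℂ] W) (v : W) {p q : W → ℂ}
    (hp : p ∈ polyFun W) (hq : q ∈ polyFun W) (hpE : ∃ u ∈ E, p (v + L u) ≠ 0)
    (hqE : ∃ u ∈ E, q (v + L u) ≠ 0) : ∃ u ∈ E, p (v + L u) ≠ 0 ∧ q (v + L u) ≠ 0 := by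
  obtain ⟨u₁, hu₁, h₁⟩ := hpE
  obtain ⟨u₂, hu₂, h₂⟩ := hqE
  obtain ⟨u, hu⟩ := polyFun_mul_ne_zero (polyFun_comp_add_linear hp v (L ∘ₗ E.subtype))
    (polyFun_comp_add_linear hq v (L ∘ₗ E.subtype)) ⟨⟨u₁, hu₁⟩, h₁⟩ ⟨⟨u₂, hu₂⟩, h₂⟩
  exact ⟨u.1, u.2, hu⟩

theorem exists_polyFun_separating {E : Submodule ℂ U} {e : U} (he : e ∉ E) {L : U →ₗ[ℂ] W}
    (hL : Function.Injective L) (v : W) :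
    ∃ p ∈ polyFun W, p (v + L e) ≠ 0 ∧ ∀ u ∈ E, p (v + L u) = 0 := by
  obtain ⟨φ, hφe, hφE⟩ := Submodule.exists_le_ker_of_notMem he
  obtain ⟨g, hg⟩ := L.exists_leftInverse_of_injective (LinearMap.ker_eq_bot.2 hL)
  have hval : ∀ u, φ (g (v + L u)) - φ (g v) = φ u := fun u => by
    rw [map_add, map_add, add_sub_cancel_left]
    exact congrArg φ (LinearMap.congr_fun hg u)
  refine ⟨fun w => φ (g w) - φ (g v), Subalgebra.sub_mem _ (dual_mem_polyFun (φ ∘ₗ g))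
    (const_mem_polyFun _), ?_, fun u hu => ?_⟩
  · exact fun h => hφe ((hval e).symm.trans h)
  · exact (hval u).trans (hφE hu)

theorem krullDim_submodule (U : Type*) [AddCommGroup U] [Module ℂ U] [FiniteDimensional ℂ U] :
    Order.krullDim (Submodule ℂ U) = Module.finrank ℂ U := by
  rw [← Module.coe_length, Module.length_eq_finrank]
  rfl

end Affine

section LowerBound

open TopologicalSpace

variable {n m : ℕ} {d : Fin m → ℕ} {v : ParamVec n d} {ℓ₀ : Module.Dual ℂ (Residues d)}
  {ℓ : ∀ i, Module.Dual ℂ (HomPoly n (d i))}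

theorem residues_functional_add (hv₀ : ℓ₀ v.1 = 1) (u : Slice (LinearMap.ker ℓ₀) ℓ) :
    ℓ₀ (v + sliceIncl _ ℓ u).1 = 1 := by
  change ℓ₀ (v.1 + u.1.1) = 1
  rw [map_add, hv₀, LinearMap.mem_ker.1 u.1.2, add_zero]

theorem factor_functional_add (hv : ∀ i, ℓ i (v.2 i) = 1) (u : Slice (LinearMap.ker ℓ₀) ℓ)
    (i : Fin m) : ℓ i ((v + sliceIncl _ ℓ u).2 i) = 1 := by
  change ℓ i (v.2 i + (u.2 i).1) = 1
  rw [map_add, hv, LinearMap.mem_ker.1 (u.2 i).2, add_zero]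

theorem add_sliceIncl_mem (hv₀ : ℓ₀ v.1 = 1) (hv : ∀ i, ℓ i (v.2 i) = 1)
    (u : Slice (LinearMap.ker ℓ₀) ℓ) : v + sliceIncl _ ℓ u ∈ ParamCone n d := by
  refine ⟨fun h => ?_, fun i h => ?_⟩
  · have := residues_functional_add (ℓ := ℓ) hv₀ u
    rw [h, map_zero] at this
    exact zero_ne_one this
  · have := factor_functional_add hv u i
    rw [h, map_zero] at this
    exact zero_ne_one this

/-- The chart of the parameter space given by the slice on which all coordinates are normalised. -/
def chart (hv₀ : ℓ₀ v.1 = 1) (hv : ∀ i, ℓ i (v.2 i) = 1) (u : Slice (LinearMap.ker ℓ₀) ℓ) :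
    ParamSpace n d := ParamSpace.proj n d ⟨_, add_sliceIncl_mem hv₀ hv u⟩

theorem isIrreducible_image_chart (hv₀ : ℓ₀ v.1 = 1) (hv : ∀ i, ℓ i (v.2 i) = 1)
    (E : Submodule ℂ (Slice (LinearMap.ker ℓ₀) ℓ)) : IsIrreducible (chart hv₀ hv '' E) := by
  refine ⟨⟨_, 0, E.zero_mem, rfl⟩, ?_⟩
  rintro O₁ O₂ hO₁ hO₂ ⟨_, ⟨u₁, hu₁, rfl⟩, h₁⟩ ⟨_, ⟨u₂, hu₂, rfl⟩, h₂⟩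
  obtain ⟨p₁, hp₁, hp₁u, hp₁O⟩ := paramSpace_isOpen_iff.1 hO₁ _ h₁
  obtain ⟨p₂, hp₂, hp₂u, hp₂O⟩ := paramSpace_isOpen_iff.1 hO₂ _ h₂
  obtain ⟨u, huE, hu, hu'⟩ := exists_mem_forall_ne_zero E (sliceIncl _ ℓ) v hp₁ hp₂
    ⟨u₁, hu₁, hp₁u⟩ ⟨u₂, hu₂, hp₂u⟩
  exact ⟨_, ⟨u, huE, rfl⟩, hp₁O ⟨_, add_sliceIncl_mem hv₀ hv u⟩ hu,
    hp₂O ⟨_, add_sliceIncl_mem hv₀ hv u⟩ hu'⟩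

theorem sliceIncl_injective (N : Submodule ℂ (Residues d)) :
    Function.Injective (sliceIncl N ℓ) := fun _ _ h =>
  Prod.ext (Subtype.ext (congrArg Prod.fst h))
    (funext fun i => Subtype.ext (congrFun (congrArg Prod.snd h) i))

/-- An affine equation that separates `e` from `E` extends to an element of the Segre algebra, hence to a
closed subset of the parameter space. -/
theorem chart_notMem_closure (hv₀ : ℓ₀ v.1 = 1) (hv : ∀ i, ℓ i (v.2 i) = 1)
    {E : Submodule ℂ (Slice (LinearMap.ker ℓ₀) ℓ)} {e : Slice (LinearMap.ker ℓ₀) ℓ} (he : e ∉ E) :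
    chart hv₀ hv e ∉ closure (chart hv₀ hv '' E) := by
  obtain ⟨p, hp, hpe, hpE⟩ := exists_polyFun_separating he
    (L := sliceIncl (LinearMap.ker ℓ₀) ℓ) (sliceIncl_injective _) v
  obtain ⟨N, q, hq, hqw⟩ := exists_eq_pow_mul ℓ₀ ℓ hp
  -- the vectors of the slice are normalised, and a multiple of such a vector is normalised to it
  have hnorm : ∀ (u : Slice (LinearMap.ker ℓ₀) ℓ) (c : ℂ) (a : Fin m → ℂ), c ≠ 0 → (∀ i, a i ≠ 0) →
      ∃ k : ℂ, k ≠ 0 ∧ q (scaleVec c a (v + sliceIncl _ ℓ u)) = k * p (v + sliceIncl _ ℓ u) :=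
    fun u c a hc ha => by
      have h₀ : ℓ₀ (scaleVec c a (v + sliceIncl _ ℓ u)).1 = c := by
        change ℓ₀ (c • (v + sliceIncl _ ℓ u).1) = c
        rw [map_smul, residues_functional_add hv₀, smul_eq_mul, mul_one]
      have hi : ∀ i, ℓ i ((scaleVec c a (v + sliceIncl _ ℓ u)).2 i) = a i := fun i => by
        change ℓ i (a i • (v + sliceIncl _ ℓ u).2 i) = a i
        rw [map_smul, factor_functional_add hv, smul_eq_mul, mul_one]
      have hz : segreFun ℓ₀ ℓ (scaleVec c a (v + sliceIncl _ ℓ u)) ≠ 0 :=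
        segreFun_ne_zero_iff.2 ⟨by rwa [h₀], fun i => by rw [hi]; exact ha i⟩
      refine ⟨_, pow_ne_zero N hz, ?_⟩
      rw [hqw _ hz, h₀]
      simp only [hi]
      rw [scaleVec_scaleVec, inv_mul_cancel₀ hc, show (fun i => (a i)⁻¹) * a = 1 from
        funext fun i => inv_mul_cancel₀ (ha i)]
      congr 2
      exact Prod.ext (one_smul _ _) (funext fun _ => one_smul _ _)
  intro h
  obtain ⟨_, ⟨w, hw, hqw'⟩, ⟨u, hu, rfl⟩⟩ := mem_closure_iff.1 h _
    (isOpen_setOf_segreAlg_ne_zero hq) (by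
      obtain ⟨k, hk, hke⟩ := hnorm e 1 1 one_ne_zero fun _ => one_ne_zero
      let w : ParamCone n d := ⟨_, add_sliceIncl_mem hv₀ hv e⟩
      refine ⟨⟨_, scaleVec_one_mem one_ne_zero w⟩, proj_scaleVec_one one_ne_zero w, ?_⟩
      change q (scaleVec 1 1 (v + sliceIncl _ ℓ e)) ≠ 0
      rw [hke]
      exact mul_ne_zero hk hpe)
  obtain ⟨c, a, hc, ha, hca⟩ := proj_eq_iff.1 hw
  obtain ⟨k, -, hku⟩ := hnorm u c a hc ha
  refine hqw' ?_
  rw [hca, hku, hpE u hu, mul_zero]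

/-- Closures of linear subspaces of a chart. -/
def chartClosure (hv₀ : ℓ₀ v.1 = 1) (hv : ∀ i, ℓ i (v.2 i) = 1)
    (E : Submodule ℂ (Slice (LinearMap.ker ℓ₀) ℓ)) : IrreducibleCloseds (ParamSpace n d) where
  carrier := closure (chart hv₀ hv '' E)
  isIrreducible' := (isIrreducible_image_chart hv₀ hv E).closure
  isClosed' := isClosed_closure

theorem strictMono_chartClosure (hv₀ : ℓ₀ v.1 = 1) (hv : ∀ i, ℓ i (v.2 i) = 1) :
    StrictMono (chartClosure (ℓ₀ := ℓ₀) hv₀ hv) := by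
  intro E E' h
  refine lt_of_le_not_ge (closure_mono (Set.image_mono h.le)) fun h' => ?_
  obtain ⟨e, he', he⟩ := SetLike.exists_of_lt h
  exact chart_notMem_closure hv₀ hv he (h' (subset_closure ⟨e, he', rfl⟩))

theorem finrank_le_topologicalKrullDim_paramSpace (hv₀ : ℓ₀ v.1 = 1)
    (hv : ∀ i, ℓ i (v.2 i) = 1) : Module.finrank ℂ (Slice (LinearMap.ker ℓ₀) ℓ) ≤
      topologicalKrullDim (ParamSpace n d) := by
  refine (krullDim_submodule (Slice (LinearMap.ker ℓ₀) ℓ)).ge.trans ?_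
  exact Order.krullDim_le_of_strictMono _ (strictMono_chartClosure hv₀ hv)

/-- The members of the flags all pass through the origin of the chart, so that they meet every open
set which contains the class of this point. -/
theorem finrank_le_topologicalKrullDim_of_isOpen (hv₀ : ℓ₀ v.1 = 1) (hv : ∀ i, ℓ i (v.2 i) = 1)
    {A : Set (Quotient (permRel n d))} (hA : IsOpen A)
    (hvA : Quotient.mk (permRel n d) (chart (ℓ₀ := ℓ₀) hv₀ hv 0) ∈ A) :
    Module.finrank ℂ (Slice (LinearMap.ker ℓ₀) ℓ) ≤ topologicalKrullDim A := by
  refine (krullDim_submodule (Slice (LinearMap.ker ℓ₀) ℓ)).ge.trans ?_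
  let F : Submodule ℂ (Slice (LinearMap.ker ℓ₀) ℓ) →
      {Z : IrreducibleCloseds (Quotient (permRel n d)) |
        ((Subtype.val : A → Quotient (permRel n d)) ⁻¹' (Z : Set _)).Nonempty} := fun E =>
    ⟨IrreducibleCloseds.map _ continuous_quotient_mk' (chartClosure hv₀ hv E),
      ⟨_, hvA⟩, subset_closure ⟨_, subset_closure ⟨0, E.zero_mem, rfl⟩, rfl⟩⟩
  have hF : StrictMono F := fun E E' h =>
    strictMono_map_quotient (strictMono_chartClosure hv₀ hv h)
  exact Order.krullDim_le_of_strictMono _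
    ((IrreducibleCloseds.orderIsoOfIsOpenEmbedding _ hA.isOpenEmbedding_subtypeVal).symm.strictMono.comp
      hF)

theorem IsGenericDenominator.topologicalKrullDim_eq {Δ : ProjForm n (∑ i, d i) → ℂ}
    (hΔ : IsGenericDenominator n d Δ) :
    topologicalKrullDim (LogComponent n d) = topologicalKrullDim (ParamSpace n d) := by
  obtain ⟨v, hvΔ⟩ := hΔ.exists_ne_zero
  have hvC := mem_paramCone_of_mu_ne_zero (hΔ.ne_zero _ hvΔ)
  obtain ⟨ℓ₀, hv₀⟩ := exists_dual_eq_one hvC.1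
  choose ℓ hv using fun i => exists_dual_eq_one (hvC.2 i)
  have h0 : chart hv₀ hv 0 = ParamSpace.proj n d ⟨v, hvC⟩ := by
    have : v + sliceIncl (LinearMap.ker ℓ₀) ℓ 0 = v := by rw [map_zero, add_zero]
    unfold chart
    congr 1
    exact Subtype.ext this
  refine le_antisymm
    ((topologicalKrullDim_logComponent_le hv₀ hv).trans
      (finrank_le_topologicalKrullDim_paramSpace hv₀ hv))
    ((topologicalKrullDim_paramSpace_le hv₀ hv).trans
      ((finrank_le_topologicalKrullDim_of_isOpen hv₀ hv hΔ.isOpen_genericQuot ?_).trans ?_))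
  · rw [h0]
    exact mk_mem_genericQuot.2 ⟨_, rfl, hvΔ⟩
  · rw [IsHomeomorph.topologicalKrullDim_eq _ hΔ.iso.toHomeomorph.isHomeomorph]
    exact topologicalKrullDim_subspace_le _ _

end LowerBound

end LogForms

end

theorem proposition6p1 (n m : ℕ) (d : Fin m → ℕ) (hn : 2 ≤ n) (hm : 2 ≤ m) (hd : ∀ i, 0 < d i)
    (h2 : m = 2 → ∀ i j, i ≠ j → ¬ d i ∣ d j) :
    (∃ V : Set (LogForms.LogComponent n d), IsOpen V ∧ Dense V ∧ V ⊆ Set.range (LogForms.rho n d) ∧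
      ∀ x x' : LogForms.rhoDomain n d, LogForms.rho n d x ∈ V →
        (LogForms.rho n d x = LogForms.rho n d x' ↔
          ∃ s : LogForms.degreePerm d, s • (x : LogForms.ParamSpace n d) = x')) ∧
    LogForms.BirationalModPerm n d ∧
    topologicalKrullDim (LogForms.LogComponent n d) =
      topologicalKrullDim (LogForms.ParamSpace n d) := by
  obtain ⟨Δ, hΔ⟩ := LogForms.exists_isGenericDenominator hn hm hd h2
  exact ⟨⟨LogForms.genericComp Δ, hΔ.isOpen_genericComp, hΔ.dense_genericComp,
    fun _ hy => hΔ.exists_rho_eq hy, fun _ _ hx => hΔ.rho_eq_iff hx⟩, hΔ.birationalModPerm,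
    hΔ.topologicalKrullDim_eq⟩
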